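/- All graphs are finite and simple. A vertex of a graph is a branch vertex if its degree is more than two, and a leaf of a tree is a vertex of degree at most one. A vertex is simplicial if its neighbourhood is a clique; $\mathcal{Z}(H)$ is the set of simplicial vertices of $H$. A path in a graph is an induced subgraph that is a path (possibly with a single vertex), and its length is its number of edges. A $\theta$-tuple $(p_1,\dots,p_\theta)$, $\theta\ge 1$, of vertices of a path $P$ is a $\sigma$-widening of $P$ if $p_1$ and $p_\theta$ are the ends of $P$, the vertices $p_1,\dots,p_\theta$ appear in this order when traversing $P$ from $p_1$ to $p_\theta$, and for all $i<\theta$ the subpath of $P$ from $p_i$ to $p_{i+1}$ has length at least $\sigma$. A subdivided star is a tree with at most one branch vertex. It is rooted by choosing a root $r$, which has to be the branch vertex unless the tree is a path. A stem is a path from a leaf to the root. A caterpillar is a tree of maximum degree three in which all branch vertices lie on a path; a spine of it is an inclusion-wise maximal path among those containing all branch vertices. For a leaf $l$ of a caterpillar, $v_l$ is the unique branch vertex such that the path from $l$ to $v_l$ contains no other branch vertex. A $\sigma$-caterpillar is a caterpillar whose set of leaves (of size $\theta\ge 3$) has an enumeration $(l_1,\dots,l_\theta)$ such that $(l_1,v_{l_2},\dots,v_{l_{\theta-1}},l_\theta)$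 is a $\sigma$-widening of some spine. Let $G$ be a graph, $S\subseteq V(G)$, and let $\eta,\sigma\ge 1$ be integers. An induced subgraph $H$ of $G$ is $(S,\eta)$-tied if $\mathcal{Z}(H)\subseteq V(H)\cap S$ and $|V(H)\cap S|=\eta$, and loosely $(S,\eta)$-tied if $\mathcal{Z}(H)=V(H)\cap S$ and $|V(H)\cap S|=\eta$. It is an $(S,\eta,\sigma)$-connectifier if one of the following holds: (C0) $H$ is loosely $(S,\eta)$-tied and is isomorphic to the line graph of a rooted subdivided star in which every stem has length at least $\sigma$; (C1) $H$ is $(S,\eta)$-tied and is a rooted subdivided star with some root $r$ in which every stem has length at least $\sigma$, and every vertex of $V(H)\cap S$ other than $r$ is a leaf of $H$; (C2) $H$ is $(S,\eta)$-tied and is a path, and $V(H)\cap S=\{s_1,\dots,s_\eta\}$ where $(s_1,\dots,s_\eta)$ is a $\sigma$-widening of $H$; (C3) $H$ is loosely $(S,\eta)$-tied and is a $\sigma$-caterpillar; (C4) $H$ is loosely $(S,\eta)$-tied and is isomorphic to the line graph of a $\sigma$-caterpillar. An $(S,\eta)$-connectifier is an $(S,\eta,1)$-connectifier. Theorem. For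 every integer $\eta\ge 1$ there exists an integer $\mu=\mu(\eta)\ge 1$ with the following property. Let $G$ be a graph and let $S\subseteq V(G)$ with $|S|\ge\mu$ be contained in a connected component of $G$. Then $G$ contains an $(S,\eta)$-connectifier $H$. In particular, $H$ is connected, $|V(H)\cap S|=\eta$, and every vertex of $V(H)\cap S$ has degree at most $\eta$ in $H$. -/

import Mathlib

universe u

namespace Connectifier

variable {W : Type u}

/- All graphs to which these definitions are applied are finite, so that `Set.ncard` is the
cardinality. -/

/-- The degree of a vertex. -/
noncomputable def deg (Γ : SimpleGraph W) (v : W) : ℕ := (Γ.neighborSet v).ncard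

/-- The set of branch vertices: the vertices of degree more than two. -/
def branchSet (Γ : SimpleGraph W) : Set W := {v | 2 < deg Γ v}

/-- The set of leaves (used for forests): the vertices of degree at most one. -/
def leafSet (Γ : SimpleGraph W) : Set W := {v | deg Γ v ≤ 1}

/-- The set of simplicial vertices: the vertices whose neighbourhood is a clique. -/
def simplicialSet (Γ : SimpleGraph W) : Set W := {v | Γ.IsClique (Γ.neighborSet v)}

/-- `P` is the vertex set of a path in `Γ` (an induced subgraph that is a path): its vertices can
be listed as `f 0, …, f m` with `f i` adjacent to `f j` if and only if `|i - j| = 1`. -/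
def IsPathIn (Γ : SimpleGraph W) (P : Set W) : Prop :=
  ∃ (m : ℕ) (f : SimpleGraph.pathGraph (m + 1) ↪g Γ), Set.range f = P

/-- `Q` is the vertex set of a path in `Γ` of length `m` with ends `a` and `b`. -/
def IsPathFromTo (Γ : SimpleGraph W) (Q : Set W) (m : ℕ) (a b : W) : Prop :=
  ∃ f : SimpleGraph.pathGraph (m + 1) ↪g Γ, Set.range f = Q ∧ f 0 = a ∧ f (Fin.last m) = b

/-- The tuple `(p 0, …, p (θ - 1))`, `θ ≥ 1`, is a `σ`-widening of the path `P` of `Γ`: its first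
and last entries are the ends of `P`, its entries appear in this order when `P` is traversed from
the first to the last (`p i` is the vertex number `k i` of this traversal `f`), and the subpath
between two consecutive entries has length at least `σ`. -/
def IsWidening (Γ : SimpleGraph W) (σ : ℕ) (P : Set W) {θ : ℕ} (p : Fin θ → W) : Prop :=
  0 < θ ∧ ∃ (m : ℕ) (f : SimpleGraph.pathGraph (m + 1) ↪g Γ) (k : Fin θ → Fin (m + 1)),
    Set.range f = P ∧ (∀ i, p i = f (k i)) ∧
    (∀ i : Fin θ, (i : ℕ) = 0 → (k i : ℕ) = 0) ∧
    (∀ i : Fin θ, (i : ℕ) + 1 = θ → (k i : ℕ) = m) ∧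
    (∀ i j : Fin θ, (i : ℕ) + 1 = (j : ℕ) → (k i : ℕ) + σ ≤ (k j : ℕ))

/-- A subdivided star: a tree with at most one branch vertex. -/
def IsSubdividedStar (Γ : SimpleGraph W) : Prop :=
  Γ.IsTree ∧ (branchSet Γ).Subsingleton

/-- A rooted subdivided star: if it is not a path, then the root is its unique branch vertex. -/
def IsRootedSubdividedStar (Γ : SimpleGraph W) (r : W) : Prop :=
  IsSubdividedStar Γ ∧ (¬ IsPathIn Γ Set.univ → r ∈ branchSet Γ)

/-- Every stem (path from a leaf to the root `r`) has length at least `σ`. -/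
def StemsAtLeast (Γ : SimpleGraph W) (r : W) (σ : ℕ) : Prop :=
  ∀ (Q : Set W) (m : ℕ) (l : W), l ∈ leafSet Γ → IsPathFromTo Γ Q m l r → σ ≤ m

/-- A caterpillar: a tree of maximum degree three all of whose branch vertices lie on a path. -/
def IsCaterpillar (Γ : SimpleGraph W) : Prop :=
  Γ.IsTree ∧ (∀ v, deg Γ v ≤ 3) ∧ (∃ v, deg Γ v = 3) ∧ ∃ P, IsPathIn Γ P ∧ branchSet Γ ⊆ P

/-- A spine: an inclusion-wise maximal path among those containing all branch vertices. -/
def IsSpine (Γ : SimpleGraph W) (P : Set W) : Prop :=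
  Maximal (fun Q : Set W => IsPathIn Γ Q ∧ branchSet Γ ⊆ Q) P

/-- `v` is a branch vertex and it is the only branch vertex on a path from `l` to `v`. In a
caterpillar every leaf `l` has exactly one such `v`, usually written `v_l`. -/
def IsBranchOfLeaf (Γ : SimpleGraph W) (l v : W) : Prop :=
  v ∈ branchSet Γ ∧ ∃ (Q : Set W) (m : ℕ), IsPathFromTo Γ Q m l v ∧ Q ∩ branchSet Γ = {v}

/-- `(l 0, …, l (θ - 1))`, `θ ≥ 3`, is a `σ`-wide enumeration of the leaves of a caterpillar: for
some spine `P`, the tuple `q` that has the same first and last entry as `l` and whose other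
entries are the branch vertices `v_{l i}` is a `σ`-widening of `P`. -/
def IsWideEnumeration (Γ : SimpleGraph W) (σ : ℕ) {θ : ℕ} (l : Fin θ → W) : Prop :=
  3 ≤ θ ∧ Function.Injective l ∧ Set.range l = leafSet Γ ∧
  ∃ (P : Set W) (q : Fin θ → W), IsSpine Γ P ∧ IsWidening Γ σ P q ∧
    (∀ i : Fin θ, ((i : ℕ) = 0 ∨ (i : ℕ) + 1 = θ) → q i = l i) ∧
    (∀ i : Fin θ, (i : ℕ) ≠ 0 → (i : ℕ) + 1 ≠ θ → IsBranchOfLeaf Γ (l i) (q i))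

/-- A `σ`-caterpillar: a caterpillar whose set of leaves admits a `σ`-wide enumeration. -/
def IsWideCaterpillar (Γ : SimpleGraph W) (σ : ℕ) : Prop :=
  IsCaterpillar Γ ∧ ∃ (θ : ℕ) (l : Fin θ → W), IsWideEnumeration Γ σ l

/-- For a graph `Γ` with vertex set `W`, where `T` is the set of vertices of `Γ` in `S`:
`Γ` is `(S, η)`-tied. -/
def IsTied (Γ : SimpleGraph W) (T : Set W) (η : ℕ) : Prop :=
  simplicialSet Γ ⊆ T ∧ T.ncard = η

/-- For a graph `Γ` with vertex set `W`, where `T` is the set of vertices of `Γ` in `S`: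
`Γ` is loosely `(S, η)`-tied. -/
def IsLooselyTied (Γ : SimpleGraph W) (T : Set W) (η : ℕ) : Prop :=
  simplicialSet Γ = T ∧ T.ncard = η

/-- A loosely tied line graph of a (rooted) subdivided star with all stems of length at least
`σ`. -/
def Type0 (Γ : SimpleGraph W) (T : Set W) (η σ : ℕ) : Prop :=
  IsLooselyTied Γ T η ∧ ∃ (U : Type u) (_ : Finite U) (K : SimpleGraph U) (r : U),
    IsRootedSubdividedStar K r ∧ StemsAtLeast K r σ ∧ Nonempty (Γ ≃g K.lineGraph)

/-- A tied rooted subdivided star with all stems of length at least `σ`, in which every vertex in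
`T` is a leaf or the root. -/
def Type1 (Γ : SimpleGraph W) (T : Set W) (η σ : ℕ) : Prop :=
  IsTied Γ T η ∧ ∃ r : W,
    IsRootedSubdividedStar Γ r ∧ StemsAtLeast Γ r σ ∧ T \ leafSet Γ ⊆ {r}

/-- A tied path for which `T` can be listed as a `σ`-widening. -/
def Type2 (Γ : SimpleGraph W) (T : Set W) (η σ : ℕ) : Prop :=
  IsTied Γ T η ∧ IsPathIn Γ Set.univ ∧
    ∃ s : Fin η → W, Set.range s = T ∧ IsWidening Γ σ Set.univ s

/-- A loosely tied `σ`-caterpillar. -/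
def Type3 (Γ : SimpleGraph W) (T : Set W) (η σ : ℕ) : Prop :=
  IsLooselyTied Γ T η ∧ IsWideCaterpillar Γ σ

/-- A loosely tied line graph of a `σ`-caterpillar. -/
def Type4 (Γ : SimpleGraph W) (T : Set W) (η σ : ℕ) : Prop :=
  IsLooselyTied Γ T η ∧ ∃ (U : Type u) (_ : Finite U) (C : SimpleGraph U),
    IsWideCaterpillar C σ ∧ Nonempty (Γ ≃g C.lineGraph)

/-- The subgraph of `G` induced by the vertex set `H` is an `(S, η, σ)`-connectifier. -/
def IsWideConnectifier {V : Type u} (G : SimpleGraph V) (S : Set V) (η σ : ℕ) (H : Set V) :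
    Prop :=
  Type0 (G.induce H) ((↑) ⁻¹' S) η σ ∨ Type1 (G.induce H) ((↑) ⁻¹' S) η σ ∨
  Type2 (G.induce H) ((↑) ⁻¹' S) η σ ∨ Type3 (G.induce H) ((↑) ⁻¹' S) η σ ∨
  Type4 (G.induce H) ((↑) ⁻¹' S) η σ

/-- The subgraph of `G` induced by the vertex set `H` is an `(S, η)`-connectifier. -/
def IsConnectifier {V : Type u} (G : SimpleGraph V) (S : Set V) (η : ℕ) (H : Set V) : Prop :=
  IsWideConnectifier G S η 1 H

end Connectifier

/-! Pass to a minimal connected induced subgraph containing `S`. It is tight (`IsTight`): deleting a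
nonempty set that misses `S` disconnects what remains. Two consequences carry the argument. If `Z`
is nonempty and connected, every component of `G - Z` meets `S`, since it could be deleted
otherwise; so it contains an induced path from the neighbourhood of `Z` to `S`, a leg
(`IsTight.exists_leg`). And if a vertex `p` of `Z` outside `S` does not separate the rest of `Z`,
some component of `G - p` avoids `Z` (`IsTight.exists_private`), which gives a leg that touches `Z`
only at `p`.

A vertex of huge degree has, by Ramsey, a large clique or a large independent set among its
neighbours. Private legs extend the clique to the line graph of a subdivided star, and the
independent set, with the centre, to a subdivided star (`exists_degree_bound`).

If the degrees are bounded, go away from a root in `S` along shortest paths, always keeping many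
vertices of `S` ahead. This gives an induced path with many vertices that are in `S` or have a
neighbour off the path (`exists_descent`). If `η` of its vertices are in `S`, a subpath is a
connectifier. Otherwise a stretch of the path free of `S` contains many widely spaced vertices with
neighbours off the path. Near each of them hangs a leg whose neighbours on the path are among two
consecutive vertices (`IsTight.exists_attachment`). For half of the legs the number of these
neighbours is the same: one neighbour each gives a caterpillar, two give the line graph of a
caterpillar (`IsAttached.hasModel`).

The target graphs are built once and for all as combs, trees given by a parent function. Identifying
each edge with its end farther from the root describes the line graph in the same coordinates. The
cases `η = 1` and `η = 2` are paths and are treated apart, since the other constructions need enough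
legs. -/

namespace Connectifier

/-! ### Trees given by parent functions, and their line graphs. -/

section ParentGraph

variable {U : Type u}

/-- The graph in which every vertex is joined to its parent. -/
def parentGraph (par : U → U) : SimpleGraph U where
  Adj x y := x ≠ y ∧ (par x = y ∨ par y = x)
  symm := ⟨fun _ _ h => ⟨h.1.symm, h.2.symm⟩⟩
  loopless := ⟨fun _ h => h.1 rfl⟩

/-- The graph on the vertices other than the root `r` in which `x` and `y` are adjacent if one is
the parent of the other or if they have the same parent. -/
def siblingGraph (par : U → U) (r : U) : SimpleGraph {x : U // x ≠ r} where
  Adj x y := x ≠ y ∧ (par x = y ∨ par y = x ∨ par x = par y)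
  symm := ⟨fun _ _ h => ⟨h.1.symm, by rcases h.2 with h | h | h <;> simp [h]⟩⟩
  loopless := ⟨fun _ h => h.1 rfl⟩

/-- `par` is the parent function of a tree with root `r`. -/
structure IsParentFun (par : U → U) (r : U) (rk : U → ℕ) : Prop where
  root : par r = r
  lt : ∀ x, x ≠ r → rk (par x) < rk x

variable {par : U → U} {r : U} {rk : U → ℕ}

theorem IsParentFun.ne (h : IsParentFun par r rk) {x : U} (hx : x ≠ r) : par x ≠ x :=
  fun e => by have := h.lt x hx; rw [e] at this; omega

theorem IsParentFun.ne_root (h : IsParentFun par r rk) {x y : U} (hx : x ≠ y) (e : par x = y) :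
    x ≠ r := by
  rintro rfl; exact hx (h.root.symm.trans e)

theorem IsParentFun.adj_par (h : IsParentFun par r rk) {x : U} (hx : x ≠ r) :
    (parentGraph par).Adj x (par x) := ⟨(h.ne hx).symm, Or.inl rfl⟩

theorem IsParentFun.reachable (h : IsParentFun par r rk) (x : U) :
    (parentGraph par).Reachable x r := by
  induction hn : rk x using Nat.strong_induction_on generalizing x with
  | _ n ih =>
    by_cases hx : x = r
    · rw [hx]
    · exact (h.adj_par hx).reachable.trans (ih _ (hn ▸ h.lt x hx) _ rfl)

theorem IsParentFun.connected (h : IsParentFun par r rk) : (parentGraph par).Connected :=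
  have : Nonempty U := ⟨r⟩
  ⟨fun x y => (h.reachable x).trans (h.reachable y).symm⟩

/-- The edge from a vertex to its parent. -/
def IsParentFun.edge (h : IsParentFun par r rk) (x : {x : U // x ≠ r}) :
    (parentGraph par).edgeSet := ⟨s(x.1, par x.1), h.adj_par x.2⟩

/-- Rank drops from a vertex to its parent, so an edge cannot be the parent edge of both of its
ends. -/
theorem IsParentFun.edge_bijective (h : IsParentFun par r rk) : Function.Bijective h.edge := by
  constructor
  · intro x y e
    have e := congrArg Subtype.val e
    simp only [IsParentFun.edge, Sym2.eq_iff] at e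
    rcases e with e | ⟨e1, e2⟩
    · exact Subtype.ext e.1
    · have h1 := h.lt _ x.2
      have h2 := h.lt _ y.2
      rw [← e1] at h2
      rw [e2] at h1
      omega
  · rintro ⟨e, he⟩
    induction e using Sym2.ind with
    | _ a b =>
      obtain ⟨hab, e | e⟩ := he
      · refine ⟨⟨a, h.ne_root hab e⟩, Subtype.ext ?_⟩
        simp [IsParentFun.edge, e]
      · refine ⟨⟨b, h.ne_root hab.symm e⟩, Subtype.ext ?_⟩
        simp [IsParentFun.edge, e, Sym2.eq_swap]

/-- The graph is connected, and its edges are counted by the vertices other than the root. -/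
theorem IsParentFun.isTree [Finite U] (h : IsParentFun par r rk) : (parentGraph par).IsTree := by
  rw [SimpleGraph.isTree_iff_connected_and_card]
  refine ⟨h.connected, ?_⟩
  rw [← Nat.card_congr (Equiv.ofBijective _ h.edge_bijective)]
  have h1 := Set.ncard_add_ncard_compl ({r} : Set U)
  rw [Set.ncard_singleton] at h1
  rw [← h1, add_comm]
  rfl

/-- Each edge is represented by its child end. Two parent edges meet if one child is the parent of
the other or if the parents coincide, which is the adjacency of `siblingGraph`. -/
theorem IsParentFun.nonempty_iso_lineGraph (h : IsParentFun par r rk) :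
    Nonempty (siblingGraph par r ≃g (parentGraph par).lineGraph) := by
  refine ⟨Equiv.ofBijective _ h.edge_bijective, ?_⟩
  intro x y
  have hne : h.edge x ≠ h.edge y ↔ x ≠ y := h.edge_bijective.1.ne_iff
  rw [SimpleGraph.lineGraph_adj_iff_exists]
  simp only [Equiv.ofBijective_apply, hne]
  refine and_congr_right fun hxy => ?_
  have hxy' : (x : U) ≠ y := fun e => hxy (Subtype.ext e)
  simp only [IsParentFun.edge, Sym2.mem_iff]
  constructor
  · rintro ⟨v, rfl | rfl, e | e⟩
    · exact absurd e hxy'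
    · exact Or.inr (Or.inl e.symm)
    · exact Or.inl e
    · exact Or.inr (Or.inr e)
  · rintro (e | e | e)
    · exact ⟨y, Or.inr e.symm, Or.inl rfl⟩
    · exact ⟨x, Or.inl rfl, Or.inr e.symm⟩
    · exact ⟨par x, Or.inr rfl, Or.inr e⟩

/-- Going from parent to parent ends in a child of the root, and the children of the root are
pairwise adjacent. -/
theorem IsParentFun.siblingGraph_connected (h : IsParentFun par r rk) {c : U} (hc : c ≠ r)
    (hcr : par c = r) : (siblingGraph par r).Connected := by
  have key : ∀ x : {x : U // x ≠ r}, (siblingGraph par r).Reachable x ⟨c, hc⟩ := by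
    intro x
    induction hn : rk x using Nat.strong_induction_on generalizing x with
    | _ n ih =>
      by_cases hx : par x = r
      · by_cases hxc : x = ⟨c, hc⟩
        · rw [hxc]
        · exact SimpleGraph.Adj.reachable ⟨hxc, Or.inr (Or.inr (hx.trans hcr.symm))⟩
      · have hadj : (siblingGraph par r).Adj x ⟨par x, hx⟩ :=
          ⟨fun e => h.ne x.2 (congrArg Subtype.val e).symm, Or.inl rfl⟩
        exact hadj.reachable.trans (ih _ (hn ▸ h.lt x x.2) ⟨par x, hx⟩ rfl)
  have : Nonempty {x : U // x ≠ r} := ⟨⟨c, hc⟩⟩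
  exact ⟨fun x y => (key x).trans (key y).symm⟩

/-- The vertex of largest rank in a triangle would have two different parents. -/
theorem IsParentFun.not_triangle (h : IsParentFun par r rk) {x a b : U}
    (ha : (parentGraph par).Adj x a) (hb : (parentGraph par).Adj x b) :
    ¬ (parentGraph par).Adj a b := by
  have key : ∀ {x a : U}, x ≠ a → par x = a → rk a < rk x := fun hxa e =>
    e ▸ h.lt _ (h.ne_root hxa e)
  rintro ⟨hab, hab'⟩
  obtain ⟨hxa, hxa'⟩ := ha
  obtain ⟨hxb, hxb'⟩ := hb
  rcases hxa' with e1 | e1 <;> rcases hxb' with e2 | e2 <;> rcases hab' with e3 | e3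
  all_goals first
    | exact hab (e1.symm.trans e2)
    | exact hxb (e1.symm.trans e3)
    | exact hxa (e2.symm.trans e3)
    | (first | have k1 := key hxa e1 | have k1 := key hxa.symm e1)
      (first | have k2 := key hxb e2 | have k2 := key hxb.symm e2)
      (first | have k3 := key hab e3 | have k3 := key hab.symm e3)
      omega

/-- A vertex other than the root that is the parent of no vertex. -/
def IsChildless (par : U → U) (r x : U) : Prop := x ≠ r ∧ ∀ y, y ≠ x → par y ≠ x

theorem one_lt_deg [Finite U] {Γ : SimpleGraph U} {x a b : U} (ha : Γ.Adj x a) (hb : Γ.Adj x b)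
    (hab : a ≠ b) : 1 < deg Γ x :=
  (Set.one_lt_ncard (Set.toFinite _)).2 ⟨a, ha, b, hb, hab⟩

theorem two_lt_deg [Finite U] {Γ : SimpleGraph U} {x a b c : U} (ha : Γ.Adj x a) (hb : Γ.Adj x b)
    (hc : Γ.Adj x c) (hab : a ≠ b) (hac : a ≠ c) (hbc : b ≠ c) : 2 < deg Γ x :=
  (Set.two_lt_ncard (Set.toFinite _)).2 ⟨a, ha, b, hb, c, hc, hab, hac, hbc⟩

theorem deg_le_of_subset [Finite U] {Γ : SimpleGraph U} {x : U} {A : Set U} {d : ℕ}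
    (h : ∀ y, Γ.Adj x y → y ∈ A) (hA : A.ncard ≤ d) : deg Γ x ≤ d :=
  (Set.ncard_le_ncard h (Set.toFinite _)).trans hA

theorem ncard_pair_le (a b : U) : ({a, b} : Set U).ncard ≤ 2 :=
  (Set.ncard_insert_le _ _).trans (by simp)

/-- The root has at least two children. -/
def RootBranches (par : U → U) (r : U) : Prop :=
  ∃ a b, a ≠ b ∧ a ≠ r ∧ b ≠ r ∧ par a = r ∧ par b = r

/-- A vertex other than the root that has a child also has its parent as a neighbour; only the root
needs two children. -/
theorem IsParentFun.exists_two_neighbors (h : IsParentFun par r rk) (hb : RootBranches par r)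
    {x : U} (hx : ¬ IsChildless par r x) :
    ∃ a b, a ≠ b ∧ (parentGraph par).Adj x a ∧ (parentGraph par).Adj x b := by
  by_cases hxr : x = r
  · subst hxr
    obtain ⟨a, b, hab, ha, hb, ea, eb⟩ := hb
    exact ⟨a, b, hab, ⟨ha.symm, Or.inr ea⟩, ⟨hb.symm, Or.inr eb⟩⟩
  · simp only [IsChildless, not_and, not_forall, not_not] at hx
    obtain ⟨y, hy, e⟩ := hx hxr
    refine ⟨y, par x, ?_, ⟨hy.symm, Or.inr e⟩, h.adj_par hxr⟩
    rintro rfl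
    have h1 := h.lt _ hxr
    have h2 := h.lt _ (h.ne_root hy e)
    rw [e] at h2
    omega

theorem IsChildless.eq_par {x : U} (hx : IsChildless par r x) {y : U}
    (hy : (parentGraph par).Adj x y) : y = par x := by
  rcases hy.2 with e | e
  · exact e.symm
  · exact absurd e (hx.2 y hy.1.symm)

theorem IsChildless.deg_le [Finite U] {x : U} (hx : IsChildless par r x) :
    deg (parentGraph par) x ≤ 1 :=
  deg_le_of_subset (A := {par x}) (fun _ hy => hx.eq_par hy) (by simp)

theorem IsParentFun.leafSet_eq [Finite U] (h : IsParentFun par r rk) (hb : RootBranches par r) :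
    leafSet (parentGraph par) = {x | IsChildless par r x} := by
  ext x
  refine ⟨fun hx => ?_, fun hx => hx.deg_le⟩
  by_contra hc
  obtain ⟨a, b, hab, ha, hb⟩ := h.exists_two_neighbors hb hc
  exact absurd (one_lt_deg ha hb hab) (not_lt.2 hx)

theorem IsParentFun.simplicialSet_eq (h : IsParentFun par r rk)
    (hb : RootBranches par r) :
    simplicialSet (parentGraph par) = {x | IsChildless par r x} := by
  ext x
  constructor
  · intro hx
    by_contra hc
    obtain ⟨a, b, hab, ha, hb⟩ := h.exists_two_neighbors hb hc
    exact h.not_triangle ha hb (hx ha hb hab)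
  · intro hx a ha b hb hab
    exact absurd ((hx.eq_par ha).trans (hx.eq_par hb).symm) hab

/-- If `x` has a child `z`, then the edge of `z` and an edge at the upper end of `x` (that of its
parent, or that of a sibling if `x` is a child of the root) are two nonadjacent neighbours of `x`.
If `x` is childless, all neighbouring edges share its upper end. -/
theorem IsParentFun.simplicialSet_siblingGraph_eq (h : IsParentFun par r rk)
    (hb : RootBranches par r) :
    simplicialSet (siblingGraph par r) = {x | IsChildless par r x.1} := by
  ext x
  constructor
  · intro hx
    by_contra hc
    simp only [IsChildless, Set.mem_ofPred_eq, not_and, not_forall, not_not] at hc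
    obtain ⟨z, hz, ez⟩ := hc x.2
    have hzr := h.ne_root hz ez
    have l1 := h.lt _ hzr
    have l2 := h.lt _ x.2
    have hxz : (siblingGraph par r).Adj x ⟨z, hzr⟩ :=
      ⟨fun e => hz (congrArg Subtype.val e).symm, Or.inr (Or.inl ez)⟩
    by_cases hxr : par x = r
    · obtain ⟨y, hy, hyr, ey⟩ : ∃ y, y ≠ x.1 ∧ y ≠ r ∧ par y = r := by
        obtain ⟨a, b, hab, ha, hb, ea, eb⟩ := hb
        by_cases hax : a = x.1
        · exact ⟨b, fun e => hab (hax.trans e.symm), hb, eb⟩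
        · exact ⟨a, hax, ha, ea⟩
      have hxy : (siblingGraph par r).Adj x ⟨y, hyr⟩ :=
        ⟨fun e => hy (congrArg Subtype.val e).symm, Or.inr (Or.inr (hxr.trans ey.symm))⟩
      have hzy : z ≠ y := by
        rintro rfl
        exact x.2 (ez.symm.trans ey)
      obtain ⟨-, e | e | e⟩ := hx hxz hxy (fun e => hzy (congrArg Subtype.val e))
      · exact hy (e.symm.trans ez)
      · exact hzr (e.symm.trans ey)
      · exact x.2 (ez.symm.trans (e.trans ey))
    · have hxp : (siblingGraph par r).Adj x ⟨par x, hxr⟩ :=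
        ⟨fun e => h.ne x.2 (congrArg Subtype.val e).symm, Or.inl rfl⟩
      have l3 := h.lt _ hxr
      rw [ez] at l1
      have hzy : z ≠ par x := by
        intro e
        rw [e] at l1
        omega
      obtain ⟨-, e | e | e⟩ := hx hxz hxp (fun e => hzy (congrArg Subtype.val e))
      · exact h.ne x.2 (e.symm.trans ez)
      · simp only at e
        rw [e] at l3
        omega
      · simp only at e
        rw [← e, ez] at l3
        omega
  · intro hx a ha b hb hab
    refine ⟨hab, ?_⟩
    have key : ∀ y : {x : U // x ≠ r}, (siblingGraph par r).Adj x y →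
        par x = y ∨ par x = par y := by
      rintro y ⟨hxy, e | e | e⟩
      · exact Or.inl e
      · exact absurd e (hx.2 _ fun e => hxy (Subtype.ext e.symm))
      · exact Or.inr e
    rcases key a ha with e1 | e1 <;> rcases key b hb with e2 | e2
    · exact absurd (Subtype.ext (e1.symm.trans e2)) hab
    · exact Or.inr (Or.inl (e2.symm.trans e1))
    · exact Or.inl (e1.symm.trans e2)
    · exact Or.inr (Or.inr (e1.symm.trans e2))

end ParentGraph

end Connectifier

namespace Connectifier

/-! ### Invariance under isomorphism, and models embedded in a graph. -/

section Iso

variable {W W' : Type u} {Γ : SimpleGraph W} {Γ' : SimpleGraph W'}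

theorem deg_iso (e : Γ ≃g Γ') (x : W) : deg Γ' (e x) = deg Γ x := by
  have : Γ'.neighborSet (e x) = e '' Γ.neighborSet x := by
    ext y
    constructor
    · intro hy
      exact ⟨e.symm y, by simpa [← e.map_adj_iff] using hy, by simp⟩
    · rintro ⟨z, hz, rfl⟩
      exact e.map_adj_iff.2 hz
  rw [deg, deg, this, Set.ncard_image_of_injective _ e.injective]

theorem mem_branchSet_iso (e : Γ ≃g Γ') (x : W) : e x ∈ branchSet Γ' ↔ x ∈ branchSet Γ := by
  change 2 < deg Γ' (e x) ↔ 2 < deg Γ x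
  rw [deg_iso]

theorem mem_leafSet_iso (e : Γ ≃g Γ') (x : W) : e x ∈ leafSet Γ' ↔ x ∈ leafSet Γ := by
  change deg Γ' (e x) ≤ 1 ↔ deg Γ x ≤ 1
  rw [deg_iso]

theorem mem_simplicialSet_iso (e : Γ ≃g Γ') (x : W) :
    e x ∈ simplicialSet Γ' ↔ x ∈ simplicialSet Γ := by
  constructor
  · intro h a ha b hb hab
    exact e.map_adj_iff.1 (h (e.map_adj_iff.2 ha) (e.map_adj_iff.2 hb) (e.injective.ne hab))
  · intro h a ha b hb hab
    obtain ⟨a, rfl⟩ := e.surjective a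
    obtain ⟨b, rfl⟩ := e.surjective b
    exact e.map_adj_iff.2 (h (e.map_adj_iff.1 ha) (e.map_adj_iff.1 hb) (fun h => hab (h ▸ rfl)))

theorem IsPathIn.iso (e : Γ ≃g Γ') {P : Set W} (h : IsPathIn Γ P) : IsPathIn Γ' (e '' P) := by
  obtain ⟨m, f, rfl⟩ := h
  exact ⟨m, f.trans e.toRelEmbedding, by
    rw [← Set.range_comp]; rfl⟩

theorem IsPathFromTo.iso (e : Γ ≃g Γ') {P : Set W} {m : ℕ} {a b : W}
    (h : IsPathFromTo Γ P m a b) : IsPathFromTo Γ' (e '' P) m (e a) (e b) := by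
  obtain ⟨f, rfl, rfl, rfl⟩ := h
  exact ⟨f.trans e.toRelEmbedding, by rw [← Set.range_comp]; rfl, rfl, rfl⟩

theorem IsWidening.iso (e : Γ ≃g Γ') {σ : ℕ} {P : Set W} {θ : ℕ} {p : Fin θ → W}
    (h : IsWidening Γ σ P p) : IsWidening Γ' σ (e '' P) (fun i => e (p i)) := by
  obtain ⟨h0, m, f, k, rfl, h1, h2⟩ := h
  exact ⟨h0, m, f.trans e.toRelEmbedding, k, by rw [← Set.range_comp]; rfl,
    fun i => congrArg e (h1 i), h2⟩

theorem image_branchSet_subset_iff (e : Γ ≃g Γ') (P : Set W) :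
    branchSet Γ' ⊆ e '' P ↔ branchSet Γ ⊆ P := by
  constructor
  · intro h x hx
    obtain ⟨y, hy, hyx⟩ := h ((mem_branchSet_iso e x).2 hx)
    exact e.injective hyx ▸ hy
  · intro h x hx
    obtain ⟨y, rfl⟩ := e.surjective x
    exact ⟨y, h ((mem_branchSet_iso e y).1 hx), rfl⟩

theorem image_symm_image (e : Γ ≃g Γ') (P : Set W') : e '' (e.symm '' P) = P := by
  ext x
  simp

theorem IsSpine.iso (e : Γ ≃g Γ') {P : Set W} (h : IsSpine Γ P) : IsSpine Γ' (e '' P) := by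
  refine ⟨⟨h.1.1.iso e, (image_branchSet_subset_iff e P).2 h.1.2⟩, ?_⟩
  intro Q hQ hPQ
  have h1 : IsPathIn Γ (e.symm '' Q) := hQ.1.iso e.symm
  have h2 : branchSet Γ ⊆ e.symm '' Q := (image_branchSet_subset_iff e.symm Q).2 hQ.2
  have h3 := h.2 ⟨h1, h2⟩ (fun x hx => ⟨e x, hPQ ⟨x, hx, rfl⟩, by simp⟩)
  rw [← image_symm_image e Q]
  exact Set.image_mono h3

theorem IsBranchOfLeaf.iso (e : Γ ≃g Γ') {l v : W} (h : IsBranchOfLeaf Γ l v) :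
    IsBranchOfLeaf Γ' (e l) (e v) := by
  obtain ⟨h1, Q, m, h2, h3⟩ := h
  refine ⟨(mem_branchSet_iso e v).2 h1, e '' Q, m, h2.iso e, ?_⟩
  rw [← Set.image_singleton, ← h3]
  ext x
  obtain ⟨x, rfl⟩ := e.surjective x
  simp [mem_branchSet_iso]

theorem IsWideEnumeration.iso (e : Γ ≃g Γ') {σ θ : ℕ} {l : Fin θ → W}
    (h : IsWideEnumeration Γ σ l) : IsWideEnumeration Γ' σ (fun i => e (l i)) := by
  obtain ⟨h1, h2, h3, P, q, h4, h5, h6, h7⟩ := h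
  refine ⟨h1, e.injective.comp h2, ?_, e '' P, fun i => e (q i), h4.iso e, h5.iso e,
    fun i hi => congrArg e (h6 i hi), fun i hi hi' => (h7 i hi hi').iso e⟩
  ext x
  obtain ⟨x, rfl⟩ := e.surjective x
  rw [mem_leafSet_iso, ← h3]
  simp

theorem IsWideCaterpillar.iso (e : Γ ≃g Γ') {σ : ℕ} (h : IsWideCaterpillar Γ σ) :
    IsWideCaterpillar Γ' σ := by
  obtain ⟨⟨h1, h2, ⟨v, h3⟩, P, h4, h5⟩, θ, l, h6⟩ := h
  refine ⟨⟨e.isTree_iff.1 h1, ?_, ⟨e v, by rw [deg_iso, h3]⟩, e '' P, h4.iso e,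
    (image_branchSet_subset_iff e P).2 h5⟩, θ, _, h6.iso e⟩
  intro x
  obtain ⟨x, rfl⟩ := e.surjective x
  rw [deg_iso]
  exact h2 x

theorem IsRootedSubdividedStar.iso (e : Γ ≃g Γ') {r : W} (h : IsRootedSubdividedStar Γ r) :
    IsRootedSubdividedStar Γ' (e r) := by
  refine ⟨⟨e.isTree_iff.1 h.1.1, ?_⟩, fun hn => ?_⟩
  · intro x hx y hy
    obtain ⟨x, rfl⟩ := e.surjective x
    obtain ⟨y, rfl⟩ := e.surjective y
    rw [mem_branchSet_iso] at hx hy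
    rw [h.1.2 hx hy]
  · rw [mem_branchSet_iso]
    refine h.2 fun hp => hn ?_
    have := hp.iso e
    rwa [Set.image_univ, e.surjective.range_eq] at this

theorem StemsAtLeast.iso (e : Γ ≃g Γ') {r : W} {σ : ℕ} (h : StemsAtLeast Γ r σ) :
    StemsAtLeast Γ' (e r) σ := by
  intro Q m l hl hQ
  have := hQ.iso e.symm
  rw [e.symm_apply_apply] at this
  exact h _ m _ ((mem_leafSet_iso e.symm l).2 hl) this

theorem ncard_preimage_iso (e : Γ ≃g Γ') (T' : Set W') : (e ⁻¹' T').ncard = T'.ncard := by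
  rw [← Set.ncard_image_of_injective _ e.injective, Set.image_preimage_eq _ e.surjective]

theorem IsTied.iso (e : Γ ≃g Γ') {T' : Set W'} {η : ℕ} (h : IsTied Γ (e ⁻¹' T') η) :
    IsTied Γ' T' η := by
  refine ⟨fun x hx => ?_, by rw [← ncard_preimage_iso e, h.2]⟩
  obtain ⟨x, rfl⟩ := e.surjective x
  exact h.1 ((mem_simplicialSet_iso e x).1 hx)

theorem IsLooselyTied.iso (e : Γ ≃g Γ') {T' : Set W'} {η : ℕ} (h : IsLooselyTied Γ (e ⁻¹' T') η) :
    IsLooselyTied Γ' T' η := by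
  refine ⟨?_, by rw [← ncard_preimage_iso e, h.2]⟩
  ext x
  obtain ⟨x, rfl⟩ := e.surjective x
  rw [mem_simplicialSet_iso, h.1]
  rfl

/-- `Γ`, with the set `T` of its vertices in `S`, is a connectifier with the additional
properties that a connectifier is expected to have. -/
structure IsModel (Γ : SimpleGraph W) (T : Set W) (η : ℕ) : Prop where
  type : Type0 Γ T η 1 ∨ Type1 Γ T η 1 ∨ Type2 Γ T η 1 ∨ Type3 Γ T η 1 ∨ Type4 Γ T η 1
  connected : Γ.Connected
  ncard_eq : T.ncard = η
  deg_le : ∀ v ∈ T, deg Γ v ≤ η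

theorem IsModel.iso (e : Γ ≃g Γ') {T' : Set W'} {η : ℕ} (h : IsModel Γ (e ⁻¹' T') η) :
    IsModel Γ' T' η := by
  obtain ⟨h1, h2, h3, h4⟩ := h
  refine ⟨?_, e.connected_iff.1 h2, by rw [← ncard_preimage_iso e, h3], ?_⟩
  · rcases h1 with ⟨ht, U, hU, K, r, hK, hr, ⟨i⟩⟩ | ⟨ht, r, hr, hs, hT⟩ | ⟨ht, hp, s, hs, hw⟩ | h |
      ⟨ht, U, hU, K, hK, ⟨i⟩⟩
    · exact Or.inl ⟨ht.iso e, U, hU, K, r, hK, hr, ⟨e.symm.trans i⟩⟩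
    · refine Or.inr (Or.inl ⟨ht.iso e, e r, hr.iso e, hs.iso e, ?_⟩)
      rintro x ⟨hx, hx'⟩
      obtain ⟨x, rfl⟩ := e.surjective x
      rw [mem_leafSet_iso] at hx'
      exact congrArg e (hT ⟨hx, hx'⟩)
    · refine Or.inr (Or.inr (Or.inl ⟨ht.iso e, ?_, fun i => e (s i), ?_, ?_⟩))
      · have := hp.iso e
        rwa [Set.image_univ, e.surjective.range_eq] at this
      · have : Set.range (fun i => e (s i)) = e '' Set.range s := by
          rw [← Set.range_comp]; rfl
        rw [this, hs, Set.image_preimage_eq _ e.surjective]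
      · have := hw.iso e
        rwa [Set.image_univ, e.surjective.range_eq] at this
    · exact Or.inr (Or.inr (Or.inr (Or.inl ⟨h.1.iso e, h.2.iso e⟩)))
    · exact Or.inr (Or.inr (Or.inr (Or.inr ⟨ht.iso e, U, hU, K, hK, ⟨e.symm.trans i⟩⟩)))
  · intro v hv
    obtain ⟨v, rfl⟩ := e.surjective v
    rw [deg_iso]
    exact h4 v hv

end Iso

/-- Some connectifier with the additional properties of `IsModel` embeds into `G`. -/
def HasModel {V : Type u} (G : SimpleGraph V) (S : Set V) (η : ℕ) : Prop :=
  ∃ (W : Type u) (Γ : SimpleGraph W) (φ : Γ ↪g G), IsModel Γ (φ ⁻¹' S) η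

theorem HasModel.of_induce {V : Type u} {G : SimpleGraph V} {S X : Set V} {η : ℕ}
    (h : HasModel (G.induce X) ((↑) ⁻¹' S) η) : HasModel G S η := by
  obtain ⟨W, Γ, φ, h⟩ := h
  exact ⟨W, Γ, φ.trans (SimpleGraph.Embedding.induce X), h⟩

theorem HasModel.exists_connectifier {V : Type u} {G : SimpleGraph V} {S : Set V} {η : ℕ}
    (h : HasModel G S η) :
    ∃ H : Set V, IsConnectifier G S η H ∧ (G.induce H).Connected ∧ (H ∩ S).ncard = η ∧
      ∀ v : H, (v : V) ∈ S → deg (G.induce H) v ≤ η := by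
  obtain ⟨W, Γ, φ, h⟩ := h
  let e : Γ ≃g G.induce (Set.range φ) :=
    ⟨Equiv.ofInjective φ φ.injective, fun {a b} => φ.map_adj_iff⟩
  have h' : IsModel (G.induce (Set.range φ)) ((↑) ⁻¹' S) η := IsModel.iso e h
  refine ⟨Set.range φ, h'.type, h'.connected, ?_, h'.deg_le⟩
  rw [← h'.ncard_eq, ← Set.ncard_image_of_injective _ Subtype.val_injective,
    Subtype.image_preimage_coe]

end Connectifier

/-! ### Combs as a common model of subdivided stars and caterpillars. -/

namespace Connectifier

/-- The data of a comb: a spine with vertices `0, …, m` and legs `1, …, n`; the leg `i` has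
`L i` vertices and is attached to the vertex `k i` of the spine. -/
structure Comb where
  n : ℕ
  m : ℕ
  L : ℕ → ℕ
  k : ℕ → ℕ
  L_pos : ∀ i, 0 < L i
  k_le : ∀ i, k i ≤ m

namespace Comb

variable (C : Comb)

/-- The vertices of a comb: `(0, j)` is a vertex of the spine, and `(i, j)` is the vertex of the
leg `i` at distance `j` from its first vertex. -/
@[ext]
structure Vert : Type u where
  i : ℕ
  j : ℕ
  valid : (i = 0 ∧ j ≤ C.m) ∨ (0 < i ∧ i ≤ C.n ∧ j < C.L i)

instance : Finite (Vert.{u} C) := by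
  let B := C.m + 1 + ∑ i ∈ Finset.range (C.n + 1), C.L i
  have hB : ∀ x : Vert.{u} C, x.i < C.n + 1 ∧ x.j < B := by
    rintro ⟨i, j, h | h⟩
    · simp only [B]; omega
    · have : C.L i ≤ ∑ i ∈ Finset.range (C.n + 1), C.L i :=
        Finset.single_le_sum (f := C.L) (fun _ _ => Nat.zero_le _)
          (Finset.mem_range.2 (by omega))
      simp only [B]; omega
  refine Finite.of_injective
    (fun x : Vert.{u} C => ((⟨x.i, (hB x).1⟩, ⟨x.j, (hB x).2⟩) : Fin (C.n + 1) × Fin B)) ?_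
  intro x y h
  simp only [Prod.mk.injEq, Fin.mk.injEq] at h
  exact Vert.ext h.1 h.2

/-- A vertex of the spine. -/
def spine (j : ℕ) (hj : j ≤ C.m) : Vert.{u} C := ⟨0, j, Or.inl ⟨rfl, hj⟩⟩

/-- A vertex of a leg. -/
def leg (i j : ℕ) (hi : 0 < i) (hn : i ≤ C.n) (hj : j < C.L i) : Vert.{u} C :=
  ⟨i, j, Or.inr ⟨hi, hn, hj⟩⟩

/-- The root of a comb: the first vertex of its spine. -/
def root : Vert.{u} C := C.spine 0 (Nat.zero_le _)

/-- The parent function of a comb. -/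
def par (x : Vert.{u} C) : Vert.{u} C where
  i := if x.j = 0 then 0 else x.i
  j := if x.i = 0 then x.j - 1 else if x.j = 0 then C.k x.i else x.j - 1
  valid := by
    have h1 := x.valid
    have h2 := C.k_le x.i
    split_ifs <;> omega

/-- The distance from the root. -/
def rk (x : Vert.{u} C) : ℕ := if x.i = 0 then x.j else C.k x.i + 1 + x.j

variable {C}

theorem ne_iff {x y : Vert.{u} C} : x ≠ y ↔ x.i ≠ y.i ∨ x.j ≠ y.j := by
  rw [Ne, Vert.ext_iff]; omega

theorem par_eq_iff {x y : Vert.{u} C} : C.par x = y ↔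
    (if x.j = 0 then 0 else x.i) = y.i ∧
    (if x.i = 0 then x.j - 1 else if x.j = 0 then C.k x.i else x.j - 1) = y.j := by
  rw [Vert.ext_iff]; rfl

theorem isParentFun : IsParentFun C.par (root.{u} C) C.rk := by
  constructor
  · rw [par_eq_iff]; simp [root, spine]
  · intro x hx
    rw [ne_iff] at hx
    simp only [root, spine] at hx
    simp only [rk, par]
    split_ifs <;> omega

variable (C) in
/-- The comb as a tree. -/
abbrev tree : SimpleGraph (Vert.{u} C) := parentGraph C.par

variable (C) in
/-- The line graph of a comb. -/
abbrev line : SimpleGraph {x : Vert.{u} C // x ≠ C.root} := siblingGraph C.par C.root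

/-- The adjacency of a comb in coordinates. -/
def TreeAdj (k : ℕ → ℕ) (i j i' j' : ℕ) : Prop :=
  (i = i' ∧ (j + 1 = j' ∨ j' + 1 = j)) ∨ (i = 0 ∧ 0 < i' ∧ j' = 0 ∧ j = k i') ∨
    (i' = 0 ∧ 0 < i ∧ j = 0 ∧ j' = k i)

/-- The adjacency of the line graph of a comb in coordinates. -/
def LineAdj (k : ℕ → ℕ) (i j i' j' : ℕ) : Prop :=
  (i = i' ∧ (j + 1 = j' ∨ j' + 1 = j)) ∨
    (i = 0 ∧ 0 < i' ∧ j' = 0 ∧ (j = k i' ∨ j = k i' + 1)) ∨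
    (i' = 0 ∧ 0 < i ∧ j = 0 ∧ (j' = k i ∨ j' = k i + 1)) ∨
    (0 < i ∧ 0 < i' ∧ i ≠ i' ∧ j = 0 ∧ j' = 0 ∧ k i = k i')

theorem tree_adj {x y : Vert.{u} C} : C.tree.Adj x y ↔ TreeAdj C.k x.i x.j y.i y.j := by
  change (x ≠ y ∧ (C.par x = y ∨ C.par y = x)) ↔ _
  rw [ne_iff, par_eq_iff, par_eq_iff, TreeAdj]
  obtain ⟨i, j, h⟩ := x
  obtain ⟨i', j', h'⟩ := y
  dsimp only
  split_ifs <;> constructor <;> intro hh <;> omega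

theorem line_adj_aux (k : ℕ → ℕ) {i j i' j' : ℕ} (_ : i ≠ 0 ∨ j ≠ 0) (_ : i' ≠ 0 ∨ j' ≠ 0) :
    ((i ≠ i' ∨ j ≠ j') ∧
      (((if j = 0 then 0 else i) = i' ∧
        (if i = 0 then j - 1 else if j = 0 then k i else j - 1) = j') ∨
      ((if j' = 0 then 0 else i') = i ∧
        (if i' = 0 then j' - 1 else if j' = 0 then k i' else j' - 1) = j) ∨
      ((if j = 0 then 0 else i) = (if j' = 0 then 0 else i') ∧
        (if i = 0 then j - 1 else if j = 0 then k i else j - 1) =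
        (if i' = 0 then j' - 1 else if j' = 0 then k i' else j' - 1)))) ↔
    LineAdj k i j i' j' := by
  rw [LineAdj]
  generalize k i = a at *
  generalize k i' = b at *
  by_cases hi : i = 0 <;> by_cases hi' : i' = 0 <;> by_cases hj : j = 0 <;>
    by_cases hj' : j' = 0 <;> simp [hi, hi', hj, hj', Nat.pos_iff_ne_zero] <;>
    omega

theorem line_adj {x y : {x : Vert.{u} C // x ≠ C.root}} :
    C.line.Adj x y ↔ LineAdj C.k x.1.i x.1.j y.1.i y.1.j := by
  change (x ≠ y ∧ (C.par x = y ∨ C.par y = x ∨ C.par x = C.par y)) ↔ _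
  rw [Ne, Subtype.ext_iff, ← Ne, ne_iff, par_eq_iff, par_eq_iff, par_eq_iff, LineAdj]
  obtain ⟨⟨i, j, h⟩, hx⟩ := x
  obtain ⟨⟨i', j', h'⟩, hy⟩ := y
  have hx' := ne_iff.1 hx
  have hy' := ne_iff.1 hy
  simp only [root, spine] at hx' hy'
  have := C.k_le i
  have := C.k_le i'
  exact line_adj_aux C.k hx' hy'

/-- `x` is the last vertex of a leg. -/
def IsTip (x : Vert.{u} C) : Prop := 0 < x.i ∧ x.j + 1 = C.L x.i

/-- The leg attached at `C.m` gives the last vertex of the spine a child; every other spine vertex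
has its successor as a child. -/
theorem isChildless_iff {i : ℕ} (hi : 0 < i) (hn : i ≤ C.n) (hk : C.k i = C.m) {x : Vert.{u} C} :
    IsChildless C.par C.root x ↔ IsTip x := by
  constructor
  · rintro ⟨-, h2⟩
    have hv := x.valid
    by_contra hc
    rw [IsTip] at hc
    rcases Nat.eq_zero_or_pos x.i with h0 | h0
    · rcases Nat.lt_or_ge x.j C.m with hj | hj
      · refine h2 (C.spine (x.j + 1) hj) (ne_iff.2 (Or.inr ?_)) (par_eq_iff.2 ?_) <;>
          simp [spine, h0]
      · refine h2 (C.leg i 0 hi hn (C.L_pos i)) (ne_iff.2 (Or.inl ?_)) (par_eq_iff.2 ?_) <;>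
          simp only [leg, if_true, if_neg hi.ne', h0, true_and]
        exacts [hi.ne', by omega]
    · refine h2 (C.leg x.i (x.j + 1) h0 (by omega) (by omega)) (ne_iff.2 (Or.inr ?_))
        (par_eq_iff.2 ?_) <;> simp [leg]
  · rintro ⟨h1, h2⟩
    refine ⟨ne_iff.2 (Or.inl (by simp [root, spine]; omega)), fun y hy hyx => ?_⟩
    rw [par_eq_iff] at hyx
    have hv := y.valid
    have hy' := ne_iff.1 hy
    have hp := C.L_pos y.i
    obtain ⟨e1, e2⟩ := hyx
    split_ifs at e1 e2
    all_goals try omega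
    rw [← e1] at h2
    omega

theorem ncard_isTip : {x : Vert.{u} C | IsTip x}.ncard = C.n := by
  have hL := C.L_pos
  refine Set.ncard_eq_of_bijective
    (fun i hi => C.leg (i + 1) (C.L (i + 1) - 1) (by omega) (by omega)
      (by have := hL (i + 1); omega)) ?_ ?_ ?_
  · rintro x ⟨h1, h2⟩
    have hv := x.valid
    refine ⟨x.i - 1, by omega, ?_⟩
    have e : x.i - 1 + 1 = x.i := by omega
    apply Vert.ext
    · simp only [leg]; omega
    · simp only [leg, e]; omega
  · intro i hi
    refine ⟨by simp [leg], ?_⟩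
    have := hL (i + 1)
    simp only [leg]; omega
  · intro i j hi hj e
    have := congrArg Vert.i e
    simpa [leg] using this

theorem ncard_isTip_line : {x : {x : Vert.{u} C // x ≠ C.root} | IsTip x.1}.ncard = C.n := by
  rw [← ncard_isTip.{u} (C := C), ← Set.ncard_image_of_injective _ Subtype.val_injective]
  congr 1
  ext x
  constructor
  · rintro ⟨y, hy, rfl⟩
    exact hy
  · intro hx
    refine ⟨⟨x, ne_iff.2 (Or.inl ?_)⟩, hx, rfl⟩
    have := hx.1
    simp only [root, spine]; omega

/-- An embedding of a comb from coordinates. -/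
theorem exists_tree_embedding {V : Type u} {G : SimpleGraph V} (F : ℕ → ℕ → V)
    (hinj : ∀ x y : Vert.{u} C, F x.i x.j = F y.i y.j → x.i = y.i ∧ x.j = y.j)
    (hadj : ∀ x y : Vert.{u} C, G.Adj (F x.i x.j) (F y.i y.j) ↔ TreeAdj C.k x.i x.j y.i y.j) :
    ∃ φ : tree.{u} C ↪g G, ∀ x, φ x = F x.i x.j :=
  ⟨⟨⟨fun x => F x.i x.j, fun x y h => Vert.ext (hinj x y h).1 (hinj x y h).2⟩,
    fun {x y} => (hadj x y).trans tree_adj.symm⟩, fun _ => rfl⟩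

theorem exists_line_embedding {V : Type u} {G : SimpleGraph V} (F : ℕ → ℕ → V)
    (hinj : ∀ x y : Vert.{u} C, x ≠ C.root → y ≠ C.root → F x.i x.j = F y.i y.j →
      x.i = y.i ∧ x.j = y.j)
    (hadj : ∀ x y : Vert.{u} C, x ≠ C.root → y ≠ C.root →
      (G.Adj (F x.i x.j) (F y.i y.j) ↔ LineAdj C.k x.i x.j y.i y.j)) :
    ∃ φ : line.{u} C ↪g G, ∀ x, φ x = F x.1.i x.1.j :=
  ⟨⟨⟨fun x => F x.1.i x.1.j, fun x y h => Subtype.ext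
      (Vert.ext (hinj x y x.2 y.2 h).1 (hinj x y x.2 y.2 h).2)⟩,
    fun {x y} => (hadj x y x.2 y.2).trans line_adj.symm⟩, fun _ => rfl⟩

end Comb

end Connectifier

/-! ### Paths in combs, and combs that are subdivided stars. -/

namespace Connectifier

theorem exists_pathGraph_embedding {W : Type u} {Γ : SimpleGraph W} {m : ℕ} (f : Fin (m + 1) → W)
    (hinj : ∀ a b, f a = f b → a.1 = b.1)
    (hadj : ∀ a b, Γ.Adj (f a) (f b) ↔ a.1 + 1 = b.1 ∨ b.1 + 1 = a.1) :
    ∃ φ : SimpleGraph.pathGraph (m + 1) ↪g Γ, ∀ a, φ a = f a :=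
  ⟨⟨⟨f, fun a b h => Fin.ext (hinj a b h)⟩,
    fun {a b} => (hadj a b).trans SimpleGraph.pathGraph_adj.symm⟩, fun _ => rfl⟩

/-- A larger path would have an edge leaving `P`. Its end in `P` would then have three neighbours on
that path, or, at an end of `P`, two neighbours although its degree is at most one. -/
theorem isSpine_of_forall {W : Type u} [Finite W] {Γ : SimpleGraph W} {P : Set W}
    (hP : IsPathIn Γ P) (hB : branchSet Γ ⊆ P)
    (h : ∀ x ∈ P, (∃ a ∈ P, ∃ b ∈ P, a ≠ b ∧ Γ.Adj x a ∧ Γ.Adj x b) ∨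
      (deg Γ x ≤ 1 ∧ ∃ a ∈ P, Γ.Adj x a)) : IsSpine Γ P := by
  refine ⟨⟨hP, hB⟩, ?_⟩
  rintro Q ⟨⟨M, g, rfl⟩, -⟩ hPQ
  by_contra hcon
  obtain ⟨_, ⟨t, rfl⟩, ht⟩ := Set.not_subset.1 hcon
  obtain ⟨m, f, rfl⟩ := hP
  obtain ⟨s, hs⟩ := hPQ ⟨0, rfl⟩
  obtain ⟨p⟩ := (SimpleGraph.pathGraph_connected M).preconnected s t
  obtain ⟨d, -, hd1, hd2⟩ := p.exists_boundary_dart (g ⁻¹' Set.range f) ⟨0, hs.symm⟩ ht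
  have hadj : Γ.Adj (g d.fst) (g d.snd) := g.map_adj_iff.2 d.adj
  have hne : ∀ a ∈ Set.range f, a ≠ g d.snd := fun a ha e => hd2 (show g d.snd ∈ _ from e ▸ ha)
  rcases h _ hd1 with ⟨a, ha, b, hb, hab, hxa, hxb⟩ | ⟨hdeg, a, ha, hxa⟩
  · have ha' := hne a ha
    have hb' := hne b hb
    obtain ⟨a, rfl⟩ := hPQ ha
    obtain ⟨b, rfl⟩ := hPQ hb
    rw [g.map_adj_iff, SimpleGraph.pathGraph_adj] at hxa hxb hadj
    rw [g.injective.ne_iff, Ne, Fin.ext_iff] at hab ha' hb'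
    omega
  · exact absurd (one_lt_deg hxa hadj (hne a ha)) (not_lt.2 hdeg)

namespace Comb

variable {C : Comb}

theorem deg_le_card {x : Vert.{u} C} (F : Finset (ℕ × ℕ))
    (h : ∀ y, C.tree.Adj x y → (y.i, y.j) ∈ F) : deg C.tree x ≤ F.card := by
  rw [deg, ← Set.ncard_coe_finset]
  refine Set.ncard_le_ncard_of_injOn (fun y => (y.i, y.j)) h ?_ F.finite_toSet
  intro y _ z _ e
  rw [Prod.mk.injEq] at e
  exact Vert.ext e.1 e.2

theorem deg_line_le_card {x : {x : Vert.{u} C // x ≠ C.root}} (F : Finset (ℕ × ℕ))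
    (h : ∀ y, C.line.Adj x y → (y.1.i, y.1.j) ∈ F) : deg C.line x ≤ F.card := by
  rw [deg, ← Set.ncard_coe_finset]
  refine Set.ncard_le_ncard_of_injOn (fun y => (y.1.i, y.1.j)) h ?_ F.finite_toSet
  intro y _ z _ e
  rw [Prod.mk.injEq] at e
  exact Subtype.ext (Vert.ext e.1 e.2)

theorem deg_le_two_of_leg {x : Vert.{u} C} (hx : 0 < x.i) : deg C.tree x ≤ 2 := by
  refine (deg_le_card {((C.par x).i, (C.par x).j), (x.i, x.j + 1)} fun y hy => ?_).trans
    Finset.card_le_two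
  rw [tree_adj, TreeAdj] at hy
  simp only [par, Finset.mem_insert, Finset.mem_singleton, Prod.mk.injEq]
  split_ifs <;> omega

variable (C) in
/-- The first and the last leg of a comb are attached to the ends of its spine. -/
structure IsLong : Prop where
  two_le : 2 ≤ C.n
  k_one : C.k 1 = 0
  k_n : C.k C.n = C.m

/-- The vertices of the path from the tip of the first leg to the tip of the last leg. -/
def longPath (hC : IsLong C) (x : Fin (C.L 1 + C.m + C.L C.n + 1)) : Vert.{u} C where
  i := if x.1 < C.L 1 then 1 else if x.1 ≤ C.L 1 + C.m then 0 else C.n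
  j := if x.1 < C.L 1 then C.L 1 - 1 - x.1 else if x.1 ≤ C.L 1 + C.m then x.1 - C.L 1
    else x.1 - C.L 1 - C.m - 1
  valid := by
    have h1 := hC.two_le
    have h2 := x.2
    have h3 := C.L_pos 1
    have h4 := C.L_pos C.n
    split_ifs
    · exact Or.inr (by omega)
    · omega
    · exact Or.inr (by omega)

theorem longPath_cases (hC : IsLong C) (x : Fin (C.L 1 + C.m + C.L C.n + 1)) :
    (x.1 < C.L 1 ∧ (longPath.{u} hC x).i = 1 ∧ (longPath.{u} hC x).j = C.L 1 - 1 - x.1) ∨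
    (C.L 1 ≤ x.1 ∧ x.1 ≤ C.L 1 + C.m ∧ (longPath.{u} hC x).i = 0 ∧
      (longPath.{u} hC x).j = x.1 - C.L 1) ∨
    (C.L 1 + C.m < x.1 ∧ (longPath.{u} hC x).i = C.n ∧
      (longPath.{u} hC x).j = x.1 - C.L 1 - C.m - 1) := by
  simp only [longPath]
  rcases Nat.lt_or_ge x.1 (C.L 1) with h | h
  · simp [h]
  · rcases Nat.lt_or_ge (C.L 1 + C.m) x.1 with h' | h'
    · simp [h', not_lt.2 h, not_le.2 h']
    · simp [h', h, not_lt.2 h]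

theorem exists_longPath (hC : IsLong C) :
    ∃ φ : SimpleGraph.pathGraph (C.L 1 + C.m + C.L C.n + 1) ↪g tree.{u} C,
      ∀ x, φ x = longPath hC x := by
  have h1 := hC.two_le
  have h2 := hC.k_one
  have h3 := hC.k_n
  have h4 := C.L_pos 1
  have h5 := C.L_pos C.n
  refine exists_pathGraph_embedding _ ?_ ?_
  · intro a b e
    have ha := a.2
    have hb := b.2
    rw [Vert.ext_iff] at e
    rcases longPath_cases.{u} hC a with ha | ha | ha <;>
      rcases longPath_cases.{u} hC b with hb | hb | hb <;> omega
  · intro a b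
    have ha := a.2
    have hb := b.2
    rw [tree_adj, TreeAdj]
    rcases longPath_cases.{u} hC a with ⟨ha1, ha2, ha3⟩ | ⟨ha0, ha1, ha2, ha3⟩ | ⟨ha1, ha2, ha3⟩ <;>
      rcases longPath_cases.{u} hC b with
        ⟨hb1, hb2, hb3⟩ | ⟨hb0, hb1, hb2, hb3⟩ | ⟨hb1, hb2, hb3⟩ <;>
      rw [ha2, ha3, hb2, hb3] <;> omega

theorem mem_range_longPath (hC : IsLong C) {x : Vert.{u} C} :
    x ∈ Set.range (longPath.{u} hC) ↔ x.i = 0 ∨ x.i = 1 ∨ x.i = C.n := by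
  have h1 := hC.two_le
  have h4 := C.L_pos 1
  have h5 := C.L_pos C.n
  constructor
  · rintro ⟨a, rfl⟩
    simp only [longPath]
    split_ifs <;> simp
  · have hv := x.valid
    rintro (h | h | h)
    · refine ⟨⟨C.L 1 + x.j, by omega⟩, Vert.ext ?_ ?_⟩ <;> simp only [longPath]
      · rw [if_neg (by omega), if_pos (by omega), h]
      · rw [if_neg (by omega), if_pos (by omega)]; omega
    · rw [h] at hv
      refine ⟨⟨C.L 1 - 1 - x.j, by omega⟩, Vert.ext ?_ ?_⟩ <;> simp only [longPath]
      · rw [if_pos (by omega), h]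
      · rw [if_pos (by omega)]; omega
    · rw [h] at hv
      refine ⟨⟨C.L 1 + C.m + 1 + x.j, by omega⟩, Vert.ext ?_ ?_⟩ <;> simp only [longPath]
      · rw [if_neg (by omega), if_neg (by omega), h]
      · rw [if_neg (by omega), if_neg (by omega)]; omega

theorem isPathIn_range_longPath (hC : IsLong C) :
    IsPathIn C.tree (Set.range (longPath.{u} hC)) := by
  obtain ⟨φ, hφ⟩ := exists_longPath.{u} hC
  exact ⟨_, φ, by rw [show (φ : _ → _) = longPath hC from funext hφ]⟩

variable (C) in
/-- A comb that is a subdivided star. -/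
structure IsStar : Prop where
  two_le : 2 ≤ C.n
  m_eq : C.m = 0

theorem IsStar.k_eq (hC : IsStar C) (i : ℕ) : C.k i = 0 := by
  have := C.k_le i
  have := hC.m_eq
  omega

theorem IsStar.isLong (hC : IsStar C) : IsLong C :=
  ⟨hC.two_le, hC.k_eq _, by rw [hC.k_eq, hC.m_eq]⟩

theorem IsStar.rootBranches (hC : IsStar C) : RootBranches C.par (root.{u} C) := by
  have h := hC.two_le
  refine ⟨C.leg 1 0 (by omega) (by omega) (C.L_pos 1), C.leg 2 0 (by omega) (by omega) (C.L_pos 2),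
    ?_, ?_, ?_, ?_, ?_⟩
  · simp [leg]
  · simp [leg, root, spine]
  · simp [leg, root, spine]
  · simp [par_eq_iff, leg, root, spine, hC.k_eq]
  · simp [par_eq_iff, leg, root, spine, hC.k_eq]

theorem IsStar.isChildless_iff (hC : IsStar C) {x : Vert.{u} C} :
    IsChildless C.par C.root x ↔ IsTip x :=
  Comb.isChildless_iff (i := C.n) (by have := hC.two_le; omega) le_rfl hC.isLong.k_n

theorem IsStar.pos_of_ne (hC : IsStar C) {x : Vert.{u} C} (hx : x ≠ C.root) : 0 < x.i := by
  have := hC.m_eq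
  have := x.valid
  have := ne_iff.1 hx
  simp only [root, spine] at this
  omega

/-- With three legs the root is a branch vertex. With exactly two legs the comb is a path, and
nothing is required of the root. -/
theorem IsStar.isRootedSubdividedStar (hC : IsStar C) :
    IsRootedSubdividedStar C.tree (root.{u} C) := by
  have hroot : ∀ x ∈ branchSet (tree.{u} C), x = C.root := by
    intro x hx
    by_contra hne
    exact absurd (deg_le_two_of_leg (hC.pos_of_ne hne)) (not_le.2 hx)
  refine ⟨⟨isParentFun.isTree, fun x hx y hy => (hroot x hx).trans (hroot y hy).symm⟩, ?_⟩
  intro hn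
  have h2 := hC.two_le
  rcases h2.lt_or_eq with h3 | h3
  · have key : ∀ i (h0 : 0 < i) (h1 : i ≤ C.n),
        C.tree.Adj (root.{u} C) (C.leg i 0 h0 h1 (C.L_pos i)) := by
      intro i h0 h1
      rw [tree_adj, TreeAdj]
      simp [root, spine, leg, hC.k_eq, h0]
    exact two_lt_deg (key 1 (by omega) (by omega)) (key 2 (by omega) (by omega))
      (key 3 (by omega) (by omega)) (by simp [leg]) (by simp [leg]) (by simp [leg])
  · refine absurd ?_ hn
    convert isPathIn_range_longPath.{u} hC.isLong
    symm
    rw [Set.eq_univ_iff_forall]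
    intro x
    rw [mem_range_longPath]
    have := x.valid
    omega

/-- A stem of length zero would make the root a leaf, but the root has two children. -/
theorem IsStar.stemsAtLeast (hC : IsStar C) : StemsAtLeast C.tree (root.{u} C) 1 := by
  rintro Q m l hl ⟨f, -, h0, h1⟩
  by_contra hm
  obtain rfl : m = 0 := by omega
  rw [isParentFun.leafSet_eq hC.rootBranches] at hl
  have e : l = C.root := h0.symm.trans h1
  exact hl.1 e

/-- The root may or may not be in `T`; its degree is at most the number of legs, hence the
assumption `C.n ≤ η`. -/
theorem IsStar.isModel_tree (hC : IsStar C) {T : Set (Vert.{u} C)} {η : ℕ}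
    (h1 : ∀ x, IsTip x → x ∈ T) (h2 : ∀ x ∈ T, IsTip x ∨ x = C.root) (hT : T.ncard = η)
    (hη : C.n ≤ η) : IsModel C.tree T η := by
  have hleaf := isParentFun.leafSet_eq hC.rootBranches.{u}
  refine ⟨Or.inr (Or.inl ⟨⟨?_, hT⟩, C.root, hC.isRootedSubdividedStar, hC.stemsAtLeast, ?_⟩),
    isParentFun.connected, hT, fun v hv => ?_⟩
  · rw [isParentFun.simplicialSet_eq hC.rootBranches]
    exact fun x hx => h1 x (hC.isChildless_iff.1 hx)
  · rintro x ⟨hx, hx'⟩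
    rw [hleaf] at hx'
    exact (h2 x hx).resolve_left fun ht => hx' (hC.isChildless_iff.2 ht)
  · rcases h2 v hv with h | rfl
    · exact (hC.isChildless_iff.2 h).deg_le.trans ((one_le_two.trans hC.two_le).trans hη)
    · refine (deg_le_card ((Finset.Icc 1 C.n) ×ˢ {0}) fun y hy => ?_).trans ?_
      · rw [tree_adj, TreeAdj] at hy
        have := y.valid
        have := hC.m_eq
        simp only [root, spine] at hy
        simp only [Finset.mem_product, Finset.mem_Icc, Finset.mem_singleton]
        omega
      · simpa using hη

theorem IsStar.isModel_line (hC : IsStar C) {T : Set {x : Vert.{u} C // x ≠ C.root}}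
    (h1 : ∀ x, x ∈ T ↔ IsTip x.1) : IsModel C.line T C.n := by
  have hT : T = {x | IsTip x.1} := by ext x; exact h1 x
  have hn : T.ncard = C.n := by rw [hT, ncard_isTip_line]
  refine ⟨Or.inl ⟨⟨?_, hn⟩, Vert.{u} C, inferInstance, C.tree, C.root, hC.isRootedSubdividedStar,
    hC.stemsAtLeast, isParentFun.nonempty_iso_lineGraph⟩, ?_, hn, fun v hv => ?_⟩
  · rw [isParentFun.simplicialSet_siblingGraph_eq hC.rootBranches, hT]
    ext x
    exact hC.isChildless_iff
  · obtain ⟨a, b, hab, ha, hb, ea, eb⟩ := hC.rootBranches.{u}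
    exact isParentFun.siblingGraph_connected ha ea
  · have htip := (h1 v).1 hv
    rw [IsTip] at htip
    have hn := hC.two_le
    rcases Nat.eq_zero_or_pos v.1.j with h0 | h0
    -- A leg with a single vertex: its tip lies in the central clique, which has one vertex per leg.
    · refine (deg_line_le_card ((Finset.Icc 1 C.n) ×ˢ {0}) fun y hy => ?_).trans (by simp)
      rw [line_adj, LineAdj] at hy
      have h3 := y.1.valid
      have h4 := hC.pos_of_ne y.2
      simp only [Finset.mem_product, Finset.mem_Icc, Finset.mem_singleton]
      rcases hy with ⟨e, hy⟩ | hy | hy | hy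
      · rw [← e] at h3
        omega
      all_goals omega
    · refine (deg_line_le_card {(v.1.i, v.1.j - 1)} fun y hy => ?_).trans (by simp; omega)
      rw [line_adj, LineAdj] at hy
      have h3 := y.1.valid
      have h4 := hC.pos_of_ne y.2
      simp only [Finset.mem_singleton, Prod.mk.injEq]
      rcases hy with ⟨e, hy⟩ | hy | hy | hy
      · rw [← e] at h3
        omega
      all_goals omega

end Comb

end Connectifier

/-! ### Combs that are caterpillars. -/

namespace Connectifier

namespace Comb

variable {C : Comb}

variable (C) in
/-- A comb that is a caterpillar. -/
structure IsCat : Prop where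
  three_le : 3 ≤ C.n
  k_one : C.k 1 = 0
  k_n : C.k C.n = C.m
  k_lt : ∀ i i', 1 ≤ i → i < i' → i' ≤ C.n → C.k i < C.k i'

theorem IsCat.isLong (hC : IsCat C) : IsLong C :=
  ⟨by have := hC.three_le; omega, hC.k_one, hC.k_n⟩

theorem IsCat.two_le_m (hC : IsCat C) : 2 ≤ C.m := by
  have h := hC.three_le
  have h1 := hC.k_lt 1 2 (by omega) (by omega) (by omega)
  have h2 := hC.k_lt 2 C.n (by omega) (by omega) (by omega)
  have := hC.k_n
  omega

theorem IsCat.k_inj (hC : IsCat C) {i i' : ℕ} (hi : 0 < i) (hn : i ≤ C.n) (hi' : 0 < i')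
    (hn' : i' ≤ C.n) (h : C.k i = C.k i') : i = i' := by
  by_contra hne
  rcases lt_or_gt_of_ne hne with h' | h'
  · exact absurd h (hC.k_lt i i' hi h' hn').ne
  · exact absurd h (hC.k_lt i' i hi' h' hn).ne'

theorem IsCat.rootBranches (hC : IsCat C) : RootBranches C.par (root.{u} C) := by
  have h := hC.three_le
  have hm := hC.two_le_m
  refine ⟨C.leg 1 0 (by omega) (by omega) (C.L_pos 1), C.spine 1 (by omega), ?_, ?_, ?_, ?_, ?_⟩
  · simp [leg, spine]
  · simp [leg, root, spine]
  · simp [root, spine]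
  · simp [par_eq_iff, leg, root, spine, hC.k_one]
  · simp [par_eq_iff, root, spine]

theorem IsCat.isChildless_iff (hC : IsCat C) {x : Vert.{u} C} :
    IsChildless C.par C.root x ↔ IsTip x :=
  Comb.isChildless_iff (i := C.n) (by have := hC.three_le; omega) le_rfl hC.k_n

theorem IsCat.leafSet_eq (hC : IsCat C) : leafSet (tree.{u} C) = {x | IsTip x} := by
  rw [isParentFun.leafSet_eq hC.rootBranches]
  ext x
  exact hC.isChildless_iff

/-- The places `k i` are distinct, so a spine vertex carries at most one leg besides its two
neighbours on the spine. -/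
theorem IsCat.deg_le_three (hC : IsCat C) (x : Vert.{u} C) : deg C.tree x ≤ 3 := by
  rcases Nat.eq_zero_or_pos x.i with h0 | h0
  · by_cases hk : ∃ i, 0 < i ∧ i ≤ C.n ∧ x.j = C.k i
    · obtain ⟨i, hi, hn, hj⟩ := hk
      refine (deg_le_card {(0, x.j - 1), (0, x.j + 1), (i, 0)} fun y hy => ?_).trans
        Finset.card_le_three
      rw [tree_adj, TreeAdj, h0] at hy
      have hv := y.valid
      simp only [Finset.mem_insert, Finset.mem_singleton, Prod.mk.injEq]
      rcases hy with hy | ⟨-, hy1, hy2, hy3⟩ | hy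
      · omega
      · have := hC.k_inj hi hn hy1 (by omega) (hj.symm.trans hy3)
        omega
      · omega
    · refine (deg_le_card {(0, x.j - 1), (0, x.j + 1)} fun y hy => ?_).trans
        (Finset.card_le_two.trans (by omega))
      rw [tree_adj, TreeAdj, h0] at hy
      have hv := y.valid
      simp only [Finset.mem_insert, Finset.mem_singleton, Prod.mk.injEq]
      rcases hy with hy | ⟨-, hy1, hy2, hy3⟩ | hy
      · omega
      · exact absurd ⟨y.i, hy1, by omega, hy3⟩ hk
      · omega
  · exact (deg_le_two_of_leg h0).trans (by omega)

/-- Legs `1` and `n` merely prolong the spine at its two ends, so they create no branch vertices;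
each other leg creates one. -/
theorem IsCat.mem_branchSet_iff (hC : IsCat C) {x : Vert.{u} C} :
    x ∈ branchSet (tree.{u} C) ↔ x.i = 0 ∧ ∃ i, 1 < i ∧ i < C.n ∧ x.j = C.k i := by
  have h3 := hC.three_le
  have hm := hC.two_le_m
  constructor
  · intro hx
    have hx : 2 < deg C.tree x := hx
    have h0 : x.i = 0 := by
      by_contra h0
      exact absurd (deg_le_two_of_leg (Nat.pos_of_ne_zero h0)) (not_le.2 hx)
    refine ⟨h0, ?_⟩
    by_contra hk
    refine absurd hx (not_lt.2 ?_)
    by_cases hj0 : x.j = 0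
    · refine (deg_le_card {(0, 1), (1, 0)} fun y hy => ?_).trans Finset.card_le_two
      rw [tree_adj, TreeAdj, h0, hj0] at hy
      have hv := y.valid
      simp only [Finset.mem_insert, Finset.mem_singleton, Prod.mk.injEq]
      rcases hy with hy | ⟨-, hy1, hy2, hy3⟩ | hy
      · omega
      · have := hC.k_inj (i := 1) (by omega) (by omega) hy1 (by omega) (by rw [hC.k_one, hy3])
        omega
      · omega
    -- At the end of the spine, the first vertex of the last leg takes the place of the missing
    -- successor.
    · refine (deg_le_card {(0, x.j - 1), if x.j = C.m then (C.n, 0) else (0, x.j + 1)}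
        fun y hy => ?_).trans Finset.card_le_two
      rw [tree_adj, TreeAdj, h0] at hy
      have hv := y.valid
      have hxv := x.valid
      simp only [Finset.mem_insert, Finset.mem_singleton, Prod.mk.injEq]
      rcases hy with hy | ⟨-, hy1, hy2, hy3⟩ | hy
      · split_ifs <;> simp only [Prod.mk.injEq] <;> omega
      · have h1 : y.i ≠ 1 := by
          intro e
          rw [e, hC.k_one] at hy3
          exact hj0 hy3
        have h2 : y.i = C.n := by
          by_contra hne
          exact hk ⟨y.i, by omega, by omega, hy3⟩
        rw [h2, hC.k_n] at hy3
        rw [if_pos hy3, Prod.mk.injEq]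
        omega
      · omega
  · rintro ⟨h0, i, hi, hn, hj⟩
    have h1 := hC.k_lt 1 i (by omega) (by omega) (by omega)
    have h2 := hC.k_lt i C.n (by omega) (by omega) (by omega)
    have h4 := hC.k_n
    refine two_lt_deg (a := C.spine (x.j - 1) (by omega)) (b := C.spine (x.j + 1) (by omega))
      (c := C.leg i 0 (by omega) (by omega) (C.L_pos i)) ?_ ?_ ?_ ?_ ?_ ?_
    · exact tree_adj.2 (Or.inl ⟨h0, Or.inr (by simp only [spine]; omega)⟩)
    · exact tree_adj.2 (Or.inl ⟨h0, Or.inl rfl⟩)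
    · exact tree_adj.2 (Or.inr (Or.inl ⟨h0, by simp only [leg]; omega, rfl, hj⟩))
    · exact ne_iff.2 (Or.inr (by simp only [spine]; omega))
    · exact ne_iff.2 (Or.inl (by simp only [spine, leg]; omega))
    · exact ne_iff.2 (Or.inl (by simp only [spine, leg]; omega))

/-- The path from the tip of the first leg to that of the last leg contains the whole comb spine.
Its ends are leaves, so it cannot be prolonged. -/
theorem IsCat.isSpine (hC : IsCat C) :
    IsSpine (tree.{u} C) (Set.range (longPath.{u} hC.isLong)) := by
  refine isSpine_of_forall (isPathIn_range_longPath _) ?_ ?_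
  · intro x hx
    rw [mem_range_longPath]
    exact Or.inl (hC.mem_branchSet_iff.1 hx).1
  · obtain ⟨φ, hφ⟩ := exists_longPath.{u} hC.isLong
    have h1 := C.L_pos 1
    have h2 := C.L_pos C.n
    have hadj : ∀ a b, (tree.{u} C).Adj (longPath hC.isLong a) (longPath hC.isLong b) ↔
        a.1 + 1 = b.1 ∨ b.1 + 1 = a.1 := by
      intro a b
      rw [← hφ, ← hφ, φ.map_adj_iff, SimpleGraph.pathGraph_adj]
    rintro _ ⟨a, rfl⟩
    have ha := a.2
    by_cases h0 : a.1 = 0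
    · right
      refine ⟨?_, _, ⟨⟨1, by omega⟩, rfl⟩, (hadj _ _).2 (by simp [h0])⟩
      refine (hC.isChildless_iff.2 ?_).deg_le
      have := longPath_cases.{u} hC.isLong a
      rw [IsTip]
      rcases this with ⟨_, e1, e2⟩ | h | h
      · rw [e1, e2]; omega
      all_goals omega
    · by_cases hl : a.1 = C.L 1 + C.m + C.L C.n
      · right
        refine ⟨?_, _, ⟨⟨a.1 - 1, by omega⟩, rfl⟩, (hadj _ _).2 (by simp; omega)⟩
        refine (hC.isChildless_iff.2 ?_).deg_le
        have := longPath_cases.{u} hC.isLong a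
        have h3 := hC.three_le
        rw [IsTip]
        rcases this with h | h | ⟨_, e1, e2⟩
        · omega
        · omega
        · rw [e1, e2]; omega
      · left
        refine ⟨_, ⟨⟨a.1 - 1, by omega⟩, rfl⟩, _, ⟨⟨a.1 + 1, by omega⟩, rfl⟩, ?_,
          (hadj _ _).2 (by simp; omega), (hadj _ _).2 (by simp)⟩
        rw [← hφ, ← hφ, φ.injective.ne_iff, Ne, Fin.ext_iff]
        simp only
        omega

/-- The last vertex of a leg. -/
def tip (i : ℕ) (hi : 0 < i) (hn : i ≤ C.n) : Vert.{u} C :=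
  C.leg i (C.L i - 1) hi hn (by have := C.L_pos i; omega)

theorem IsCat.isBranchOfLeaf (hC : IsCat C) {i : ℕ} (hi : 1 < i) (hn : i < C.n) :
    IsBranchOfLeaf (tree.{u} C) (tip i (by omega) hn.le) (C.spine (C.k i) (C.k_le i)) := by
  have hL := C.L_pos i
  refine ⟨hC.mem_branchSet_iff.2 ⟨rfl, i, hi, hn, rfl⟩, ?_⟩
  -- The leg `i` traversed from its tip, followed by the spine vertex to which it is attached; the
  -- latter is the only vertex outside the leg and the only branch vertex.
  let f : Fin (C.L i + 1) → Vert.{u} C := fun x =>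
    if h : x.1 < C.L i then C.leg i (C.L i - 1 - x.1) (by omega) hn.le (by omega)
    else C.spine (C.k i) (C.k_le i)
  have hf : ∀ x, (x.1 < C.L i ∧ (f x).i = i ∧ (f x).j = C.L i - 1 - x.1) ∨
      (x.1 = C.L i ∧ (f x).i = 0 ∧ (f x).j = C.k i) := by
    intro x
    have hx := x.2
    by_cases h : x.1 < C.L i
    · left; simp [f, h, leg]
    · right; simp [f, h, spine]; omega
  obtain ⟨φ, hφ⟩ := exists_pathGraph_embedding (Γ := tree.{u} C) f (by
      intro a b e
      rw [Vert.ext_iff] at e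
      rcases hf a with ha | ha <;> rcases hf b with hb | hb <;> omega) (by
      intro a b
      rw [tree_adj, TreeAdj]
      rcases hf a with ⟨ha1, ha2, ha3⟩ | ⟨ha1, ha2, ha3⟩ <;>
        rcases hf b with ⟨hb1, hb2, hb3⟩ | ⟨hb1, hb2, hb3⟩ <;>
        rw [ha2, ha3, hb2, hb3] <;> omega)
  have hlast : φ (Fin.last _) = C.spine (C.k i) (C.k_le i) := by
    rw [hφ]; simp [f]
  refine ⟨Set.range φ, C.L i, ⟨φ, rfl, ?_, hlast⟩, ?_⟩
  · rw [hφ]; simp [f, hL, tip]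
  · ext x
    rw [Set.mem_singleton_iff]
    constructor
    · rintro ⟨⟨a, rfl⟩, ha⟩
      rw [hC.mem_branchSet_iff, hφ] at ha
      rw [hφ]
      rcases hf a with h | h
      · omega
      · exact Vert.ext h.2.1 h.2.2
    · rintro rfl
      exact ⟨⟨_, hlast⟩, hC.mem_branchSet_iff.2 ⟨rfl, i, hi, hn, rfl⟩⟩

theorem IsCat.isWideCaterpillar (hC : IsCat C) : IsWideCaterpillar (tree.{u} C) 1 := by
  have h3 := hC.three_le
  have hL1 := C.L_pos 1
  have hLn := C.L_pos C.n
  have hk2 : C.k 2 ≤ C.m := C.k_le 2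
  refine ⟨⟨isParentFun.isTree, hC.deg_le_three,
    ⟨C.spine (C.k 2) hk2, le_antisymm (hC.deg_le_three _)
      (hC.mem_branchSet_iff.2 ⟨rfl, 2, by omega, by omega, rfl⟩)⟩, _, hC.isSpine.1⟩, ?_⟩
  let l : Fin C.n → Vert.{u} C := fun i => tip (i.1 + 1) (by omega) (by omega)
  let q : Fin C.n → Vert.{u} C := fun i =>
    if i.1 = 0 ∨ i.1 + 1 = C.n then l i else C.spine (C.k (i.1 + 1)) (C.k_le _)
  refine ⟨C.n, l, h3, ?_, ?_, Set.range (longPath.{u} hC.isLong), q, hC.isSpine, ?_,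
    fun i hi => if_pos hi, ?_⟩
  · intro i j e
    have := congrArg Vert.i e
    simpa [l, tip, leg, Fin.ext_iff] using this
  · rw [hC.leafSet_eq]
    ext x
    constructor
    · rintro ⟨i, rfl⟩
      have := C.L_pos (i.1 + 1)
      refine ⟨?_, ?_⟩ <;> simp only [l, tip, leg] <;> omega
    · rintro ⟨hx1, hx2⟩
      have hv := x.valid
      have e : x.i - 1 + 1 = x.i := by omega
      refine ⟨⟨x.i - 1, by omega⟩, Vert.ext ?_ ?_⟩ <;> simp only [l, tip, leg, e]
      omega
  · obtain ⟨φ, hφ⟩ := exists_longPath.{u} hC.isLong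
    -- Positions on the long path: the `C.L 1` vertices of the first leg come first, so the spine
    -- vertex `j` has position `C.L 1 + j`.
    let κ : Fin C.n → Fin (C.L 1 + C.m + C.L C.n + 1) := fun i =>
      if i.1 = 0 then 0 else if i.1 + 1 = C.n then Fin.last _
      else ⟨C.L 1 + C.k (i.1 + 1), by have := C.k_le (i.1 + 1); omega⟩
    have hκ : ∀ i, (i.1 = 0 ∧ (κ i).1 = 0) ∨
        (i.1 + 1 = C.n ∧ (κ i).1 = C.L 1 + C.m + C.L C.n) ∨
        (i.1 ≠ 0 ∧ i.1 + 1 ≠ C.n ∧ (κ i).1 = C.L 1 + C.k (i.1 + 1)) := by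
      intro i
      by_cases h0 : i.1 = 0
      · simp [κ, h0]
      · by_cases h1 : i.1 + 1 = C.n
        · simp [κ, h0, h1]
        · simp [κ, h0, h1]
    refine ⟨by omega, _, φ, κ, by rw [show (φ : _ → _) = longPath hC.isLong from funext hφ],
      ?_, ?_, ?_, ?_⟩
    · intro i
      rw [hφ]
      have hcase := longPath_cases.{u} hC.isLong (κ i)
      have hkm := C.k_le (i.1 + 1)
      rcases hκ i with ⟨h0, e⟩ | ⟨h0, e⟩ | ⟨h0, h1, e⟩
      · have hq : q i = l i := if_pos (Or.inl h0)
        rw [hq]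
        apply Vert.ext <;> simp only [l, tip, leg, h0, zero_add] <;> omega
      · have hq : q i = l i := if_pos (Or.inr h0)
        rw [hq]
        apply Vert.ext <;> simp only [l, tip, leg, h0] <;> omega
      · have hq : q i = C.spine (C.k (i.1 + 1)) (C.k_le _) := if_neg (by omega)
        rw [hq]
        apply Vert.ext <;> simp only [spine] <;> omega
    · intro i h0
      have := hκ i
      omega
    · intro i h0
      have := hκ i
      omega
    · intro i j hij
      have hj := j.2
      have h1 := hκ i
      have h2 := hκ j
      have hkm := C.k_le (i.1 + 1)
      rcases h1 with h1 | h1 | h1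
      · omega
      · omega
      · have := hC.k_lt (i.1 + 1) (j.1 + 1) (by omega) (by omega) (by omega)
        omega
  · intro i h0 h1
    have hq : q i = C.spine (C.k (i.1 + 1)) (C.k_le _) := if_neg (by omega)
    rw [hq]
    exact hC.isBranchOfLeaf (by omega) (by omega)

theorem IsCat.isModel_tree (hC : IsCat C) {T : Set (Vert.{u} C)}
    (h1 : ∀ x, x ∈ T ↔ IsTip x) : IsModel C.tree T C.n := by
  have hT : T = {x | IsTip x} := by ext x; exact h1 x
  have hn : T.ncard = C.n := by rw [hT, ncard_isTip]
  refine ⟨Or.inr (Or.inr (Or.inr (Or.inl ⟨⟨?_, hn⟩, hC.isWideCaterpillar⟩))),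
    isParentFun.connected, hn, fun v hv => ?_⟩
  · rw [isParentFun.simplicialSet_eq hC.rootBranches, hT]
    ext x
    exact hC.isChildless_iff
  · have := hC.three_le
    exact (hC.isChildless_iff.2 ((h1 v).1 hv)).deg_le.trans (by omega)

theorem IsCat.isModel_line (hC : IsCat C) {T : Set {x : Vert.{u} C // x ≠ C.root}}
    (h1 : ∀ x, x ∈ T ↔ IsTip x.1) : IsModel C.line T C.n := by
  have hT : T = {x | IsTip x.1} := by ext x; exact h1 x
  have hn : T.ncard = C.n := by rw [hT, ncard_isTip_line]
  refine ⟨Or.inr (Or.inr (Or.inr (Or.inr ⟨⟨?_, hn⟩, Vert.{u} C, inferInstance, C.tree,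
    hC.isWideCaterpillar, isParentFun.nonempty_iso_lineGraph⟩))), ?_, hn, fun v hv => ?_⟩
  · rw [isParentFun.simplicialSet_siblingGraph_eq hC.rootBranches, hT]
    ext x
    exact hC.isChildless_iff
  · obtain ⟨a, b, hab, ha, hb, ea, eb⟩ := hC.rootBranches.{u}
    exact isParentFun.siblingGraph_connected ha ea
  · have htip := (h1 v).1 hv
    rw [IsTip] at htip
    have h3 := hC.three_le
    -- A tip has at most two neighbours: its predecessor in the leg or, if the leg has one vertex,
    -- the two spine edges at its place.
    refine (deg_line_le_card {(0, C.k v.1.i + 1),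
      if v.1.j = 0 then (0, C.k v.1.i) else (v.1.i, v.1.j - 1)} fun y hy => ?_).trans
      (Finset.card_le_two.trans (by omega))
    rw [line_adj, LineAdj] at hy
    have hv := v.1.valid
    have hy' := y.1.valid
    simp only [Finset.mem_insert, Finset.mem_singleton]
    rcases hy with ⟨e, hy⟩ | hy | hy | ⟨hy1, hy2, hy3, -, -, hy4⟩
    · rw [← e] at hy'
      right
      rw [if_neg (by omega), Prod.mk.injEq]
      omega
    · omega
    · rw [if_pos hy.2.2.1, Prod.mk.injEq, Prod.mk.injEq]
      omega
    · exact absurd (hC.k_inj hy1 (by omega) hy2 (by omega) hy4) hy3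

end Comb

end Connectifier

/-! ### Shortest paths, components, and tight graphs. -/

namespace Connectifier

open Relation

/-- A shortest walk between two sets along a relation. -/
theorem exists_shortest {V : Type u} {R : V → V → Prop} {A B : Set V} {a b : V} (ha : a ∈ A)
    (hb : b ∈ B) (h : ReflTransGen R a b) :
    ∃ (n : ℕ) (f : ℕ → V), f 0 ∈ A ∧ f n ∈ B ∧ (∀ i < n, R (f i) (f (i + 1))) ∧
      (∀ i ≤ n, f i ∈ A → i = 0) ∧ (∀ i ≤ n, f i ∈ B → i = n) ∧
      (∀ i j, i < j → j ≤ n → f i ≠ f j) ∧ (∀ i j, i + 1 < j → j ≤ n → ¬ R (f i) (f j)) := by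
  classical
  let p : ℕ → Prop := fun n => ∃ f : ℕ → V, f 0 ∈ A ∧ f n ∈ B ∧ ∀ i < n, R (f i) (f (i + 1))
  have hp : ∃ n, p n := by
    have : ∃ (n : ℕ) (f : ℕ → V), f 0 = a ∧ f n = b ∧ ∀ i < n, R (f i) (f (i + 1)) := by
      clear hb
      induction h with
      | refl => exact ⟨0, fun _ => a, rfl, rfl, by simp⟩
      | @tail c d _ hcd ih =>
        obtain ⟨n, f, h0, hn, hs⟩ := ih
        refine ⟨n + 1, fun i => if i ≤ n then f i else d, by simpa using h0, by simp, ?_⟩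
        intro i hi
        rcases Nat.lt_or_ge i n with h | h
        · simpa [h.le, Nat.succ_le_of_lt h] using hs i h
        · obtain rfl : i = n := by omega
          simpa [hn] using hcd
    obtain ⟨n, f, h0, hn, hs⟩ := this
    exact ⟨n, f, h0 ▸ ha, hn ▸ hb, hs⟩
  obtain ⟨f, h0, hn, hs⟩ := Nat.find_spec hp
  have hmin : ∀ m < Nat.find hp, ¬ p m := fun m hm => Nat.find_min hp hm
  generalize Nat.find hp = n at *
  -- Leaving out `f (i + 1), …, f (i + d)` would give a shorter walk, which ends in `f i` if `i + d
  -- = n`. Repeated vertices and chords are both excluded in this way.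
  have splice : ∀ i d, 0 < d → i + d ≤ n →
      (i + d < n → R (f i) (f (i + d + 1))) → (i + d = n → f i ∈ B) → False := by
    intro i d hd hid hR hB
    refine hmin (n - d) (by omega) ⟨fun x => if x ≤ i then f x else f (x + d), by simpa using h0,
      ?_, ?_⟩
    · by_cases h : n - d ≤ i
      · have e : n - d = i := by omega
        simp only [e, le_refl, if_true]
        exact hB (by omega)
      · simp only [h, if_false]
        rwa [Nat.sub_add_cancel (by omega)]
    · intro x hx
      rcases lt_trichotomy x i with h | h | h
      · simpa [h.le, Nat.succ_le_of_lt h] using hs x (by omega)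
      · subst h
        have e : x + 1 + d = x + d + 1 := by omega
        simpa [e] using hR (by omega)
      · have e : x + 1 + d = x + d + 1 := by omega
        simpa [not_le.2 h, not_le.2 (Nat.lt_succ_of_lt h), e] using hs (x + d) (by omega)
  refine ⟨n, f, h0, hn, hs, ?_, ?_, ?_, ?_⟩
  · intro i hi hA
    by_contra hne
    refine hmin (n - i) (by omega) ⟨fun x => f (x + i), by simpa using hA, ?_, ?_⟩
    · simpa [Nat.sub_add_cancel hi] using hn
    · intro x hx
      have e : x + 1 + i = x + i + 1 := by omega
      simpa [e] using hs (x + i) (by omega)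
  · intro i hi hB
    by_contra hne
    exact hmin i (by omega) ⟨f, h0, hB, fun x hx => hs x (by omega)⟩
  · intro i j hij hj e
    refine splice i (j - i) (by omega) (by omega) ?_ ?_
    · intro h
      rw [e]
      have e' : i + (j - i) = j := by omega
      rw [e'] at h ⊢
      exact hs j h
    · intro h
      rw [e]
      have e' : j = n := by omega
      rwa [e']
  · intro i j hij hj hR
    refine splice i (j - i - 1) (by omega) (by omega) ?_ (fun h => by omega)
    intro _
    have e' : i + (j - i - 1) + 1 = j := by omega
    rwa [e']

variable {V : Type u}

/-- `f 0, …, f (n - 1)` are the vertices of an induced path in this order. -/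
def IsPathSeq (G : SimpleGraph V) (f : ℕ → V) (n : ℕ) : Prop :=
  ∀ i j, i < n → j < n → (f i = f j → i = j) ∧ (G.Adj (f i) (f j) ↔ i + 1 = j ∨ j + 1 = i)

theorem isPathSeq_of_lt {G : SimpleGraph V} {f : ℕ → V} {n : ℕ}
    (h : ∀ i j, i < j → j < n → f i ≠ f j ∧ (G.Adj (f i) (f j) ↔ i + 1 = j)) :
    IsPathSeq G f n := by
  intro i j hi hj
  rcases lt_trichotomy i j with hij | rfl | hij
  · refine ⟨fun e => absurd e (h i j hij hj).1, ?_⟩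
    rw [(h i j hij hj).2]; omega
  · simp
  · refine ⟨fun e => absurd e.symm (h j i hij hi).1, ?_⟩
    rw [G.adj_comm, (h j i hij hi).2]; omega

theorem exists_shortest_path {G : SimpleGraph V} {D A B : Set V} {a b : V} (ha : a ∈ A)
    (haD : a ∈ D) (hb : b ∈ B) (h : ReflTransGen (fun x y => G.Adj x y ∧ y ∈ D) a b) :
    ∃ (n : ℕ) (f : ℕ → V), f 0 ∈ A ∧ f n ∈ B ∧ IsPathSeq G f (n + 1) ∧ (∀ i ≤ n, f i ∈ D) ∧
      (∀ i ≤ n, f i ∈ A → i = 0) ∧ (∀ i ≤ n, f i ∈ B → i = n) := by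
  -- The relation only forces the later vertices into `D`; intersecting `A` with `D` takes care of
  -- the first one.
  obtain ⟨n, f, h0, hn, hs, hA, hB, hi, hR⟩ := exists_shortest (A := A ∩ D) ⟨ha, haD⟩ hb h
  have hD : ∀ i ≤ n, f i ∈ D := by
    intro i hin
    cases i with
    | zero => exact h0.2
    | succ i => exact (hs i (by omega)).2
  refine ⟨n, f, h0.1, hn, isPathSeq_of_lt ?_, hD, fun i hin hiA => hA i hin ⟨hiA, hD i hin⟩, hB⟩
  intro i j hij hj
  refine ⟨hi i j hij (by omega), fun hadj => ?_, fun e => e ▸ (hs i (by omega)).1⟩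
  by_contra hne
  exact hR i j (by omega) (by omega) ⟨hadj, hD j (by omega)⟩

/-- There is a walk from `a` to `b` that avoids `Z` after its first vertex. -/
def ReachOff (G : SimpleGraph V) (Z : Set V) (a b : V) : Prop :=
  ReflTransGen (fun x y => G.Adj x y ∧ y ∉ Z) a b

theorem ReachOff.notMem {G : SimpleGraph V} {Z : Set V} {a b : V} (h : ReachOff G Z a b)
    (ha : a ∉ Z) : b ∉ Z := by
  induction h with
  | refl => exact ha
  | tail _ h _ => exact h.2

theorem ReachOff.symm {G : SimpleGraph V} {Z : Set V} {a b : V} (h : ReachOff G Z a b)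
    (ha : a ∉ Z) : ReachOff G Z b a := by
  induction h with
  | refl => exact ReflTransGen.refl
  | @tail c d hc hcd ih =>
    exact ReflTransGen.head ⟨hcd.1.symm, ReachOff.notMem hc ha⟩ ih

theorem ReachOff.trans {G : SimpleGraph V} {Z : Set V} {a b c : V} (h : ReachOff G Z a b)
    (h' : ReachOff G Z b c) : ReachOff G Z a c := ReflTransGen.trans h h'

theorem ReachOff.of_adj {G : SimpleGraph V} {Z : Set V} {a b : V} (h : G.Adj a b) (hb : b ∉ Z) :
    ReachOff G Z a b := ReflTransGen.single ⟨h, hb⟩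

/-- The component of `v` after the deletion of `Z`. -/
def comp (G : SimpleGraph V) (Z : Set V) (v : V) : Set V := {w | ReachOff G Z v w}

/-- `C` is disjoint from `Z`, and all neighbours of the vertices of `C` are in `C` or in `Z`. -/
structure IsOff (G : SimpleGraph V) (Z C : Set V) : Prop where
  notMem : ∀ x ∈ C, x ∉ Z
  closed : ∀ x ∈ C, ∀ y, G.Adj x y → y ∈ C ∨ y ∈ Z

theorem isOff_comp {G : SimpleGraph V} {Z : Set V} {v : V} (hv : v ∉ Z) :
    IsOff G Z (comp G Z v) where
  notMem _ hx := ReachOff.notMem hx hv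
  closed _ hx y hxy := by
    by_cases hy : y ∈ Z
    · exact Or.inr hy
    · exact Or.inl (ReachOff.trans hx (ReachOff.of_adj hxy hy))

/-- `G` is connected, and the deletion of a nonempty set disjoint from `S` disconnects it. -/
structure IsTight (G : SimpleGraph V) (S : Set V) : Prop where
  reach : ∀ a b, ReflTransGen G.Adj a b
  cut : ∀ D : Set V, D.Nonempty → (∀ x ∈ D, x ∉ S) →
    (∀ a ∉ D, ∀ b ∉ D, ReachOff G D a b) → ∀ x, x ∈ D

/-- `Z` is nonempty and connected. -/
structure IsConn (G : SimpleGraph V) (Z : Set V) : Prop where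
  nonempty : Z.Nonempty
  reach : ∀ a ∈ Z, ∀ b ∈ Z, ReflTransGen (fun x y => G.Adj x y ∧ y ∈ Z) a b

theorem isConn_singleton (G : SimpleGraph V) (p : V) : IsConn G {p} where
  nonempty := ⟨p, rfl⟩
  reach := by
    rintro a rfl b rfl
    exact ReflTransGen.refl

/-- A leg in `C` attached to `Z`: an induced path in `C` of which exactly the first vertex has
neighbours in `Z` and exactly the last vertex is in `S`. -/
structure IsLeg (G : SimpleGraph V) (S Z C : Set V) (g : ℕ → V) (L : ℕ) : Prop where
  pos : 0 < L
  path : IsPathSeq G g L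
  mem : ∀ j < L, g j ∈ C
  touch : ∀ j < L, (∃ z ∈ Z, G.Adj (g j) z) ↔ j = 0
  mem_iff : ∀ j < L, g j ∈ S ↔ j + 1 = L

/-- If the component missed `S`, it could be deleted: all other vertices still reach `Z`, and `Z` is
connected. So it meets `S`, and as `G` is connected it also has a vertex with a neighbour in `Z`. A
shortest path inside it between these two kinds of vertices is a leg. -/
theorem IsTight.exists_leg {G : SimpleGraph V} {S Z : Set V} (h : IsTight G S) (hZ : IsConn G Z)
    {v : V} (hv : v ∉ Z) : ∃ g L, IsLeg G S Z (comp G Z v) g L := by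
  have hoff := isOff_comp (G := G) hv
  obtain ⟨z, hz⟩ := hZ.nonempty
  obtain ⟨s, hs, hsS⟩ : ∃ s ∈ comp G Z v, s ∈ S := by
    by_contra hcon
    have hcon : ∀ x ∈ comp G Z v, x ∉ S := fun x hx hxS => hcon ⟨x, hx, hxS⟩
    have hZD : ∀ x ∈ Z, x ∉ comp G Z v := fun x hx hxC => hoff.notMem x hxC hx
    -- Walk towards `z` and stop at the first vertex of `Z`: the component can be entered only from
    -- `Z`.
    have toZ : ∀ a ∉ comp G Z v, ∃ z' ∈ Z, ReachOff G (comp G Z v) a z' := by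
      intro a ha
      have := h.reach a z
      induction this using ReflTransGen.head_induction_on with
      | refl => exact ⟨z, hz, ReflTransGen.refl⟩
      | @head a c hac hc ih =>
        by_cases haZ : a ∈ Z
        · exact ⟨a, haZ, ReflTransGen.refl⟩
        · have hcC : c ∉ comp G Z v := fun hcC =>
            (hoff.closed c hcC a hac.symm).elim ha haZ
          obtain ⟨z', hz', hr⟩ := ih hcC
          exact ⟨z', hz', (ReachOff.of_adj hac hcC).trans hr⟩
    refine hZD z hz (h.cut _ ⟨v, ReflTransGen.refl⟩ hcon ?_ z)
    intro a ha b hb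
    obtain ⟨z1, hz1, h1⟩ := toZ a ha
    obtain ⟨z2, hz2, h2⟩ := toZ b hb
    refine (h1.trans ?_).trans (h2.symm hb)
    exact ReflTransGen.mono (fun x y hxy => ⟨hxy.1, hZD y hxy.2⟩) _ _ (hZ.reach z1 hz1 z2 hz2)
  obtain ⟨w, hw, z', hz', hwz⟩ : ∃ w ∈ comp G Z v, ∃ z' ∈ Z, G.Adj w z' := by
    by_contra hcon
    have : ∀ b, ReflTransGen G.Adj v b → b ∈ comp G Z v := by
      intro b hb
      induction hb with
      | refl => exact ReflTransGen.refl
      | @tail c d _ hcd ih =>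
        exact (hoff.closed c ih d hcd).resolve_right fun hd => hcon ⟨c, ih, d, hd, hcd⟩
    exact hoff.notMem z (this z (h.reach v z)) hz
  have hws : ReachOff G Z w s := (ReachOff.symm hw hv).trans hs
  have hws' : ReflTransGen (fun x y => G.Adj x y ∧ y ∈ comp G Z v) w s := by
    clear hs hsS hwz
    induction hws with
    | refl => exact ReflTransGen.refl
    | @tail c d hc hcd ih => exact ih.tail ⟨hcd.1, (ReachOff.trans hw hc).trans
        (ReachOff.of_adj hcd.1 hcd.2)⟩
  obtain ⟨n, f, h0, hn, hp, hD, hA, hB⟩ := exists_shortest_path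
    (A := {x | ∃ z ∈ Z, G.Adj x z}) (B := S) ⟨z', hz', hwz⟩ hw hsS hws'
  refine ⟨f, n + 1, Nat.succ_pos _, hp, fun j hj => hD j (by omega), fun j hj => ⟨fun hz =>
    hA j (by omega) hz, fun e => e ▸ h0⟩, fun j hj => ⟨fun hz => ?_, fun e => ?_⟩⟩
  · rw [hB j (by omega) hz]
  · obtain rfl : j = n := by omega
    exact hn

/-- The component argument for cut vertices: if `p` is a vertex of `Z` outside `S` and the
deletion of `p` does not separate vertices of `Z`, then some component of `G - p` avoids `Z`. -/
theorem IsTight.exists_private {G : SimpleGraph V} {S Z : Set V} (h : IsTight G S) {p : V}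
    (hp : p ∉ S) (hZ : ∃ z ∈ Z, z ≠ p)
    (hreach : ∀ a ∈ Z, ∀ b ∈ Z, a ≠ p → b ≠ p → ReachOff G {p} a b) :
    ∃ v, v ≠ p ∧ ∀ z ∈ Z, z ∉ comp G {p} v := by
  obtain ⟨z0, hz0, hzp⟩ := hZ
  by_contra hcon
  push Not at hcon
  refine hzp (h.cut {p} ⟨p, rfl⟩ (by rintro x rfl; exact hp) ?_ z0)
  intro a ha b hb
  obtain ⟨z1, hz1, h1⟩ := hcon a ha
  obtain ⟨z2, hz2, h2⟩ := hcon b hb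
  have n1 : z1 ∉ ({p} : Set V) := ReachOff.notMem h1 ha
  have n2 : z2 ∉ ({p} : Set V) := ReachOff.notMem h2 hb
  exact (ReachOff.trans h1 (hreach z1 hz1 z2 hz2 n1 n2)).trans (ReachOff.symm h2 hb)

end Connectifier

/-! ### Ramsey's theorem, private legs, and vertices of large degree. -/

namespace Connectifier

open Relation

/-- Ramsey's theorem for graphs. -/
theorem exists_clique_or_indep (a b : ℕ) : ∃ N : ℕ, ∀ (V : Type u) (G : SimpleGraph V)
    (s : Finset V), N ≤ s.card →
    (∃ t ⊆ s, t.card = a ∧ ∀ x ∈ t, ∀ y ∈ t, x ≠ y → G.Adj x y) ∨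
    (∃ t ⊆ s, t.card = b ∧ ∀ x ∈ t, ∀ y ∈ t, ¬ G.Adj x y) := by
  classical
  induction a generalizing b with
  | zero => exact ⟨0, fun V G s _ => Or.inl ⟨∅, by simp⟩⟩
  | succ a iha =>
    induction b with
    | zero => exact ⟨0, fun V G s _ => Or.inr ⟨∅, by simp⟩⟩
    | succ b ihb =>
      obtain ⟨N1, h1⟩ := iha (b + 1)
      obtain ⟨N2, h2⟩ := ihb
      refine ⟨N1 + N2 + 1, fun V G s hs => ?_⟩
      obtain ⟨v, hv⟩ : s.Nonempty := Finset.card_pos.1 (by omega)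
      have hcard := Finset.card_filter_add_card_filter_not (s := s.erase v) (fun x => G.Adj v x)
      rw [Finset.card_erase_of_mem hv] at hcard
      have hsub : ∀ {p : V → Prop} [DecidablePred p] {t : Finset V},
          t ⊆ (s.erase v).filter p → insert v t ⊆ s := by
        intro p _ t ht
        refine Finset.insert_subset hv fun x hx => ?_
        exact Finset.mem_of_mem_erase (Finset.mem_filter.1 (ht hx)).1
      have hnot : ∀ {p : V → Prop} [DecidablePred p] {t : Finset V},
          t ⊆ (s.erase v).filter p → v ∉ t := by
        intro p _ t ht hvt
        exact (Finset.mem_erase.1 (Finset.mem_filter.1 (ht hvt)).1).1 rfl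
      rcases Nat.lt_or_ge ((s.erase v).filter fun x => G.Adj v x).card N1 with hlt | hge
      · rcases h2 V G ((s.erase v).filter fun x => ¬ G.Adj v x) (by omega) with
          ⟨t, ht, htc, hta⟩ | ⟨t, ht, htc, hta⟩
        · exact Or.inl ⟨t, fun x hx => hsub ht (Finset.mem_insert_of_mem hx), htc, hta⟩
        · have hvt : ∀ x ∈ t, ¬ G.Adj v x := fun x hx => (Finset.mem_filter.1 (ht hx)).2
          refine Or.inr ⟨insert v t, hsub ht, by rw [Finset.card_insert_of_notMem (hnot ht), htc],
            ?_⟩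
          intro x hx y hy
          rw [Finset.mem_insert] at hx hy
          rcases hx with rfl | hx <;> rcases hy with rfl | hy
          · exact G.irrefl
          · exact hvt y hy
          · exact fun e => hvt x hx e.symm
          · exact hta x hx y hy
      · rcases h1 V G _ hge with ⟨t, ht, htc, hta⟩ | ⟨t, ht, htc, hta⟩
        · have hvt : ∀ x ∈ t, G.Adj v x := fun x hx => (Finset.mem_filter.1 (ht hx)).2
          refine Or.inl ⟨insert v t, hsub ht, by rw [Finset.card_insert_of_notMem (hnot ht), htc],
            ?_⟩
          intro x hx y hy hxy
          rw [Finset.mem_insert] at hx hy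
          rcases hx with rfl | hx <;> rcases hy with rfl | hy
          · exact absurd rfl hxy
          · exact hvt y hy
          · exact (hvt x hx).symm
          · exact hta x hx y hy hxy
        · exact Or.inr ⟨t, fun x hx => hsub ht (Finset.mem_insert_of_mem hx), htc, hta⟩

theorem exists_enumeration {V : Type u} (t : Finset V) (ht : t.Nonempty) :
    ∃ p : ℕ → V, (∀ i, p i ∈ t) ∧
      ∀ i i', 0 < i → i ≤ t.card → 0 < i' → i' ≤ t.card → p i = p i' → i = i' := by
  obtain ⟨v, hv⟩ := ht
  let e := t.equivFin
  refine ⟨fun i => if h : i - 1 < t.card then e.symm ⟨i - 1, h⟩ else v, fun i => ?_, ?_⟩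
  · simp only
    split_ifs
    · exact (e.symm _).2
    · exact hv
  · intro i i' hi hn hi' hn' h
    simp only [show i - 1 < t.card by omega, show i' - 1 < t.card by omega, dif_pos] at h
    have := e.symm.injective (Subtype.ext h)
    rw [Fin.mk.injEq] at this
    omega

variable {V : Type u} {G : SimpleGraph V} {S Z : Set V}

/-- A leg that starts in the vertex `p` of `Z`, continues in a set `C` whose only neighbour
outside `C` is `p`, and ends in `S`. -/
structure IsPrivateLeg (G : SimpleGraph V) (S Z : Set V) (p : V) (C : Set V) (g : ℕ → V) (L : ℕ) :
    Prop where
  notMem : ∀ x ∈ C, x ∉ Z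
  closed : ∀ x ∈ C, ∀ y, G.Adj x y → y ∈ C ∨ y = p
  pos : 0 < L
  zero : g 0 = p
  path : IsPathSeq G g L
  mem : ∀ j < L, 0 < j → g j ∈ C
  mem_iff : ∀ j < L, g j ∈ S ↔ j + 1 = L

/-- If `p` is in `S`, the leg is `p` alone and `C` is empty. Otherwise a component of `G - p` that
avoids `Z` contains a leg attached to `p`, and `p` is put in front of it. -/
theorem IsTight.exists_privateLeg (h : IsTight G S) {p : V} (hZ : ∃ z ∈ Z, z ≠ p)
    (hreach : ∀ a ∈ Z, ∀ b ∈ Z, a ≠ p → b ≠ p → ReachOff G {p} a b) :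
    ∃ C g L, IsPrivateLeg G S Z p C g L := by
  by_cases hpS : p ∈ S
  · refine ⟨∅, fun _ => p, 1, ⟨by simp, by simp, one_pos, rfl, ?_, ?_, ?_⟩⟩
    · intro i j hi hj
      obtain rfl : i = 0 := by omega
      obtain rfl : j = 0 := by omega
      simp
    · intro j hj h0
      omega
    · intro j hj
      obtain rfl : j = 0 := by omega
      simpa using hpS
  · obtain ⟨v, hv, hvZ⟩ := h.exists_private hpS hZ hreach
    obtain ⟨g, L, hg⟩ := h.exists_leg (isConn_singleton G p) (v := v) hv
    have hoff := isOff_comp (G := G) (Z := {p}) (v := v) hv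
    refine ⟨comp G {p} v, fun j => if j = 0 then p else g (j - 1), L + 1,
      ⟨fun x hx hxZ => hvZ x hxZ hx, hoff.closed, Nat.succ_pos _, rfl, ?_, ?_, ?_⟩⟩
    · refine isPathSeq_of_lt fun i j hij hj => ?_
      have hj0 : j ≠ 0 := by omega
      by_cases hi : i = 0
      · subst hi
        simp only [if_true, if_neg hj0]
        refine ⟨fun e => hoff.notMem _ (hg.mem (j - 1) (by omega)) e.symm, ?_⟩
        have := hg.touch (j - 1) (by omega)
        simp only [Set.mem_singleton_iff, exists_eq_left] at this
        rw [G.adj_comm, this]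
        omega
      · simp only [if_neg hi, if_neg hj0]
        have := hg.path (i - 1) (j - 1) (by omega) (by omega)
        refine ⟨fun e => ?_, ?_⟩
        · have := this.1 e
          omega
        · rw [this.2]
          omega
    · intro j hj h0
      simp only [if_neg h0.ne']
      exact hg.mem _ (by omega)
    · intro j hj
      by_cases h0 : j = 0
      · subst h0
        have := hg.pos
        simp only [if_true, hpS, false_iff]
        omega
      · simp only [if_neg h0]
        rw [hg.mem_iff _ (by omega)]
        omega

/-- The leg starts in `Z`, hence outside `C'`, and could enter `C'` only through `p'`. But `p'` is
in `Z` and differs from `p`, while after `p` the leg has no vertex in `Z`. -/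
theorem IsPrivateLeg.notMem_other {p p' : V} {C C' : Set V} {g g' : ℕ → V} {L L' : ℕ}
    (h : IsPrivateLeg G S Z p C g L) (h' : IsPrivateLeg G S Z p' C' g' L') (hp : p ∈ Z)
    (hp' : p' ∈ Z) (hne : p ≠ p') {j : ℕ} (hj : j < L) : g j ∉ C' := by
  induction j with
  | zero =>
    rw [h.zero]
    exact fun hC => h'.notMem _ hC hp
  | succ j ih =>
    intro hC
    have hadj : G.Adj (g (j + 1)) (g j) := ((h.path _ _ hj (by omega)).2).2 (Or.inr rfl)
    rcases h'.closed _ hC _ hadj with h1 | h1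
    · exact ih (by omega) h1
    · rcases Nat.eq_zero_or_pos j with rfl | h0
      · exact hne (h.zero.symm.trans h1)
      · exact h.notMem _ (h.mem j (by omega) h0) (h1 ▸ hp')

theorem IsPrivateLeg.separated {p p' : V} {C C' : Set V} {g g' : ℕ → V} {L L' : ℕ}
    (h : IsPrivateLeg G S Z p C g L) (h' : IsPrivateLeg G S Z p' C' g' L') (hp : p ∈ Z)
    (hp' : p' ∈ Z) (hne : p ≠ p') {j j' : ℕ} (hj : j < L) (hj' : j' < L') :
    g j ≠ g' j' ∧ (G.Adj (g j) (g' j') → j = 0 ∧ j' = 0) := by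
  have h1 := h.notMem_other h' hp hp' hne hj
  have h2 := h'.notMem_other h hp' hp hne.symm hj'
  refine ⟨fun e => ?_, fun hadj => ⟨?_, ?_⟩⟩
  · rcases Nat.eq_zero_or_pos j' with rfl | h0
    · rcases Nat.eq_zero_or_pos j with rfl | h0
      · exact hne (by rw [← h.zero, e, h'.zero])
      · exact h2 (e ▸ h.mem j hj h0)
    · exact h1 (e ▸ h'.mem j' hj' h0)
  · by_contra h0
    have hC := h.mem j hj (Nat.pos_of_ne_zero h0)
    rcases h.closed _ hC _ hadj with h3 | h3
    · exact h2 h3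
    · rcases Nat.eq_zero_or_pos j' with rfl | h0
      · exact hne (by rw [← h3, h'.zero])
      · exact h'.notMem _ (h'.mem j' hj' h0) (h3 ▸ hp)
  · by_contra h0
    have hC := h'.mem j' hj' (Nat.pos_of_ne_zero h0)
    rcases h'.closed _ hC _ hadj.symm with h3 | h3
    · exact h1 h3
    · rcases Nat.eq_zero_or_pos j with rfl | h0
      · exact hne (by rw [← h3, h.zero])
      · exact h.notMem _ (h.mem j hj h0) (h3 ▸ hp')

/-- Deleting one vertex does not disconnect the rest of the clique, so every vertex of the clique
gets a private leg. Together they form the line graph of a subdivided star, the clique being the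
edges at its root. -/
theorem IsTight.hasModel_of_clique (h : IsTight G S) {n : ℕ} (hn : 2 ≤ n) {p : ℕ → V}
    (hp : ∀ i i', 0 < i → i ≤ n → 0 < i' → i' ≤ n → i ≠ i' → G.Adj (p i) (p i')) :
    HasModel G S n := by
  let Z : Set V := {z | ∃ i, 0 < i ∧ i ≤ n ∧ z = p i}
  have hmem : ∀ i, 0 < i → i ≤ n → p i ∈ Z := fun i h0 h1 => ⟨i, h0, h1, rfl⟩
  -- Outside `1, …, n` the data are dummies of length one, because a `Comb` requires positive
  -- lengths for all indices.
  have hleg : ∀ i, ∃ C g L, 0 < L ∧ (0 < i → i ≤ n → IsPrivateLeg G S Z (p i) C g L) := by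
    intro i
    by_cases hi : 0 < i ∧ i ≤ n
    · have key : ∃ C g L, IsPrivateLeg G S Z (p i) C g L := by
        refine h.exists_privateLeg ?_ ?_
        · refine ⟨p (if i = 1 then 2 else 1), hmem _ (by split_ifs <;> omega)
            (by split_ifs <;> omega), (hp _ _ ?_ ?_ hi.1 hi.2 ?_).ne⟩ <;> split_ifs <;> omega
        · rintro _ ⟨a, ha, han, rfl⟩ _ ⟨b, hb, hbn, rfl⟩ hai hbi
          by_cases hab : a = b
          · rw [hab]; exact ReflTransGen.refl
          · exact ReachOff.of_adj (hp a b ha han hb hbn hab) hbi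
      obtain ⟨C, g, L, hg⟩ := key
      exact ⟨C, g, L, hg.pos, fun _ _ => hg⟩
    · exact ⟨∅, p, 1, one_pos, fun h0 h1 => absurd ⟨h0, h1⟩ hi⟩
  choose Cs g L hL hg using hleg
  let C : Comb := ⟨n, 0, L, fun _ => 0, hL, fun _ => le_rfl⟩
  have hC : Comb.IsStar C := ⟨hn, rfl⟩
  have hv : ∀ x : Comb.Vert.{u} C, x ≠ C.root → 0 < x.i ∧ x.i ≤ n ∧ x.j < L x.i := by
    intro x hx
    have h1 := hC.pos_of_ne hx
    have h2 := x.valid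
    have h3 : C.n = n := rfl
    have h4 : C.L = L := rfl
    rw [h3, h4] at h2
    omega
  have key : ∃ φ : Comb.line.{u} C ↪g G, ∀ x, φ x = g x.1.i x.1.j := by
    refine Comb.exists_line_embedding g ?_ ?_
    · rintro ⟨i, j, hxv⟩ ⟨i', j', hyv⟩ hx hy e
      obtain ⟨hx1, hx2, hx3⟩ := hv _ hx
      obtain ⟨hy1, hy2, hy3⟩ := hv _ hy
      dsimp only at *
      by_cases hi : i = i'
      · subst hi
        exact ⟨rfl, ((hg i hx1 hx2).path _ _ hx3 hy3).1 e⟩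
      · exact absurd e ((hg i hx1 hx2).separated (hg i' hy1 hy2) (hmem _ hx1 hx2) (hmem _ hy1 hy2)
          (hp _ _ hx1 hx2 hy1 hy2 hi).ne hx3 hy3).1
    · rintro ⟨i, j, hxv⟩ ⟨i', j', hyv⟩ hx hy
      obtain ⟨hx1, hx2, hx3⟩ := hv _ hx
      obtain ⟨hy1, hy2, hy3⟩ := hv _ hy
      dsimp only at *
      rw [Comb.LineAdj]
      by_cases hi : i = i'
      · subst hi
        rw [((hg i hx1 hx2).path _ _ hx3 hy3).2]
        omega
      · have hadj := hp _ _ hx1 hx2 hy1 hy2 hi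
        have := ((hg i hx1 hx2).separated (hg i' hy1 hy2) (hmem _ hx1 hx2) (hmem _ hy1 hy2)
          hadj.ne hx3 hy3).2
        constructor
        · intro e
          have := this e
          exact Or.inr (Or.inr (Or.inr ⟨hx1, hy1, hi, this.1, this.2, rfl⟩))
        · intro e
          obtain ⟨rfl, rfl⟩ : j = 0 ∧ j' = 0 := by omega
          rw [(hg i hx1 hx2).zero, (hg i' hy1 hy2).zero]
          exact hadj
  obtain ⟨φ, hφ⟩ := key
  refine ⟨_, _, φ, hC.isModel_line fun x => ?_⟩
  obtain ⟨h1, h2, h3⟩ := hv x x.2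
  change φ x ∈ S ↔ _
  rw [hφ, (hg _ h1 h2).mem_iff _ h3, Comb.IsTip]
  exact ⟨fun e => ⟨h1, e⟩, fun e => e.2⟩

/-- The centre `c` keeps the remaining leaves together when one of them is deleted, so each leaf
gets a private leg. The centre itself adds one to the count if it is in `S`. -/
theorem IsTight.hasModel_of_star (h : IsTight G S) {n η : ℕ} (hn : 2 ≤ n) {c : V} {p : ℕ → V}
    (hc : ∀ i, 0 < i → i ≤ n → G.Adj c (p i))
    (hp : ∀ i i', 0 < i → i ≤ n → 0 < i' → i' ≤ n → i ≠ i' → p i ≠ p i' ∧ ¬ G.Adj (p i) (p i'))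
    (hη : (c ∉ S ∧ η = n) ∨ (c ∈ S ∧ η = n + 1)) :
    HasModel G S η := by
  let Z : Set V := {z | z = c ∨ ∃ i, 0 < i ∧ i ≤ n ∧ z = p i}
  have hcZ : c ∈ Z := Or.inl rfl
  have hmem : ∀ i, 0 < i → i ≤ n → p i ∈ Z := fun i h0 h1 => Or.inr ⟨i, h0, h1, rfl⟩
  have hleg : ∀ i, ∃ C g L, 0 < L ∧ (0 < i → i ≤ n → IsPrivateLeg G S Z (p i) C g L) := by
    intro i
    by_cases hi : 0 < i ∧ i ≤ n
    · have hci : c ∉ ({p i} : Set V) := (hc i hi.1 hi.2).ne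
      have toc : ∀ a ∈ Z, a ∉ ({p i} : Set V) → ReachOff G {p i} a c := by
        rintro a (rfl | ⟨a, ha, han, rfl⟩) hai
        · exact ReflTransGen.refl
        · exact ReachOff.of_adj (hc a ha han).symm hci
      obtain ⟨C, g, L, hg⟩ := h.exists_privateLeg (Z := Z) (p := p i) ⟨c, hcZ, hci⟩
        (fun a ha b hb hai hbi => (toc a ha hai).trans (ReachOff.symm (toc b hb hbi) hbi))
      exact ⟨C, g, L, hg.pos, fun _ _ => hg⟩
    · exact ⟨∅, p, 1, one_pos, fun h0 h1 => absurd ⟨h0, h1⟩ hi⟩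
  choose Cs g L hL hg using hleg
  let C : Comb := ⟨n, 0, L, fun _ => 0, hL, fun _ => le_rfl⟩
  have hC : Comb.IsStar C := ⟨hn, rfl⟩
  have hv : ∀ x : Comb.Vert.{u} C, (x.i = 0 ∧ x.j = 0) ∨ (0 < x.i ∧ x.i ≤ n ∧ x.j < L x.i) := by
    intro x
    have h2 := x.valid
    have h3 : C.n = n := rfl
    have h4 : C.L = L := rfl
    have h5 : C.m = 0 := rfl
    rw [h3, h4, h5] at h2
    omega
  have hcg : ∀ i, 0 < i → i ≤ n → ∀ j < L i, c ≠ g i j ∧ (G.Adj c (g i j) ↔ j = 0) := by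
    intro i h0 h1 j hj
    rcases Nat.eq_zero_or_pos j with rfl | hj0
    · rw [(hg i h0 h1).zero]
      exact ⟨(hc i h0 h1).ne, by simp [hc i h0 h1]⟩
    · have hmj := (hg i h0 h1).mem j hj hj0
      refine ⟨fun e => (hg i h0 h1).notMem _ hmj (e ▸ hcZ), fun e => ?_, fun e => by omega⟩
      rcases (hg i h0 h1).closed _ hmj _ e.symm with h2 | h2
      · exact absurd hcZ ((hg i h0 h1).notMem _ h2)
      · exact absurd h2 (hc i h0 h1).ne
  let F : ℕ → ℕ → V := fun i j => if i = 0 then c else g i j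
  have hF0 : ∀ j, F 0 j = c := fun j => rfl
  have hF1 : ∀ i, 0 < i → ∀ j, F i j = g i j := fun i hi j => if_neg hi.ne'
  have key : ∃ φ : Comb.tree.{u} C ↪g G, ∀ x, φ x = F x.i x.j := by
    refine Comb.exists_tree_embedding F ?_ ?_
    · rintro ⟨i, j, hxv⟩ ⟨i', j', hyv⟩ e
      have hx := hv ⟨i, j, hxv⟩
      have hy := hv ⟨i', j', hyv⟩
      dsimp only at *
      rcases hx with ⟨rfl, rfl⟩ | ⟨hx1, hx2, hx3⟩ <;> rcases hy with ⟨rfl, rfl⟩ | ⟨hy1, hy2, hy3⟩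
      · exact ⟨rfl, rfl⟩
      · rw [hF0, hF1 _ hy1] at e
        exact absurd e (hcg _ hy1 hy2 _ hy3).1
      · rw [hF0, hF1 _ hx1] at e
        exact absurd e.symm (hcg _ hx1 hx2 _ hx3).1
      · rw [hF1 _ hx1, hF1 _ hy1] at e
        by_cases hi : i = i'
        · subst hi
          exact ⟨rfl, ((hg i hx1 hx2).path _ _ hx3 hy3).1 e⟩
        · exact absurd e ((hg i hx1 hx2).separated (hg i' hy1 hy2) (hmem _ hx1 hx2) (hmem _ hy1 hy2)
            (hp _ _ hx1 hx2 hy1 hy2 hi).1 hx3 hy3).1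
    · rintro ⟨i, j, hxv⟩ ⟨i', j', hyv⟩
      have hx := hv ⟨i, j, hxv⟩
      have hy := hv ⟨i', j', hyv⟩
      have hk : ∀ i, C.k i = 0 := fun _ => rfl
      dsimp only at *
      rw [Comb.TreeAdj, hk]
      rcases hx with ⟨rfl, rfl⟩ | ⟨hx1, hx2, hx3⟩ <;> rcases hy with ⟨rfl, rfl⟩ | ⟨hy1, hy2, hy3⟩
      · rw [hF0]
        simp
      · rw [hF0, hF1 _ hy1, (hcg _ hy1 hy2 _ hy3).2]
        omega
      · rw [hF0, hF1 _ hx1, G.adj_comm, (hcg _ hx1 hx2 _ hx3).2]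
        omega
      · rw [hF1 _ hx1, hF1 _ hy1]
        by_cases hi : i = i'
        · subst hi
          rw [((hg i hx1 hx2).path _ _ hx3 hy3).2]
          omega
        · have := ((hg i hx1 hx2).separated (hg i' hy1 hy2) (hmem _ hx1 hx2) (hmem _ hy1 hy2)
            (hp _ _ hx1 hx2 hy1 hy2 hi).1 hx3 hy3).2
          constructor
          · intro e
            obtain ⟨rfl, rfl⟩ := this e
            rw [(hg i hx1 hx2).zero, (hg i' hy1 hy2).zero] at e
            exact absurd e (hp _ _ hx1 hx2 hy1 hy2 hi).2
          · omega
  obtain ⟨φ, hφ⟩ := key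
  have hT : ∀ x, φ x ∈ S ↔ Comb.IsTip x ∨ (x = C.root ∧ c ∈ S) := by
    intro x
    rw [hφ]
    rcases hv x with ⟨h1, h2⟩ | ⟨h1, h2, h3⟩
    · have hx : x = C.root := Comb.Vert.ext h1 h2
      have : ¬ Comb.IsTip x := fun ht => absurd ht.1 (by omega)
      rw [h1, hF0]
      rw [hx] at this
      simp only [this, hx, true_and, false_or]
    · have hx : x ≠ C.root := Comb.ne_iff.2 (Or.inl (by simp [Comb.root, Comb.spine]; omega))
      rw [hF1 _ h1, (hg _ h1 h2).mem_iff _ h3, Comb.IsTip]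
      simp only [h1, true_and, hx, false_and, or_false]
      exact Iff.rfl
  refine ⟨_, _, φ, hC.isModel_tree (fun x hx => (hT x).2 (Or.inl hx))
    (fun x hx => ((hT x).1 hx).imp id And.left) ?_ ?_⟩
  · have hncard := Comb.ncard_isTip.{u} (C := C)
    rcases hη with ⟨hcS, rfl⟩ | ⟨hcS, rfl⟩
    · have : φ ⁻¹' S = {x | Comb.IsTip x} := by
        ext x
        change φ x ∈ S ↔ _
        rw [hT x]
        simp [hcS]
      rw [this, hncard]
    · have : φ ⁻¹' S = insert C.root {x | Comb.IsTip x} := by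
        ext x
        change φ x ∈ S ↔ _
        rw [hT x]
        simp [hcS, or_comm]
      rw [this, Set.ncard_insert_of_notMem (fun h => absurd h.1 (lt_irrefl 0)) (Set.toFinite _),
        hncard]
  · change n ≤ η
    omega

/-- In a tight graph without the desired induced subgraphs, the degrees are bounded. -/
theorem exists_degree_bound (η : ℕ) (hη : 3 ≤ η) : ∃ Δ : ℕ, ∀ (V : Type u) (G : SimpleGraph V)
    (S : Set V), IsTight G S → ¬ HasModel G S η →
    ∀ (c : V) (s : Finset V), (∀ x ∈ s, G.Adj c x) → s.card ≤ Δ := by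
  classical
  obtain ⟨N, hN⟩ := exists_clique_or_indep.{u} η η
  refine ⟨N, fun V G S hG hmod c s hs => ?_⟩
  by_contra hcon
  rcases hN V G s (by omega) with ⟨t, ht, htc, hta⟩ | ⟨t, ht, htc, hta⟩
  · obtain ⟨p, hp, hinj⟩ := exists_enumeration t (Finset.card_pos.1 (by omega))
    rw [htc] at hinj
    exact hmod (hG.hasModel_of_clique (by omega) fun i i' h0 h1 h0' h1' hne =>
      hta _ (hp i) _ (hp i') fun e => hne (hinj i i' h0 h1 h0' h1' e))
  · obtain ⟨p, hp, hinj⟩ := exists_enumeration t (Finset.card_pos.1 (by omega))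
    rw [htc] at hinj
    -- If the centre is in `S`, it already counts, so one leg fewer is used; `3 ≤ η` still leaves
    -- two legs.
    refine hmod (hG.hasModel_of_star (n := if c ∈ S then η - 1 else η) (c := c) (p := p) ?_ ?_ ?_ ?_)
    · split_ifs <;> omega
    · exact fun i _ _ => hs _ (ht (hp i))
    · intro i i' h0 h1 h0' h1' hne
      refine ⟨fun e => hne (hinj i i' h0 ?_ h0' ?_ e), hta _ (hp i) _ (hp i')⟩
      · split_ifs at h1 <;> omega
      · split_ifs at h1' <;> omega
    · by_cases hc : c ∈ S
      · right; simp [hc]; omega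
      · left; simp [hc]

end Connectifier

/-! ### Descending along shortest paths when degrees are bounded. -/

namespace Connectifier

section Descent

variable {V : Type u} {G : SimpleGraph V} {S : Set V} {r : V}

/-- The vertices `s` of `S` such that `v` is on a shortest path from `r` to `s`. -/
def descendants (G : SimpleGraph V) (S : Set V) (r v : V) : Set V :=
  {s | s ∈ S ∧ G.dist r v + G.dist v s = G.dist r s}

/-- `c` is a neighbour of `v` at distance from `r` one more than that of `v`. -/
def IsChild (G : SimpleGraph V) (r v c : V) : Prop := G.Adj v c ∧ G.dist r c = G.dist r v + 1

/-- The second vertex of a shortest path from `v` to `s` will do; the triangle inequality forces its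
distance from `r`. -/
theorem exists_child (hG : G.Connected) {v s : V} (hs : s ∈ descendants G S r v) (hne : s ≠ v) :
    ∃ c, IsChild G r v c ∧ s ∈ descendants G S r c := by
  obtain ⟨hsS, hs⟩ := hs
  obtain ⟨p, hp⟩ := hG.exists_walk_length_eq_dist v s
  cases p with
  | nil => exact absurd rfl hne
  | @cons _ c _ h q =>
    rw [SimpleGraph.Walk.length_cons] at hp
    have h1 : G.dist c s ≤ q.length := SimpleGraph.dist_le q
    have h2 : G.dist r s ≤ G.dist r c + G.dist c s := hG.dist_triangle
    have h3 : G.dist r c ≤ G.dist r v + G.dist v c := hG.dist_triangle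
    have h4 : G.dist v c = 1 := SimpleGraph.dist_eq_one_iff_adj.2 h
    exact ⟨c, ⟨h, by omega⟩, hsS, by omega⟩

/-- A path on which the distance from `r` increases, with `k` vertices that are in `S` or have a
child outside the path. -/
def HasDescent (G : SimpleGraph V) (S : Set V) (r v : V) (k : ℕ) : Prop :=
  ∃ (m : ℕ) (f : ℕ → V) (J : Finset ℕ), J.card = k ∧ f 0 = v ∧
    (∀ i < m, IsChild G r (f i) (f (i + 1))) ∧
    ∀ i ∈ J, i ≤ m ∧ (f i ∈ S ∨ ∃ c, IsChild G r (f i) c ∧ (i < m → c ≠ f (i + 1)))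

theorem HasDescent.prepend {v c : V} {k : ℕ} (h : HasDescent G S r c k) (hc : IsChild G r v c) :
    HasDescent G S r v k ∧
      ((v ∈ S ∨ ∃ c', IsChild G r v c' ∧ c' ≠ c) → HasDescent G S r v (k + 1)) := by
  obtain ⟨m, f, J, hJ, h0, hs, hsp⟩ := h
  let f' : ℕ → V := fun i => if i = 0 then v else f (i - 1)
  have f0 : f' 0 = v := rfl
  have f1 : ∀ i, f' (i + 1) = f i := fun i => rfl
  have hs' : ∀ i < m + 1, IsChild G r (f' i) (f' (i + 1)) := by
    intro i hi
    cases i with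
    | zero => rw [f0, f1, h0]; exact hc
    | succ i => rw [f1, f1]; exact hs i (by omega)
  let J' := J.map ⟨Nat.succ, Nat.succ_injective⟩
  have hsp' : ∀ i ∈ J', i ≤ m + 1 ∧
      (f' i ∈ S ∨ ∃ c, IsChild G r (f' i) c ∧ (i < m + 1 → c ≠ f' (i + 1))) := by
    intro i hi
    obtain ⟨j, hj, rfl⟩ := Finset.mem_map.1 hi
    obtain ⟨h1, h2⟩ := hsp j hj
    refine ⟨Nat.succ_le_succ h1, ?_⟩
    change f j ∈ S ∨ ∃ c, IsChild G r (f j) c ∧ (j + 1 < m + 1 → c ≠ f (j + 1))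
    simpa using h2
  have hJ' : J'.card = k := by rw [Finset.card_map, hJ]
  refine ⟨⟨m + 1, f', J', hJ', f0, hs', hsp'⟩, fun hv => ⟨m + 1, f', insert 0 J', ?_, f0, hs', ?_⟩⟩
  · rw [Finset.card_insert_of_notMem, hJ']
    simp [J']
  · intro i hi
    rcases Finset.mem_insert.1 hi with rfl | hi
    · refine ⟨Nat.zero_le _, ?_⟩
      rw [f0, f1, h0]
      exact hv.imp id fun ⟨c', h1, h2⟩ => ⟨c', h1, fun _ => h2⟩
    · exact hsp' i hi

/-- The descendants of `v` are those of its children and possibly `v`. With at most `Δ` children and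
`Δ * N + 2` descendants, some child has at least `N`. If `v` is in `S` or has a further child,
prepending it to a descent from that child gains one marked vertex. Otherwise the only child
inherits all descendants, and one proceeds from there with the same `k`. -/
theorem exists_descent (Δ k : ℕ) : ∃ N : ℕ, ∀ (V : Type u) [Finite V] (G : SimpleGraph V)
    (S : Set V) (r : V), G.Connected →
    (∀ (c : V) (s : Finset V), (∀ x ∈ s, G.Adj c x) → s.card ≤ Δ) →
    ∀ v, N ≤ (descendants G S r v).ncard → HasDescent G S r v k := by
  classical
  induction k with
  | zero => exact ⟨0, fun V _ G S r _ _ v _ => ⟨0, fun _ => v, ∅, by simp⟩⟩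
  | succ k ih =>
    obtain ⟨N, hN⟩ := ih
    refine ⟨Δ * N + 2, fun V _ G S r hG hΔ v hv => ?_⟩
    have := Fintype.ofFinite V
    -- Moving to an only child increases the distance from `r`, which is bounded by `B`; so `B -
    -- G.dist r v` serves as the inner induction variable.
    obtain ⟨B, hB⟩ : ∃ B, ∀ v, G.dist r v ≤ B :=
      ⟨∑ v, G.dist r v, fun v => Finset.single_le_sum (f := fun v => G.dist r v)
        (fun _ _ => Nat.zero_le _) (Finset.mem_univ v)⟩
    induction hd : B - G.dist r v using Nat.strong_induction_on generalizing v with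
    | _ d ihd =>
      obtain ⟨c, hc, hcN⟩ : ∃ c, IsChild G r v c ∧ N ≤ (descendants G S r c).ncard := by
        by_contra hcon
        push Not at hcon
        let Ch : Finset V := Finset.univ.filter fun c => IsChild G r v c
        have hCh : Ch.card ≤ Δ := hΔ v Ch fun x hx => ((Finset.mem_filter.1 hx).2).1
        let D : V → Finset V := fun c => (descendants G S r c).toFinset
        have hD : ∀ c, (D c).card = (descendants G S r c).ncard := fun c =>
          (Set.ncard_eq_toFinset_card' _).symm
        have hsub : D v ⊆ insert v (Ch.biUnion D) := by
          intro s hs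
          by_cases hsv : s = v
          · rw [hsv]; exact Finset.mem_insert_self _ _
          · obtain ⟨c, hc, hsc⟩ := exists_child hG (Set.mem_toFinset.1 hs) hsv
            exact Finset.mem_insert_of_mem (Finset.mem_biUnion.2
              ⟨c, Finset.mem_filter.2 ⟨Finset.mem_univ _, hc⟩, Set.mem_toFinset.2 hsc⟩)
        have h1 := (Finset.card_le_card hsub).trans (Finset.card_insert_le _ _)
        have h2 : (Ch.biUnion D).card ≤ Ch.card * N := by
          refine Finset.card_biUnion_le_card_mul _ _ _ fun c hc => ?_
          rw [hD]
          exact (hcon c (Finset.mem_filter.1 hc).2).le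
        have h3 : Ch.card * N ≤ Δ * N := Nat.mul_le_mul_right _ hCh
        rw [hD] at h1
        omega
      by_cases hsp : v ∈ S ∨ ∃ c', IsChild G r v c' ∧ c' ≠ c
      · exact ((hN V G S r hG hΔ c hcN).prepend hc).2 hsp
      · push Not at hsp
        have hle : descendants G S r v ⊆ descendants G S r c := by
          intro s hs
          obtain ⟨c', hc', hs'⟩ := exists_child hG hs fun e => hsp.1 (e ▸ hs.1)
          exact hsp.2 c' hc' ▸ hs'
        have hlt : B - G.dist r c < d := by
          have := hB c
          have := hc.2
          omega
        exact ((ihd _ hlt c (hv.trans (Set.ncard_le_ncard hle (Set.toFinite _))) rfl).prepend hc).1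

/-- The path has one vertex in each distance level, so it is induced, and a child of `f i` other
than `f (i + 1)` cannot lie on it. The length is now counted in vertices. -/
theorem HasDescent.exists_path {v : V} {k : ℕ} (hG : G.Connected) (h : HasDescent G S r v k) :
    ∃ (m : ℕ) (f : ℕ → V) (J : Finset ℕ), J.card = k ∧ IsPathSeq G f m ∧
      ∀ i ∈ J, i < m ∧ (f i ∈ S ∨ ∃ c, G.Adj (f i) c ∧ ∀ j < m, c ≠ f j) := by
  obtain ⟨m, f, J, hJ, -, hs, hsp⟩ := h
  have hlev : ∀ i ≤ m, G.dist r (f i) = G.dist r (f 0) + i := by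
    intro i hi
    induction i with
    | zero => rfl
    | succ i ih => rw [(hs i (by omega)).2, ih (by omega)]; rfl
  refine ⟨m + 1, f, J, hJ, isPathSeq_of_lt fun i j hij hj => ?_, fun i hi => ?_⟩
  · have h1 := hlev i (by omega)
    have h2 := hlev j (by omega)
    refine ⟨fun e => ?_, fun hadj => ?_, ?_⟩
    · rw [e] at h1
      omega
    · have h3 : G.dist r (f j) ≤ G.dist r (f i) + G.dist (f i) (f j) := hG.dist_triangle
      rw [SimpleGraph.dist_eq_one_iff_adj.2 hadj] at h3
      omega
    · rintro rfl
      exact (hs i (by omega)).1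
  · obtain ⟨h1, h2⟩ := hsp i hi
    refine ⟨by omega, h2.imp id ?_⟩
    rintro ⟨c, hc, hne⟩
    refine ⟨c, hc.1, ?_⟩
    rintro j hj rfl
    have h3 := hlev i h1
    have h4 := hlev j (by omega)
    have h5 := hc.2
    obtain rfl : j = i + 1 := by omega
    exact hne (by omega) rfl

end Descent

end Connectifier

/-! ### Path connectifiers, and the choice of a stretch free of `S`. -/

namespace Connectifier

/-- The path on `m + 1` vertices. -/
abbrev liftedPath (m : ℕ) : SimpleGraph (ULift.{u} (Fin (m + 1))) :=
  (SimpleGraph.pathGraph (m + 1)).comap ULift.down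

theorem liftedPath_adj {m : ℕ} {x y : ULift.{u} (Fin (m + 1))} :
    (liftedPath m).Adj x y ↔ x.down.1 + 1 = y.down.1 ∨ y.down.1 + 1 = x.down.1 :=
  SimpleGraph.pathGraph_adj

/-- Listing `T` in increasing order gives the widening: the ends are in `T`, and for `σ = 1` being
strictly increasing is enough. An inner vertex has two nonadjacent neighbours, so it is not
simplicial. -/
theorem isModel_liftedPath {m : ℕ} {T : Set (ULift.{u} (Fin (m + 1)))} (h0 : ⟨0⟩ ∈ T)
    (hm : ⟨Fin.last m⟩ ∈ T) : IsModel (liftedPath m) T T.ncard := by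
  classical
  have hsurj : Set.range (ULift.up : Fin (m + 1) → ULift.{u} (Fin (m + 1))) = Set.univ :=
    Set.eq_univ_of_forall fun x => ⟨x.down, rfl⟩
  let up : SimpleGraph.pathGraph (m + 1) ↪g liftedPath.{u} m :=
    ⟨⟨ULift.up, ULift.up_injective⟩, Iff.rfl⟩
  refine ⟨Or.inr (Or.inr (Or.inl ⟨⟨?_, rfl⟩, ⟨m, up, hsurj⟩, ?_⟩)), ?_, rfl, ?_⟩
  · intro x hx
    by_contra hxT
    have hx0 : x.down.1 ≠ 0 := fun e => hxT (by
      rwa [show x = ⟨0⟩ from ULift.ext _ _ (Fin.ext e)])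
    have hxm : x.down.1 ≠ m := fun e => hxT (by
      rwa [show x = ⟨Fin.last m⟩ from ULift.ext _ _ (Fin.ext e)])
    have hlt := x.down.2
    have hadj := hx (x := ⟨⟨x.down.1 - 1, by omega⟩⟩) (liftedPath_adj.2 (by simp only; omega))
      (y := ⟨⟨x.down.1 + 1, by omega⟩⟩) (liftedPath_adj.2 (by simp))
      (fun e => by
        have := congrArg (fun z => z.down.1) e
        simp only at this
        omega)
    rw [liftedPath_adj] at hadj
    simp only at hadj
    omega
  · let A : Finset (Fin (m + 1)) := Finset.univ.filter fun i => ULift.up i ∈ T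
    have hA : A.card = T.ncard := by
      have : T = ULift.up '' (A : Set (Fin (m + 1))) := by
        ext x
        constructor
        · intro hx
          exact ⟨x.down, Finset.mem_coe.2 (Finset.mem_filter.2 ⟨Finset.mem_univ _, hx⟩), rfl⟩
        · rintro ⟨i, hi, rfl⟩
          exact (Finset.mem_filter.1 hi).2
      rw [this, Set.ncard_image_of_injective _ ULift.up_injective, Set.ncard_coe_finset]
    let k := A.orderEmbOfFin hA
    have hk : ∀ i, ULift.up (k i) ∈ T := fun i =>
      (Finset.mem_filter.1 (Finset.orderEmbOfFin_mem A hA i)).2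
    have hks : ∀ i : Fin (m + 1), ULift.up i ∈ T → ∃ j, k j = i := by
      intro i hi
      have : i ∈ Set.range k := by
        rw [Finset.range_orderEmbOfFin]
        exact Finset.mem_coe.2 (Finset.mem_filter.2 ⟨Finset.mem_univ _, hi⟩)
      exact this
    refine ⟨fun i => ⟨k i⟩, ?_, (Set.ncard_pos (Set.toFinite _)).2 ⟨_, h0⟩, m, up, k, hsurj,
      fun i => rfl, ?_, ?_, ?_⟩
    · ext x
      constructor
      · rintro ⟨i, rfl⟩
        exact hk i
      · intro hx
        obtain ⟨j, hj⟩ := hks x.down hx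
        exact ⟨j, ULift.ext _ _ hj⟩
    · intro i hi
      obtain ⟨j, hj⟩ := hks 0 h0
      have : k i ≤ k j := k.monotone (by rw [Fin.le_iff_val_le_val]; omega)
      rw [hj] at this
      exact congrArg Fin.val (le_antisymm this (Fin.zero_le _))
    · intro i hi
      obtain ⟨j, hj⟩ := hks (Fin.last m) hm
      have : k j ≤ k i := k.monotone (by rw [Fin.le_iff_val_le_val]; omega)
      rw [hj] at this
      exact congrArg Fin.val (le_antisymm (Fin.le_last _) this)
    · intro i j hij
      exact k.strictMono (show i < j by rw [Fin.lt_def]; omega)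
  · exact (SimpleGraph.Iso.connected_iff
      ⟨Equiv.ulift.symm, Iff.rfl⟩ : _ ↔ (liftedPath.{u} m).Connected).1
      (SimpleGraph.pathGraph_connected m)
  · intro v _
    rcases Nat.eq_zero_or_pos m with rfl | hm0
    · have : deg (liftedPath.{u} 0) v ≤ 0 := by
        refine deg_le_of_subset (A := ∅) (fun y hy => ?_) (by simp)
        rw [liftedPath_adj] at hy
        have := v.down.2
        have := y.down.2
        omega
      omega
    · have h1 : 1 < T.ncard := (Set.one_lt_ncard (Set.toFinite _)).2 ⟨_, h0, _, hm, fun e => by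
        have := congrArg (fun z => z.down.1) e
        simp at this
        omega⟩
      refine le_trans ?_ h1
      have hv := v.down.2
      refine deg_le_of_subset (A := {⟨⟨v.down.1 - 1, by omega⟩⟩,
        ⟨⟨min (v.down.1 + 1) m, by omega⟩⟩}) (fun y hy => ?_) (ncard_pair_le _ _)
      have hy2 := y.down.2
      rw [liftedPath_adj] at hy
      rcases hy with hy | hy
      · right
        exact ULift.ext _ _ (Fin.ext (by simp only; omega))
      · left
        exact ULift.ext _ _ (Fin.ext (by simp only; omega))

variable {V : Type u} {G : SimpleGraph V} {S : Set V}

theorem hasModel_of_path {f : ℕ → V} {m : ℕ} (hf : IsPathSeq G f (m + 1)) (h0 : f 0 ∈ S)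
    (hm : f m ∈ S) [DecidablePred fun i => f i ∈ S] :
    HasModel G S (Nat.count (fun i => f i ∈ S) (m + 1)) := by
  let φ : liftedPath.{u} m ↪g G := ⟨⟨fun x => f x.down.1, fun x y e =>
    ULift.ext _ _ (Fin.ext ((hf _ _ x.down.2 y.down.2).1 e))⟩, fun {x y} =>
      (hf _ _ x.down.2 y.down.2).2.trans liftedPath_adj.symm⟩
  have h := isModel_liftedPath (T := φ ⁻¹' S) h0 hm
  have hc : (φ ⁻¹' S).ncard = Nat.count (fun i => f i ∈ S) (m + 1) := by
    rw [Nat.count_eq_card_filter_range, ← Set.ncard_coe_finset]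
    have hinj : Function.Injective fun x : ULift.{u} (Fin (m + 1)) => x.down.1 :=
      fun x y e => ULift.ext _ _ (Fin.ext e)
    rw [← Set.ncard_image_of_injective _ hinj]
    congr 1
    ext i
    rw [Finset.mem_coe, Finset.mem_filter, Finset.mem_range]
    constructor
    · rintro ⟨x, hx, rfl⟩
      exact ⟨x.down.2, hx⟩
    · rintro ⟨hi, hi'⟩
      exact ⟨⟨⟨i, hi⟩⟩, hi', rfl⟩
  rw [← hc]
  exact ⟨_, _, φ, h⟩

theorem IsPathSeq.shift {f : ℕ → V} {m : ℕ} (hf : IsPathSeq G f m) {a n : ℕ} (h : a + n ≤ m) :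
    IsPathSeq G (fun i => f (a + i)) n := by
  intro i j hi hj
  have := hf (a + i) (a + j) (by omega) (by omega)
  refine ⟨fun e => by have := this.1 e; omega, ?_⟩
  rw [this.2]
  omega

/-- Start at the first vertex in `S` and stop as soon as `η` vertices of `S` have been met; both
ends are then in `S`. -/
theorem hasModel_of_path_of_le_count {f : ℕ → V} {m η : ℕ} (hf : IsPathSeq G f m) (hη : 1 ≤ η)
    [DecidablePred fun i => f i ∈ S] (h : η ≤ Nat.count (fun i => f i ∈ S) m) :
    HasModel G S η := by
  classical
  have hex : ∃ a, f a ∈ S := by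
    by_contra hcon
    push Not at hcon
    have : Nat.count (fun i => f i ∈ S) m = 0 := by
      rw [Nat.count_eq_card_filter_range]
      simp [hcon]
    omega
  obtain ⟨a, haS, hamin⟩ : ∃ a, f a ∈ S ∧ ∀ i < a, f i ∉ S :=
    ⟨Nat.find hex, Nat.find_spec hex, fun i hi => Nat.find_min hex hi⟩
  have hca : Nat.count (fun i => f i ∈ S) a = 0 := by
    rw [Nat.count_eq_card_filter_range, Finset.card_eq_zero, Finset.filter_eq_empty_iff]
    exact fun i hi => hamin i (Finset.mem_range.1 hi)
  have ham : a < m := by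
    by_contra hcon
    have := Nat.count_monotone (fun i => f i ∈ S) (not_lt.1 hcon)
    omega
  have hadd := Nat.count_add (fun i => f i ∈ S) a (m - a)
  rw [hca, zero_add, Nat.add_sub_cancel' ham.le] at hadd
  have hex2 : ∃ b, η ≤ Nat.count (fun i => f (a + i) ∈ S) (b + 1) :=
    ⟨m - a - 1, by rw [show m - a - 1 + 1 = m - a by omega, ← hadd]; exact h⟩
  obtain ⟨b, hb, hbmin⟩ : ∃ b, η ≤ Nat.count (fun i => f (a + i) ∈ S) (b + 1) ∧
      ∀ i < b, Nat.count (fun i => f (a + i) ∈ S) (i + 1) < η :=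
    ⟨Nat.find hex2, Nat.find_spec hex2, fun i hi => not_le.1 (Nat.find_min hex2 hi)⟩
  have hlt : Nat.count (fun i => f (a + i) ∈ S) b < η := by
    cases b with
    | zero => rw [Nat.count_zero]; omega
    | succ b => exact hbmin b (by omega)
  have hbm : a + b < m := by
    by_contra hcon
    have := Nat.count_monotone (fun i => f (a + i) ∈ S) (show m - a ≤ b by omega)
    omega
  have hcs := Nat.count_succ (fun i => f (a + i) ∈ S) b
  have hbS : f (a + b) ∈ S := by
    by_contra hcon
    rw [if_neg hcon] at hcs
    omega
  rw [if_pos hbS] at hcs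
  have := hasModel_of_path (hf.shift (a := a) (n := b + 1) (by omega)) haS hbS
  rwa [show Nat.count (fun i => f (a + i) ∈ S) (b + 1) = η by omega] at this

theorem exists_strictMono_enumeration {J : Finset ℕ} {K : ℕ} (hJ : K ≤ J.card) :
    ∃ e : ℕ → ℕ, (∀ x < K, e x ∈ J) ∧ ∀ x y, x < y → y < K → e x < e y := by
  let k := J.orderEmbOfFin rfl
  refine ⟨fun x => if h : x < J.card then k ⟨x, h⟩ else 0, fun x hx => ?_, fun x y hxy hy => ?_⟩
  · simp only [show x < J.card by omega, dif_pos]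
    exact Finset.orderEmbOfFin_mem J rfl _
  · simp only [show x < J.card by omega, show y < J.card by omega, dif_pos]
    exact k.strictMono (show (⟨x, _⟩ : Fin J.card) < ⟨y, _⟩ from hxy)

/-- Among many marked integers one finds widely spaced ones in an interval free of the few
elements of a given set. -/
theorem exists_free_interval {J : Finset ℕ} {A : ℕ → Prop} [DecidablePred A] {m n η : ℕ}
    (hJm : ∀ j ∈ J, j < m) (hA : Nat.count A m < η) (hJ : η * (4 * n + 4) ≤ J.card) :
    ∃ (lo hi : ℕ) (e : ℕ → ℕ), hi < m ∧ (∀ i, 0 < i → i ≤ n → e i ∈ J ∧ lo < e i ∧ e i < hi) ∧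
      (∀ i i', 0 < i → i < i' → i' ≤ n → e i + 4 ≤ e i') ∧ ∀ x, lo ≤ x → x ≤ hi → ¬ A x := by
  obtain ⟨sp, hsp, hlt⟩ := exists_strictMono_enumeration hJ
  have hadd : ∀ d x, x + d < η * (4 * n + 4) → sp x + d ≤ sp (x + d) := by
    intro d
    induction d with
    | zero => intro x _; exact le_rfl
    | succ d ih =>
      intro x hx
      have h1 := ih x (by omega)
      have h2 := hlt (x + d) (x + (d + 1)) (by omega) hx
      omega
  have hblock : ∀ b < η, b * (4 * n + 4) + (4 * n + 3) < η * (4 * n + 4) := by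
    intro b hb
    have : (b + 1) * (4 * n + 4) ≤ η * (4 * n + 4) := Nat.mul_le_mul_right _ hb
    rw [add_mul, one_mul] at this
    omega
  -- Cut the marked integers into `η` blocks of `4 * n + 4`. If the span of every block contained an
  -- element of `A`, these `η` elements would be distinct, contradicting `hA`.
  obtain ⟨b, hb, hfree⟩ : ∃ b < η, ∀ x, sp (b * (4 * n + 4)) ≤ x →
      x ≤ sp (b * (4 * n + 4) + (4 * n + 3)) → ¬ A x := by
    by_contra hcon
    push Not at hcon
    choose! a ha1 ha2 ha3 using hcon
    have hmono : ∀ b b', b < b' → b' < η → a b < a b' := by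
      intro b b' hbb hb'
      have h1 := ha2 b (by omega)
      have h2 := ha1 b' hb'
      have h3 : (b + 1) * (4 * n + 4) ≤ b' * (4 * n + 4) := Nat.mul_le_mul_right _ hbb
      rw [add_mul, one_mul] at h3
      have h4 := hblock b' hb'
      have h5 := hlt (b * (4 * n + 4) + (4 * n + 3)) (b' * (4 * n + 4)) (by omega) (by omega)
      omega
    have hsub : (Finset.range η).image a ⊆ (Finset.range m).filter A := by
      intro x hx
      obtain ⟨b, hb, rfl⟩ := Finset.mem_image.1 hx
      have hb := Finset.mem_range.1 hb
      refine Finset.mem_filter.2 ⟨Finset.mem_range.2 ?_, ha3 b hb⟩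
      exact (ha2 b hb).trans_lt (hJm _ (hsp _ (hblock b hb)))
    have := Finset.card_le_card hsub
    rw [← Nat.count_eq_card_filter_range, Finset.card_image_of_injOn, Finset.card_range] at this
    · omega
    · intro x hx y hy e
      have hx := Finset.mem_range.1 (Finset.mem_coe.1 hx)
      have hy := Finset.mem_range.1 (Finset.mem_coe.1 hy)
      rcases lt_trichotomy x y with h | h | h
      · exact absurd e (hmono x y h hy).ne
      · exact h
      · exact absurd e (hmono y x h hx).ne'
  have hbl := hblock b hb
  -- The first and the last marked integer of the block serve as `lo` and `hi`, and every fourth one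
  -- in between is chosen, which gives the gaps of four.
  refine ⟨_, _, fun i => sp (b * (4 * n + 4) + 4 * i), hJm _ (hsp _ hbl), ?_, ?_, hfree⟩
  · intro i h0 hi
    exact ⟨hsp _ (by omega), hlt _ _ (by omega) (by omega), hlt _ _ (by omega) hbl⟩
  · intro i i' h0 hii hi'
    have h1 := hadd (4 * i' - 4 * i) (b * (4 * n + 4) + 4 * i) (by omega)
    rw [show b * (4 * n + 4) + 4 * i + (4 * i' - 4 * i) = b * (4 * n + 4) + 4 * i' by omega] at h1
    simp only
    omega

end Connectifier

/-! ### Attachments to an induced path. -/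

namespace Connectifier

open Relation

variable {V : Type u} {G : SimpleGraph V} {S : Set V} {f : ℕ → V} {m : ℕ}

/-- The vertices `f 0, …, f (m - 1)`. -/
def pathSet (f : ℕ → V) (m : ℕ) : Set V := {z | ∃ y < m, z = f y}

theorem IsPathSeq.reachOff (hf : IsPathSeq G f m) {Z : Set V} {a b : ℕ} (hab : a ≤ b) (hb : b < m)
    (hZ : ∀ y, a ≤ y → y ≤ b → f y ∉ Z) : ReachOff G Z (f a) (f b) := by
  induction b, hab using Nat.le_induction with
  | base => exact ReflTransGen.refl
  | succ b hab ih =>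
    exact (ih (by omega) fun y h1 h2 => hZ y h1 (by omega)).trans
      (ReachOff.of_adj ((hf b (b + 1) (by omega) hb).2.2 (Or.inl rfl)) (hZ _ (by omega) le_rfl))

theorem IsPathSeq.isConn (hf : IsPathSeq G f m) (hm : 0 < m) : IsConn G (pathSet f m) where
  nonempty := ⟨f 0, 0, hm, rfl⟩
  reach := by
    -- Staying on the path is avoiding its complement.
    have key : ∀ a b, a ≤ b → b < m → ReachOff G (pathSet f m)ᶜ (f a) (f b) := fun a b hab hb =>
      hf.reachOff hab hb fun y _ hy => not_not.2 ⟨y, by omega, rfl⟩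
    have conv : ∀ a b, ReachOff G (pathSet f m)ᶜ a b →
        ReflTransGen (fun x y => G.Adj x y ∧ y ∈ pathSet f m) a b := fun a b h =>
      ReflTransGen.mono (fun x y hxy => ⟨hxy.1, not_not.1 hxy.2⟩) _ _ h
    rintro _ ⟨a, ha, rfl⟩ _ ⟨b, hb, rfl⟩
    rcases le_total a b with hab | hab
    · exact conv _ _ (key a b hab hb)
    · exact conv _ _ ((key b a hab ha).symm (not_not.2 ⟨b, hb, rfl⟩))

theorem ReachOff.mono {Z Z' : Set V} (h : Z' ⊆ Z) {a b : V} (hab : ReachOff G Z a b) :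
    ReachOff G Z' a b :=
  ReflTransGen.mono (fun _ _ hxy => ⟨hxy.1, fun hy => hxy.2 (h hy)⟩) _ _ hab

/-- A set outside the path `f` with a leg to `S`, whose neighbours on the path are among
`f x` and `f (x + 1)`. -/
def HasAttachment (G : SimpleGraph V) (S : Set V) (f : ℕ → V) (m x : ℕ) : Prop :=
  ∃ C g L, IsOff G (pathSet f m) C ∧ IsLeg G S (pathSet f m) C g L ∧
    ∀ c ∈ C, ∀ y < m, G.Adj c (f y) → y = x ∨ y = x + 1

/-- If a component outside a path has neighbours on both sides of a vertex of the path which is not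
in `S`, then something is attached to this vertex only. -/
theorem IsTight.exists_attachment_of_between (h : IsTight G S) (hf : IsPathSeq G f m) {v : V}
    (hv : v ∉ pathSet f m) {a b x : ℕ} (hax : a < x) (hxb : x < b) (hb : b < m) (hx : f x ∉ S)
    (ha : ∃ c ∈ comp G (pathSet f m) v, G.Adj c (f a))
    (hb' : ∃ c ∈ comp G (pathSet f m) v, G.Adj c (f b)) :
    ∃ C g L, IsOff G (pathSet f m) C ∧ IsLeg G S (pathSet f m) C g L ∧
      ∀ c ∈ C, ∀ y < m, G.Adj c (f y) → y = x := by
  have hsub : {f x} ⊆ pathSet f m := by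
    rintro _ rfl
    exact ⟨x, by omega, rfl⟩
  have hne : ∀ y < m, y ≠ x → f y ∉ ({f x} : Set V) := fun y hy hyx e =>
    hyx ((hf y x hy (by omega)).1 e)
  have hvx : v ∉ ({f x} : Set V) := fun e => hv (hsub e)
  have toV : ∀ a < m, a ≠ x → (∃ c ∈ comp G (pathSet f m) v, G.Adj c (f a)) →
      ReachOff G {f x} v (f a) := by
    rintro a ham hax ⟨c, hc, hca⟩
    exact (ReachOff.mono hsub hc).trans (ReachOff.of_adj hca (hne a ham hax))
  have hva := toV a (by omega) (by omega) ha
  have hvb := toV b hb (by omega) hb'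
  -- The component of `v` bridges the two sides, so deleting `f x` leaves the rest of the path in
  -- one component and `exists_private` applies.
  have hall : ∀ y < m, y ≠ x → ReachOff G {f x} v (f y) := by
    have seg : ∀ p q, p ≤ q → q < m → (q < x ∨ x < p) → ReachOff G {f x} (f p) (f q) :=
      fun p q hpq hq hx' => hf.reachOff hpq hq fun y h1 h2 => hne y (by omega) (by omega)
    have seg' : ∀ p q, p < m → q < m → ((p < x ∧ q < x) ∨ (x < p ∧ x < q)) →
        ReachOff G {f x} (f p) (f q) := by
      intro p q hp hq hx'
      rcases le_total p q with hpq | hpq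
      · exact seg p q hpq hq (by omega)
      · exact (seg q p hpq hp (by omega)).symm (hne q hq (by omega))
    intro y hy hyx
    rcases lt_or_gt_of_ne hyx with h1 | h1
    · exact hva.trans (seg' a y (by omega) hy (by omega))
    · exact hvb.trans (seg' b y hb hy (by omega))
  obtain ⟨w, hw, hwP⟩ := h.exists_private (Z := pathSet f m) hx
    ⟨f a, ⟨a, by omega, rfl⟩, hne a (by omega) (by omega)⟩ (by
      rintro _ ⟨p, hp, rfl⟩ _ ⟨q, hq, rfl⟩ hpx hqx
      exact (ReachOff.symm (hall p hp fun e => hpx (e ▸ rfl)) hvx).trans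
        (hall q hq fun e => hqx (e ▸ rfl)))
  have hoff := isOff_comp (G := G) (Z := {f x}) (v := w) hw
  obtain ⟨g, L, hg⟩ := h.exists_leg (isConn_singleton G (f x)) (v := w) hw
  have hnbr : ∀ c ∈ comp G {f x} w, ∀ y < m, G.Adj c (f y) → y = x := by
    intro c hc y hy hcy
    by_contra hyx
    exact hwP (f y) ⟨y, hy, rfl⟩ ((hoff.closed c hc _ hcy).resolve_right (hne y hy hyx))
  refine ⟨comp G {f x} w, g, L, ⟨fun c hc hcP => hwP c hcP hc, fun c hc y hcy =>
    (hoff.closed c hc y hcy).imp id fun hy => hsub hy⟩, ⟨hg.pos, hg.path, hg.mem, ?_, hg.mem_iff⟩,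
    hnbr⟩
  intro j hj
  rw [← hg.touch j hj]
  constructor
  · rintro ⟨_, ⟨y, hy, rfl⟩, hadj⟩
    have := hnbr _ (hg.mem j hj) y hy hadj
    exact ⟨f y, this ▸ rfl, hadj⟩
  · rintro ⟨z, hz, hadj⟩
    exact ⟨z, hsub hz, hadj⟩

/-- Take the component of `v` off the path. If it has neighbours on both sides of one of `f (j -
1)`, `f j`, `f (j + 1)`, something else is attached to that vertex alone. Otherwise, as `f j` is one
of its neighbours, its neighbours on the path are among `f (j - 1)`, `f j` or among `f j`, `f (j +
1)`. -/
theorem IsTight.exists_attachment (h : IsTight G S) (hf : IsPathSeq G f m) {j : ℕ} (hj : 0 < j)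
    (hjm : j + 1 < m) (hS : ∀ y, j - 1 ≤ y → y ≤ j + 1 → f y ∉ S)
    (hv : ∃ v, G.Adj (f j) v ∧ ∀ y < m, v ≠ f y) :
    ∃ x, j ≤ x + 1 ∧ x ≤ j ∧ HasAttachment G S f m x := by
  obtain ⟨v, hjv, hv⟩ := hv
  have hvP : v ∉ pathSet f m := by
    rintro ⟨y, hy, e⟩
    exact hv y hy e
  let N : ℕ → Prop := fun y => ∃ c ∈ comp G (pathSet f m) v, G.Adj c (f y)
  have hNj : N j := ⟨v, ReflTransGen.refl, hjv.symm⟩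
  have between : ∀ a b y, a < y → y < b → b < m → j - 1 ≤ y → y ≤ j + 1 → N a → N b →
      ∀ x, (y = x ∨ y = x + 1) → HasAttachment G S f m x := by
    intro a b y hay hyb hb h1 h2 hNa hNb x hx
    obtain ⟨C, g, L, hC, hg, hn⟩ := h.exists_attachment_of_between hf hvP hay hyb hb (hS y h1 h2)
      hNa hNb
    refine ⟨C, g, L, hC, hg, fun c hc z hz hcz => ?_⟩
    rw [hn c hc z hz hcz]
    exact hx
  obtain ⟨g, L, hg⟩ := h.exists_leg (hf.isConn (by omega)) hvP
  have hself : ∀ x, (∀ y < m, N y → y = x ∨ y = x + 1) → HasAttachment G S f m x :=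
    fun x hx => ⟨_, g, L, isOff_comp hvP, hg, fun c hc y hy hcy => hx y hy ⟨c, hc, hcy⟩⟩
  by_cases hlow : ∃ a < j, N a
  · obtain ⟨a, haj, ha⟩ := hlow
    by_cases hhigh : ∃ b < m, j < b ∧ N b
    · obtain ⟨b, hbm, hjb, hb⟩ := hhigh
      exact ⟨j, by omega, le_rfl, between a b j haj hjb hbm (by omega) (by omega) ha hb _
        (Or.inl rfl)⟩
    · by_cases hfar : ∃ a, a + 1 < j ∧ N a
      · obtain ⟨a, haj, ha⟩ := hfar
        exact ⟨j - 1, by omega, by omega, between a j (j - 1) (by omega) (by omega) (by omega) le_rfl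
          (by omega) ha hNj _ (Or.inl rfl)⟩
      · refine ⟨j - 1, by omega, by omega, hself _ fun y hy hN => ?_⟩
        have h1 : ¬ j < y := fun h1 => hhigh ⟨y, hy, h1, hN⟩
        have h2 : ¬ y + 1 < j := fun h2 => hfar ⟨y, h2, hN⟩
        omega
  · by_cases hfar : ∃ b < m, j + 1 < b ∧ N b
    · obtain ⟨b, hbm, hjb, hb⟩ := hfar
      exact ⟨j, by omega, le_rfl, between j b (j + 1) (by omega) hjb hbm (by omega) le_rfl hNj hb _
        (Or.inr rfl)⟩
    · refine ⟨j, by omega, le_rfl, hself _ fun y hy hN => ?_⟩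
      have h1 : ¬ y < j := fun h1 => hlow ⟨y, h1, hN⟩
      have h2 : ¬ j + 1 < y := fun h2 => hfar ⟨y, hy, h2, hN⟩
      omega

/-- Legs `1, …, n` attached to a path at distinct places, in this order. -/
structure IsAttached (G : SimpleGraph V) (S : Set V) (f : ℕ → V) (m : ℕ) (C : ℕ → Set V)
    (g : ℕ → ℕ → V) (L x : ℕ → ℕ) (n : ℕ) : Prop where
  L_pos : ∀ i, 0 < L i
  off : ∀ i, 0 < i → i ≤ n → IsOff G (pathSet f m) (C i)
  leg : ∀ i, 0 < i → i ≤ n → IsLeg G S (pathSet f m) (C i) (g i) (L i)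
  nbr : ∀ i, 0 < i → i ≤ n → ∀ c ∈ C i, ∀ y < m, G.Adj c (f y) → y = x i ∨ y = x i + 1
  lt : ∀ i i', 0 < i → i < i' → i' ≤ n → x i + 2 ≤ x i'
  lt_m : ∀ i, 0 < i → i ≤ n → x i + 1 < m
  free : ∀ y, x 1 ≤ y → y ≤ x n + 1 → f y ∉ S

section IsAttached

variable {C : ℕ → Set V} {g : ℕ → ℕ → V} {L x : ℕ → ℕ} {n : ℕ}

theorem IsAttached.le (h : IsAttached G S f m C g L x n) {i i' : ℕ} (hi : 0 < i) (hii : i ≤ i')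
    (hi' : i' ≤ n) : x i ≤ x i' := by
  rcases hii.eq_or_lt with rfl | hlt
  · exact le_rfl
  · have := h.lt i i' hi hlt hi'
    omega

theorem IsAttached.comp_strictMono (h : IsAttached G S f m C g L x n) {ι : ℕ → ℕ} {n' : ℕ}
    (hn : 0 < n') (hι : ∀ i, 0 < i → i ≤ n' → 0 < ι i ∧ ι i ≤ n)
    (hlt : ∀ i i', 0 < i → i < i' → i' ≤ n' → ι i < ι i') :
    IsAttached G S f m (C ∘ ι) (g ∘ ι) (L ∘ ι) (x ∘ ι) n' where
  L_pos i := h.L_pos _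
  off i h0 h1 := h.off _ (hι i h0 h1).1 (hι i h0 h1).2
  leg i h0 h1 := h.leg _ (hι i h0 h1).1 (hι i h0 h1).2
  nbr i h0 h1 := h.nbr _ (hι i h0 h1).1 (hι i h0 h1).2
  lt i i' h0 h1 h2 := h.lt _ _ (hι i h0 (by omega)).1 (hlt i i' h0 h1 h2) (hι i' (by omega) h2).2
  lt_m i h0 h1 := h.lt_m _ (hι i h0 h1).1 (hι i h0 h1).2
  free y h0 h1 := by
    have h2 := hι 1 (by omega) (by omega)
    have h3 := hι n' (by omega) le_rfl
    have h4 : x 1 ≤ x (ι 1) := h.le (by omega) (by omega) h2.2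
    have h5 : x (ι n') ≤ x n := h.le h3.1 h3.2 le_rfl
    simp only [Function.comp_apply] at h0 h1
    exact h.free y (by omega) (by omega)

/-- The first vertex of leg `i` has a neighbour on the path near `x i`, where `C i'` has none
because of the gaps of two. From there on, the leg could enter `C i'` only through the path. -/
theorem IsAttached.notMem_other (h : IsAttached G S f m C g L x n) {i i' : ℕ} (hi : 0 < i)
    (hn : i ≤ n) (hi' : 0 < i') (hn' : i' ≤ n) (hne : i ≠ i') {j : ℕ} (hj : j < L i) :
    g i j ∉ C i' := by
  induction j with
  | zero =>
    intro hC
    obtain ⟨_, ⟨y, hy, rfl⟩, hadj⟩ := ((h.leg i hi hn).touch 0 hj).2 rfl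
    have h1 := h.nbr i hi hn _ ((h.leg i hi hn).mem 0 hj) y hy hadj
    have h2 := h.nbr i' hi' hn' _ hC y hy hadj
    rcases lt_or_gt_of_ne hne with hlt | hlt
    · have := h.lt i i' hi hlt hn'
      omega
    · have := h.lt i' i hi' hlt hn
      omega
  | succ j ih =>
    intro hC
    have hadj : G.Adj (g i (j + 1)) (g i j) :=
      (((h.leg i hi hn).path _ _ hj (by omega)).2).2 (Or.inr rfl)
    rcases (h.off i' hi' hn').closed _ hC _ hadj with h1 | h1
    · exact ih (by omega) h1
    · exact (h.off i hi hn).notMem _ ((h.leg i hi hn).mem j (by omega)) h1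

theorem IsAttached.separated (h : IsAttached G S f m C g L x n) {i i' : ℕ} (hi : 0 < i)
    (hn : i ≤ n) (hi' : 0 < i') (hn' : i' ≤ n) (hne : i ≠ i') {j j' : ℕ} (hj : j < L i)
    (hj' : j' < L i') : g i j ≠ g i' j' ∧ ¬ G.Adj (g i j) (g i' j') := by
  have h1 := h.notMem_other hi hn hi' hn' hne hj
  have h2 := (h.leg i' hi' hn').mem j' hj'
  refine ⟨fun e => h1 (e ▸ h2), fun hadj => ?_⟩
  rcases (h.off i' hi' hn').closed _ h2 _ hadj.symm with h3 | h3
  · exact h1 h3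
  · exact (h.off i hi hn).notMem _ ((h.leg i hi hn).mem j hj) h3

theorem IsAttached.spine_ne (h : IsAttached G S f m C g L x n) {i : ℕ} (hi : 0 < i)
    (hn : i ≤ n) {j : ℕ} (hj : j < L i) {y : ℕ} (hy : y < m) : g i j ≠ f y := fun e =>
  (h.off i hi hn).notMem _ ((h.leg i hi hn).mem j hj) (e ▸ ⟨y, hy, rfl⟩)

theorem IsAttached.adj_spine (h : IsAttached G S f m C g L x n) {i : ℕ} (hi : 0 < i)
    (hn : i ≤ n) {j : ℕ} (hj : j < L i) {y : ℕ} (hy : y < m) (hadj : G.Adj (g i j) (f y)) :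
    j = 0 ∧ (y = x i ∨ y = x i + 1) :=
  ⟨((h.leg i hi hn).touch j hj).1 ⟨f y, ⟨y, hy, rfl⟩, hadj⟩,
    h.nbr i hi hn _ ((h.leg i hi hn).mem j hj) y hy hadj⟩

/-- The legs and the part of the path from `f (k 1)` to `f (k n)` form a caterpillar, with the first
and the last leg continuing the path at its ends. -/
theorem IsAttached.hasModel_tree (h : IsAttached G S f m C g L x n) (hf : IsPathSeq G f m)
    (hn : 3 ≤ n) {k : ℕ → ℕ} (hk : ∀ i, 0 < i → i ≤ n → (k i = x i ∨ k i = x i + 1) ∧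
      ∀ y < m, (G.Adj (g i 0) (f y) ↔ y = k i)) : HasModel G S n := by
  have hk' : ∀ i i', 0 < i → i < i' → i' ≤ n → k i < k i' := by
    intro i i' h0 h1 h2
    have := h.lt i i' h0 h1 h2
    have := (hk i h0 (by omega)).1
    have := (hk i' (by omega) h2).1
    omega
  have hkm : k n < m := by
    have := h.lt_m n (by omega) le_rfl
    have := (hk n (by omega) le_rfl).1
    omega
  have hkle : ∀ i i', 0 < i → i ≤ i' → i' ≤ n → k i ≤ k i' := by
    intro i i' h0 h1 h2
    rcases h1.eq_or_lt with rfl | h1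
    · exact le_rfl
    · exact (hk' i i' h0 h1 h2).le
  let D : Comb := ⟨n, k n - k 1, L, fun i => if 0 < i ∧ i ≤ n then k i - k 1 else 0, h.L_pos, by
    intro i
    split_ifs with hi
    · have := hkle i n hi.1 hi.2 le_rfl
      omega
    · omega⟩
  have hDk : ∀ i, 0 < i → i ≤ n → D.k i = k i - k 1 := fun i h0 h1 => if_pos ⟨h0, h1⟩
  have hD : Comb.IsCat D := by
    refine ⟨hn, ?_, hDk n (by omega) le_rfl, fun i i' h0 h1 h2 => ?_⟩
    · rw [hDk 1 (by omega) (by omega)]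
      omega
    · change i' ≤ n at h2
      rw [hDk i h0 (by omega), hDk i' (by omega) h2]
      have := hk' i i' h0 h1 h2
      have := hkle 1 i (by omega) (by omega) (by omega)
      omega
  have hv : ∀ z : Comb.Vert.{u} D, (z.i = 0 ∧ z.j ≤ k n - k 1) ∨
      (0 < z.i ∧ z.i ≤ n ∧ z.j < L z.i) := fun z => z.valid
  have h1n := hkle 1 n (by omega) (by omega) le_rfl
  let F : ℕ → ℕ → V := fun i j => if i = 0 then f (k 1 + j) else g i j
  have hF0 : ∀ j, F 0 j = f (k 1 + j) := fun j => rfl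
  have hF1 : ∀ i, 0 < i → ∀ j, F i j = g i j := fun i hi j => if_neg hi.ne'
  have key : ∃ φ : Comb.tree.{u} D ↪g G, ∀ z, φ z = F z.i z.j := by
    refine Comb.exists_tree_embedding F ?_ ?_
    · rintro ⟨i, j, hxv⟩ ⟨i', j', hyv⟩ e
      have hx := hv ⟨i, j, hxv⟩
      have hy := hv ⟨i', j', hyv⟩
      dsimp only at *
      rcases hx with ⟨rfl, hx⟩ | ⟨hx1, hx2, hx3⟩ <;> rcases hy with ⟨rfl, hy⟩ | ⟨hy1, hy2, hy3⟩
      · rw [hF0, hF0] at e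
        have := (hf _ _ (by omega) (by omega)).1 e
        omega
      · rw [hF0, hF1 _ hy1] at e
        exact absurd e.symm (h.spine_ne hy1 hy2 hy3 (by omega))
      · rw [hF0, hF1 _ hx1] at e
        exact absurd e (h.spine_ne hx1 hx2 hx3 (by omega))
      · rw [hF1 _ hx1, hF1 _ hy1] at e
        by_cases hi : i = i'
        · subst hi
          exact ⟨rfl, ((h.leg i hx1 hx2).path _ _ hx3 hy3).1 e⟩
        · exact absurd e (h.separated hx1 hx2 hy1 hy2 hi hx3 hy3).1
    · have hcross : ∀ i j y, 0 < i → i ≤ n → j < L i → y ≤ k n - k 1 →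
          (G.Adj (g i j) (f (k 1 + y)) ↔ j = 0 ∧ y = D.k i) := by
        intro i j y h0 h1 hj hy
        have hk1 := hkle 1 i (by omega) (by omega) h1
        rw [hDk i h0 h1]
        constructor
        · intro hadj
          obtain ⟨rfl, -⟩ := h.adj_spine h0 h1 hj (by omega) hadj
          have := ((hk i h0 h1).2 (k 1 + y) (by omega)).1 hadj
          omega
        · rintro ⟨rfl, rfl⟩
          exact ((hk i h0 h1).2 _ (by omega)).2 (by omega)
      rintro ⟨i, j, hxv⟩ ⟨i', j', hyv⟩
      have hx := hv ⟨i, j, hxv⟩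
      have hy := hv ⟨i', j', hyv⟩
      dsimp only at hx hy ⊢
      clear hxv hyv
      rw [Comb.TreeAdj]
      rcases hx with ⟨rfl, hx⟩ | ⟨hx1, hx2, hx3⟩ <;> rcases hy with ⟨rfl, hy⟩ | ⟨hy1, hy2, hy3⟩
      · rw [hF0, hF0, (hf _ _ (by omega) (by omega)).2]
        omega
      · rw [hF0, hF1 _ hy1, G.adj_comm, hcross _ _ _ hy1 hy2 hy3 hx]
        omega
      · rw [hF0, hF1 _ hx1, hcross _ _ _ hx1 hx2 hx3 hy]
        omega
      · rw [hF1 _ hx1, hF1 _ hy1]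
        by_cases hi : i = i'
        · subst hi
          rw [((h.leg i hx1 hx2).path _ _ hx3 hy3).2]
          omega
        · refine iff_of_false (h.separated hx1 hx2 hy1 hy2 hi hx3 hy3).2 ?_
          omega
  obtain ⟨φ, hφ⟩ := key
  refine ⟨_, _, φ, hD.isModel_tree fun z => ?_⟩
  change φ z ∈ S ↔ _
  rw [hφ, Comb.IsTip]
  rcases hv z with ⟨h1, h2⟩ | ⟨h1, h2, h3⟩
  · rw [h1, hF0]
    refine iff_of_false (h.free _ ?_ ?_) (by simp)
    · have := (hk 1 (by omega) (by omega)).1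
      omega
    · have := (hk n (by omega) le_rfl).1
      omega
  · rw [hF1 _ h1, (h.leg _ h1 h2).mem_iff _ h3]
    exact ⟨fun e => ⟨h1, e⟩, fun e => e.2⟩

/-- The first vertex of each leg forms a triangle with an edge of the path, as in the line graph of
a caterpillar. Only `f (x 1 + 1), …, f (x n)` are kept, so the first and the last leg each retain a
single neighbour on the path. -/
theorem IsAttached.hasModel_line (h : IsAttached G S f m C g L x n) (hf : IsPathSeq G f m)
    (hn : 3 ≤ n) (hk : ∀ i, 0 < i → i ≤ n →
      G.Adj (g i 0) (f (x i)) ∧ G.Adj (g i 0) (f (x i + 1))) : HasModel G S n := by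
  have hxm : x n + 1 < m := h.lt_m n (by omega) le_rfl
  -- The spine vertex `j` stands for `f (x 1 + j)`; `j = 0` is the root, which is no vertex of the
  -- line graph, so `f (x 1)` drops out.
  let D : Comb := ⟨n, x n - x 1, L, fun i => if 0 < i ∧ i ≤ n then x i - x 1 else 0, h.L_pos, by
    intro i
    split_ifs with hi
    · have := h.le hi.1 hi.2 le_rfl
      omega
    · omega⟩
  have hDk : ∀ i, 0 < i → i ≤ n → D.k i = x i - x 1 := fun i h0 h1 => if_pos ⟨h0, h1⟩
  have hD : Comb.IsCat D := by
    refine ⟨hn, ?_, hDk n (by omega) le_rfl, fun i i' h0 h1 h2 => ?_⟩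
    · rw [hDk 1 (by omega) (by omega)]
      omega
    · change i' ≤ n at h2
      rw [hDk i h0 (by omega), hDk i' (by omega) h2]
      have := h.lt i i' h0 h1 h2
      have := h.le (i := 1) (i' := i) (by omega) (by omega) (by omega)
      omega
  have hv : ∀ z : Comb.Vert.{u} D, z ≠ D.root → (z.i = 0 ∧ 0 < z.j ∧ z.j ≤ x n - x 1) ∨
      (0 < z.i ∧ z.i ≤ n ∧ z.j < L z.i) := by
    intro z hz
    have h1 : (z.i = 0 ∧ z.j ≤ x n - x 1) ∨ (0 < z.i ∧ z.i ≤ n ∧ z.j < L z.i) := z.valid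
    have h2 := Comb.ne_iff.1 hz
    simp only [Comb.root, Comb.spine] at h2
    omega
  have h1n := h.le (i := 1) (i' := n) (by omega) (by omega) le_rfl
  let F : ℕ → ℕ → V := fun i j => if i = 0 then f (x 1 + j) else g i j
  have hF0 : ∀ j, F 0 j = f (x 1 + j) := fun j => rfl
  have hF1 : ∀ i, 0 < i → ∀ j, F i j = g i j := fun i hi j => if_neg hi.ne'
  have key : ∃ φ : Comb.line.{u} D ↪g G, ∀ z, φ z = F z.1.i z.1.j := by
    refine Comb.exists_line_embedding F ?_ ?_
    · rintro ⟨i, j, hxv⟩ ⟨i', j', hyv⟩ hxr hyr e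
      have hx := hv ⟨i, j, hxv⟩ hxr
      have hy := hv ⟨i', j', hyv⟩ hyr
      dsimp only at *
      rcases hx with ⟨rfl, hx0, hx⟩ | ⟨hx1, hx2, hx3⟩ <;>
        rcases hy with ⟨rfl, hy0, hy⟩ | ⟨hy1, hy2, hy3⟩
      · rw [hF0, hF0] at e
        have := (hf _ _ (by omega) (by omega)).1 e
        omega
      · rw [hF0, hF1 _ hy1] at e
        exact absurd e.symm (h.spine_ne hy1 hy2 hy3 (by omega))
      · rw [hF0, hF1 _ hx1] at e
        exact absurd e (h.spine_ne hx1 hx2 hx3 (by omega))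
      · rw [hF1 _ hx1, hF1 _ hy1] at e
        by_cases hi : i = i'
        · subst hi
          exact ⟨rfl, ((h.leg i hx1 hx2).path _ _ hx3 hy3).1 e⟩
        · exact absurd e (h.separated hx1 hx2 hy1 hy2 hi hx3 hy3).1
    · have hcross : ∀ i j y, 0 < i → i ≤ n → j < L i → y ≤ x n - x 1 →
          (G.Adj (g i j) (f (x 1 + y)) ↔ j = 0 ∧ (y = D.k i ∨ y = D.k i + 1)) := by
        intro i j y h0 h1 hj hy
        have hk1 := h.le (i := 1) (i' := i) (by omega) (by omega) h1
        rw [hDk i h0 h1]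
        constructor
        · intro hadj
          obtain ⟨rfl, h2⟩ := h.adj_spine h0 h1 hj (by omega) hadj
          omega
        · rintro ⟨rfl, rfl | rfl⟩
          · rw [show x 1 + (x i - x 1) = x i by omega]
            exact (hk i h0 h1).1
          · rw [show x 1 + (x i - x 1 + 1) = x i + 1 by omega]
            exact (hk i h0 h1).2
      rintro ⟨i, j, hxv⟩ ⟨i', j', hyv⟩ hxr hyr
      have hx := hv ⟨i, j, hxv⟩ hxr
      have hy := hv ⟨i', j', hyv⟩ hyr
      clear hxr hyr
      dsimp only at hx hy ⊢
      clear hxv hyv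
      rw [Comb.LineAdj]
      rcases hx with ⟨rfl, hx0, hx⟩ | ⟨hx1, hx2, hx3⟩ <;>
        rcases hy with ⟨rfl, hy0, hy⟩ | ⟨hy1, hy2, hy3⟩
      · rw [hF0, hF0, (hf _ _ (by omega) (by omega)).2]
        omega
      · rw [hF0, hF1 _ hy1, G.adj_comm, hcross _ _ _ hy1 hy2 hy3 hx]
        omega
      · rw [hF0, hF1 _ hx1, hcross _ _ _ hx1 hx2 hx3 hy]
        omega
      · rw [hF1 _ hx1, hF1 _ hy1]
        by_cases hi : i = i'
        · subst hi
          rw [((h.leg i hx1 hx2).path _ _ hx3 hy3).2]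
          omega
        · refine iff_of_false (h.separated hx1 hx2 hy1 hy2 hi hx3 hy3).2 ?_
          have hne : D.k i ≠ D.k i' := fun e => hi (hD.k_inj hx1 hx2 hy1 hy2 e)
          omega
  obtain ⟨φ, hφ⟩ := key
  refine ⟨_, _, φ, hD.isModel_line fun z => ?_⟩
  change φ z ∈ S ↔ _
  rw [hφ, Comb.IsTip]
  rcases hv z z.2 with ⟨h1, h0, h2⟩ | ⟨h1, h2, h3⟩
  · rw [h1, hF0]
    exact iff_of_false (h.free _ (by omega) (by omega)) (by simp)
  · rw [hF1 _ h1, (h.leg _ h1 h2).mem_iff _ h3]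
    exact ⟨fun e => ⟨h1, e⟩, fun e => e.2⟩

end IsAttached

end Connectifier

/-! ### Assembling the cases. -/

namespace Connectifier

open Relation

section Final

variable {V : Type u} {G : SimpleGraph V} {S : Set V} {f : ℕ → V} {m : ℕ}

/-- Among `2 * η` legs, `η` have first vertices adjacent to both possible path vertices, or `η` have
first vertices adjacent to exactly one. -/
theorem IsAttached.hasModel {C : ℕ → Set V} {g : ℕ → ℕ → V} {L x : ℕ → ℕ} {η : ℕ}
    (h : IsAttached G S f m C g L x (2 * η)) (hf : IsPathSeq G f m) (hη : 3 ≤ η) :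
    HasModel G S η := by
  classical
  let D : ℕ → Prop := fun i => G.Adj (g i 0) (f (x i)) ∧ G.Adj (g i 0) (f (x i + 1))
  have hcard := Finset.card_filter_add_card_filter_not (s := Finset.Icc 1 (2 * η)) D
  rw [Nat.card_Icc] at hcard
  have select : ∀ J : Finset ℕ, J ⊆ Finset.Icc 1 (2 * η) → η ≤ J.card → ∃ ι : ℕ → ℕ,
      (∀ i, 0 < i → i ≤ η → ι i ∈ J ∧ 0 < ι i ∧ ι i ≤ 2 * η) ∧
      ∀ i i', 0 < i → i < i' → i' ≤ η → ι i < ι i' := by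
    intro J hJ hc
    obtain ⟨e, he, hlt⟩ := exists_strictMono_enumeration hc
    refine ⟨fun i => e (i - 1), fun i h0 h1 => ?_, fun i i' h0 h1 h2 => hlt _ _ (by omega)
      (by omega)⟩
    have hm := he (i - 1) (by omega)
    have hI := Finset.mem_Icc.1 (hJ hm)
    exact ⟨hm, Nat.lt_of_lt_of_le one_pos hI.1, hI.2⟩
  rcases Nat.lt_or_ge ((Finset.Icc 1 (2 * η)).filter D).card η with hlt | hge
  · obtain ⟨ι, h1, h2⟩ := select _ (Finset.filter_subset (fun i => ¬ D i) _) (by omega)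
    have h' := h.comp_strictMono (by omega) (fun i h3 h4 => (h1 i h3 h4).2) h2
    refine h'.hasModel_tree hf hη
      (k := fun i => if G.Adj (g (ι i) 0) (f (x (ι i))) then x (ι i) else x (ι i) + 1) ?_
    intro i h3 h4
    have hD : ¬ D (ι i) := (Finset.mem_filter.1 (h1 i h3 h4).1).2
    have hL := h'.L_pos i
    obtain ⟨_, ⟨y0, hy0, rfl⟩, hadj0⟩ := ((h'.leg i h3 h4).touch 0 hL).2 rfl
    have hnbr : ∀ y < m, G.Adj (g (ι i) 0) (f y) → y = x (ι i) ∨ y = x (ι i) + 1 :=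
      fun y hy hadj => (h'.adj_spine h3 h4 hL hy hadj).2
    have hadj0 : G.Adj (g (ι i) 0) (f y0) := hadj0
    have h5 := hnbr y0 hy0 hadj0
    by_cases hx : G.Adj (g (ι i) 0) (f (x (ι i)))
    · simp only [if_pos hx, Function.comp_apply, true_or, true_and]
      refine fun y hy => ⟨fun hadj => ?_, fun e => e ▸ hx⟩
      refine (hnbr y hy hadj).resolve_right fun e => hD ⟨hx, e ▸ hadj⟩
    · simp only [if_neg hx, Function.comp_apply, or_true, true_and]
      refine fun y hy => ⟨fun hadj => ?_, fun e => ?_⟩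
      · exact (hnbr y hy hadj).resolve_left fun e => hx (e ▸ hadj)
      · rcases h5 with h5 | h5
        · exact absurd (h5 ▸ hadj0) hx
        · rw [e, ← h5]
          exact hadj0
  · obtain ⟨ι, h1, h2⟩ := select _ (Finset.filter_subset D _) hge
    have h' := h.comp_strictMono (by omega) (fun i h3 h4 => (h1 i h3 h4).2) h2
    exact h'.hasModel_line hf hη fun i h3 h4 => (Finset.mem_filter.1 (h1 i h3 h4).1).2

theorem IsTight.hasModel_of_special (h : IsTight G S) (hf : IsPathSeq G f m) {η : ℕ} (hη : 3 ≤ η)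
    {J : Finset ℕ} (hJ : η * (4 * (2 * η) + 4) + η ≤ J.card)
    (hsp : ∀ i ∈ J, i < m ∧ (f i ∈ S ∨ ∃ c, G.Adj (f i) c ∧ ∀ j < m, c ≠ f j)) :
    HasModel G S η := by
  classical
  by_cases hcount : η ≤ Nat.count (fun i => f i ∈ S) m
  · exact hasModel_of_path_of_le_count hf (by omega) hcount
  · obtain ⟨lo, hi, e, him, he, hlt, hfree⟩ := exists_free_interval (m := m) (n := 2 * η) (η := η)
      (A := fun i => f i ∈ S) (J := J) (fun j hj => (hsp j hj).1) (by omega) (by omega)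
    have hatt : ∀ i, ∃ x, 0 < i → i ≤ 2 * η → e i ≤ x + 1 ∧ x ≤ e i ∧ HasAttachment G S f m x := by
      intro i
      by_cases hi : 0 < i ∧ i ≤ 2 * η
      · obtain ⟨h1, h2, h3⟩ := he i hi.1 hi.2
        have hfr : ∀ y, e i - 1 ≤ y → y ≤ e i + 1 → f y ∉ S := fun y h4 h5 =>
          hfree y (by omega) (by omega)
        have hc := (hsp _ h1).2.resolve_left (hfr _ (by omega) (by omega))
        obtain ⟨x, hx⟩ := h.exists_attachment hf (by omega) (by omega) hfr hc
        exact ⟨x, fun _ _ => hx⟩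
      · exact ⟨0, fun h0 h1 => absurd ⟨h0, h1⟩ hi⟩
    choose x hx using hatt
    have hleg : ∀ i, ∃ C g L, 0 < L ∧ (0 < i → i ≤ 2 * η → IsOff G (pathSet f m) C ∧
        IsLeg G S (pathSet f m) C g L ∧
        ∀ c ∈ C, ∀ y < m, G.Adj c (f y) → y = x i ∨ y = x i + 1) := by
      intro i
      by_cases hi : 0 < i ∧ i ≤ 2 * η
      · obtain ⟨C, g, L, h1, h2, h3⟩ := (hx i hi.1 hi.2).2.2
        exact ⟨C, g, L, h2.pos, fun _ _ => ⟨h1, h2, h3⟩⟩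
      · exact ⟨∅, f, 1, one_pos, fun h0 h1 => absurd ⟨h0, h1⟩ hi⟩
    choose C g L hL hleg using hleg
    refine IsAttached.hasModel (C := C) (g := g) (L := L) (x := x) ⟨hL, fun i h0 h1 =>
      (hleg i h0 h1).1, fun i h0 h1 => (hleg i h0 h1).2.1, fun i h0 h1 => (hleg i h0 h1).2.2,
      ?_, ?_, ?_⟩ hf hη
    · intro i i' h0 h1 h2
      have h3 := hx i h0 (by omega)
      have h4 := hx i' (by omega) h2
      have h5 := hlt i i' h0 h1 h2
      omega
    · intro i h0 h1
      have h3 := hx i h0 h1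
      have h4 := he i h0 h1
      omega
    · intro y h0 h1
      have h3 := hx 1 (by omega) (by omega)
      have h4 := he 1 (by omega) (by omega)
      have h5 := hx (2 * η) (by omega) le_rfl
      have h6 := he (2 * η) (by omega) le_rfl
      exact hfree y (by omega) (by omega)

theorem IsTight.connected (h : IsTight G S) [Nonempty V] : G.Connected :=
  ⟨fun a b => (SimpleGraph.reachable_iff_reflTransGen a b).2 (h.reach a b)⟩

/-- Tight graphs with many vertices in `S` contain the desired induced subgraph. -/
theorem exists_bound_of_isTight (η : ℕ) (hη : 3 ≤ η) : ∃ N : ℕ, ∀ (V : Type u) [Finite V]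
    (G : SimpleGraph V) (S : Set V), IsTight G S → N + 1 ≤ S.ncard → HasModel G S η := by
  obtain ⟨Δ, hΔ⟩ := exists_degree_bound.{u} η hη
  obtain ⟨N, hN⟩ := exists_descent.{u} Δ (η * (4 * (2 * η) + 4) + η)
  refine ⟨N, fun V _ G S h hS => ?_⟩
  by_contra hcon
  obtain ⟨r, hr⟩ : S.Nonempty := (Set.ncard_pos (Set.toFinite _)).1 (by omega)
  have : Nonempty V := ⟨r⟩
  -- Seen from the root, all of `S` descends from `r`, which provides the `N` descendants that start
  -- the descent.
  have hdesc : descendants G S r r = S := by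
    ext s
    simp [descendants]
  obtain ⟨m, f, J, hJ, hf, hsp⟩ := (hN V G S r h.connected (hΔ V G S h hcon) r
    (by rw [hdesc]; omega)).exists_path h.connected
  exact hcon (h.hasModel_of_special hf hη hJ.ge hsp)

theorem hasModel_one {s : V} (hs : s ∈ S) : HasModel G S 1 := by
  classical
  refine hasModel_of_path_of_le_count (f := fun _ => s) (m := 1) (isPathSeq_of_lt ?_) le_rfl ?_
  · intro i j hij hj
    omega
  · rw [Nat.count_succ, if_pos hs]
    omega

/-- A shortest path from `s` to the rest of `S` has both of its ends in `S`. -/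
theorem hasModel_two {s t : V} (hs : s ∈ S) (ht : t ∈ S) (hst : s ≠ t)
    (h : ReflTransGen G.Adj s t) : HasModel G S 2 := by
  classical
  obtain ⟨n, f, h0, hn, hp, -, hA, -⟩ := exists_shortest_path (G := G) (D := Set.univ) (A := {s})
    (B := S \ {s}) rfl (Set.mem_univ _) ⟨ht, hst.symm⟩
    (ReflTransGen.mono (fun x y hxy => ⟨hxy, Set.mem_univ _⟩) _ _ h)
  have hne : n ≠ 0 := by
    rintro rfl
    exact hn.2 h0
  refine hasModel_of_path_of_le_count hp (by omega) ?_
  rw [Nat.count_succ, if_pos hn.1]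
  have h1 : Nat.count (fun i => f i ∈ S) 1 ≤ Nat.count (fun i => f i ∈ S) n :=
    Nat.count_monotone _ (by omega)
  have h0S : f 0 ∈ S := by rw [show f 0 = s from h0]; exact hs
  rw [Nat.count_succ, if_pos h0S] at h1
  omega

/-- A minimal connected induced subgraph containing `S` is tight. -/
theorem exists_isTight_induce [Finite V] {s0 : V} (_hs0 : s0 ∈ S) (c : G.ConnectedComponent)
    (hc : S ⊆ c.supp) : ∃ X : Set V, S ⊆ X ∧ IsTight (G.induce X) ((↑) ⁻¹' S : Set X) := by
  let p : Set V → Prop := fun X => S ⊆ X ∧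
    ∀ a ∈ X, ∀ b ∈ X, ReflTransGen (fun x y => G.Adj x y ∧ y ∈ X) a b
  have hp : p c.supp := by
    refine ⟨hc, fun a ha b hb => ?_⟩
    have hab : ReflTransGen G.Adj a b := (SimpleGraph.reachable_iff_reflTransGen a b).1
      (SimpleGraph.ConnectedComponent.exact (ha.trans hb.symm))
    clear hb
    induction hab with
    | refl => exact ReflTransGen.refl
    | @tail x y hx hxy ih =>
      refine ih.tail ⟨hxy, ?_⟩
      have hay : G.Reachable a y :=
        ((SimpleGraph.reachable_iff_reflTransGen a x).2 hx).trans hxy.reachable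
      exact (SimpleGraph.ConnectedComponent.sound hay).symm.trans ha
  obtain ⟨X, -, hX⟩ := exists_minimal_le_of_wellFoundedLT p c.supp hp
  refine ⟨X, hX.prop.1, ?_, ?_⟩
  · have lift : ∀ a b, ReflTransGen (fun x y => G.Adj x y ∧ y ∈ X) a b → ∀ ha : a ∈ X,
        ∃ hb : b ∈ X, ReflTransGen (G.induce X).Adj ⟨a, ha⟩ ⟨b, hb⟩ := by
      intro a b hab ha
      induction hab with
      | refl => exact ⟨ha, ReflTransGen.refl⟩
      | @tail x y hx hxy ih =>
        obtain ⟨hxX, ih⟩ := ih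
        exact ⟨hxy.2, ih.tail hxy.1⟩
    intro a b
    exact (lift a b (hX.prop.2 a a.2 b b.2) a.2).2
  · intro D hD hDS hcut x
    -- If the deletion of `D` left a connected graph, `X` without `D` would be a smaller candidate.
    have hpX : p {v | ∃ h : v ∈ X, (⟨v, h⟩ : X) ∉ D} := by
      refine ⟨fun s hs => ⟨hX.prop.1 hs, fun hsD => hDS _ hsD hs⟩, ?_⟩
      rintro a ⟨ha, haD⟩ b ⟨hb, hbD⟩
      refine ReflTransGen.lift Subtype.val ?_ _ _ (hcut _ haD _ hbD)
      intro u v huv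
      exact ⟨huv.1, v.2, huv.2⟩
    obtain ⟨d, hd⟩ := hD
    obtain ⟨_, hdD⟩ := hX.2 hpX (fun v hv => hv.1) d.2
    exact absurd hd hdD

end Final

end Connectifier

theorem theorem5p2 (η : ℕ) (hη : 1 ≤ η) :
    ∃ μ : ℕ, 1 ≤ μ ∧ ∀ (V : Type u) [Finite V] (G : SimpleGraph V) (S : Set V),
      μ ≤ S.ncard → (∃ c : G.ConnectedComponent, S ⊆ c.supp) →
      ∃ H : Set V, Connectifier.IsConnectifier G S η H ∧
        (G.induce H).Connected ∧ (H ∩ S).ncard = η ∧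
        ∀ v : H, (v : V) ∈ S → Connectifier.deg (G.induce H) v ≤ η := by
  open Connectifier in
  rcases (by omega : η = 1 ∨ η = 2 ∨ 3 ≤ η) with rfl | rfl | h3
  · refine ⟨1, le_rfl, fun V _ G S hS _ => ?_⟩
    obtain ⟨s, hs⟩ : S.Nonempty := (Set.ncard_pos (Set.toFinite _)).1 hS
    exact (hasModel_one hs).exists_connectifier
  · refine ⟨2, one_le_two, fun V _ G S hS ⟨c, hc⟩ => ?_⟩
    obtain ⟨s, t, hs, ht, hst⟩ := (Set.one_lt_ncard_iff (Set.toFinite _)).1 hS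
    exact (hasModel_two hs ht hst ((SimpleGraph.reachable_iff_reflTransGen s t).1
      (SimpleGraph.ConnectedComponent.exact ((hc hs).trans (hc ht).symm)))).exists_connectifier
  · obtain ⟨N, hN⟩ := exists_bound_of_isTight.{u} η h3
    refine ⟨N + 1, by omega, fun V _ G S hS ⟨c, hc⟩ => ?_⟩
    obtain ⟨s, hs⟩ : S.Nonempty := (Set.ncard_pos (Set.toFinite _)).1 (by omega)
    obtain ⟨X, hSX, hX⟩ := exists_isTight_induce hs c hc
    refine HasModel.exists_connectifier (HasModel.of_induce (hN X _ _ hX ?_))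
    rwa [← Set.ncard_image_of_injective _ Subtype.val_injective, Subtype.image_preimage_coe,
      Set.inter_eq_right.2 hSX]
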